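/- Let $\Gamma$ be a finite simple undirected graph with vertices $1,\dots,d$, and let $G_\Gamma$ be the pro-$2$ right-angled Artin group of $\Gamma$, i.e. the pro-$2$ group with generators $x_1,\dots,x_d$ and relators $[x_u,x_v]=x_u^{-1}x_v^{-1}x_ux_v$ for every edge $\{u,v\}$ of $\Gamma$. Let $\Delta$ be the group of order two, with generator $x_0$, let $\mathbf z=(z_1,\dots,z_d)\in G_\Gamma^{d}$, and suppose given an action $\delta\colon\Delta\to\mathrm{Aut}(G_\Gamma)$ by continuous automorphisms such that $\delta(x_0)(x_i)=z_i^{-1}x_i^{-1}z_i$ for $1\le i\le d$. Let $G_{\mathbf z}=G_\Gamma\rtimes_\delta\Delta$ (a $\Delta$-RAAG), in which $G_\Gamma$ is regarded as a subgroup. For a profinite group $G$ let $E(G)=\varprojlim_N\mathbb F_2[G/N]$ ($N$ open normal in $G$) be its completed group algebra over $\mathbb F_2$, let $E_n(G)$ be the $n$-th power of the augmentation ideal of $E(G)$, let $G_n=\{g\in G : g-1\in E_n(G)\}$ be the Zassenhaus filtration, and let $\mathcal L_n(G)=G_n/G_{n+1}$. Write $G_{\Gamma,n}$ and $G_{\mathbf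 z,n}$ for the terms of the Zassenhaus filtrations of $G_\Gamma$ and $G_{\mathbf z}$. Let $\mathcal L_\Gamma$ be the quotient of the free restricted Lie algebra over $\mathbb F_2$ on $X_1,\dots,X_d$ by the restricted ideal generated by the $[X_u,X_v]$ for the edges $\{u,v\}$ of $\Gamma$, graded by $\deg X_i=1$, and let $\mathcal L_{\Gamma,n}$ be its component of degree $n$. Then $G_{\Gamma,n}=G_{\mathbf z,n}$ for every integer $n\ge2$. Consequently, for every $n\ge 2$ there is an isomorphism of $\mathbb F_2$-vector spaces $$\mathcal L_n(G_{\mathbf z})=G_{\mathbf z,n}/G_{\mathbf z,n+1}\;\simeq\;\mathcal L_{\Gamma,n},$$ and these isomorphisms can be chosen compatibly, for $m,n\ge2$, with the Lie brackets $\mathcal L_m\times\mathcal L_n\to\mathcal L_{m+n}$ (induced on the group side by $(g,h)\mapsto g^{-1}h^{-1}gh$) and with the $2$-power maps $\mathcal L_n\to\mathcal L_{2n}$ (induced on the group side by $g\mapsto g^2$). -/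

import Mathlib

noncomputable section

/-! ## Pro-`2` completions, free pro-`2` groups and pro-`2` right-angled Artin groups -/

/-- Normal subgroups of (finite) `2`-power index of an abstract group. -/
structure TwoPowerNormalSubgroup (A : Type*) [Group A] where
  /-- the underlying subgroup -/
  carrier : Subgroup A
  normal : carrier.Normal
  index_eq : ∃ k : ℕ, carrier.index = 2 ^ k

/-- The finite `2`-group `A / N`, as a discrete group. -/
def FiniteTwoQuotient {A : Type*} [Group A] (N : TwoPowerNormalSubgroup A) : Type _ :=
  A ⧸ N.carrier

namespace FiniteTwoQuotient

variable {A : Type*} [Group A] (N : TwoPowerNormalSubgroup A)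

instance : Group (FiniteTwoQuotient N) :=
  haveI := N.normal
  inferInstanceAs (Group (A ⧸ N.carrier))

instance : TopologicalSpace (FiniteTwoQuotient N) := ⊥

instance : DiscreteTopology (FiniteTwoQuotient N) := ⟨rfl⟩

/-- The projection `A → A / N`. -/
def proj : A →* FiniteTwoQuotient N :=
  haveI := N.normal
  QuotientGroup.mk' N.carrier

/-- The transition map `A / N → A / M` for `N ≤ M`. -/
def transition {N M : TwoPowerNormalSubgroup A} (h : N.carrier ≤ M.carrier) :
    FiniteTwoQuotient N →* FiniteTwoQuotient M :=
  haveI := N.normal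
  haveI := M.normal
  QuotientGroup.map N.carrier M.carrier (MonoidHom.id A) h

end FiniteTwoQuotient

/-- The pro-`2` completion `lim A / N` of an abstract group `A`, realised as the group of
compatible families in `∏ A / N`, where `N` runs over the normal subgroups of `2`-power index.
Its topology is the subspace topology of the product of the discrete groups `A / N`. -/
def proTwoCompletion (A : Type*) [Group A] :
    Subgroup (∀ N : TwoPowerNormalSubgroup A, FiniteTwoQuotient N) where
  carrier := {f | ∀ (N M : TwoPowerNormalSubgroup A) (h : N.carrier ≤ M.carrier),
    FiniteTwoQuotient.transition h (f N) = f M}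
  mul_mem' {f g} hf hg N M h := by
    simp only [Pi.mul_apply, map_mul, hf N M h, hg N M h]
  one_mem' N M h := by simp only [Pi.one_apply, map_one]
  inv_mem' {f} hf N M h := by simp only [Pi.inv_apply, map_inv, hf N M h]

/-- The canonical map from `A` to its pro-`2` completion. -/
def toProTwoCompletion (A : Type*) [Group A] : A →* proTwoCompletion A where
  toFun a := ⟨fun N => FiniteTwoQuotient.proj N a, fun _ _ _ => rfl⟩
  map_one' := Subtype.ext (funext fun _ => map_one _)
  map_mul' a b := Subtype.ext (funext fun _ => map_mul _ a b)

/-- The free pro-`2` group on `d` generators. -/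
abbrev FreeProTwoGroup (d : ℕ) : Type := proTwoCompletion (FreeGroup (Fin d))

namespace ProTwoRAAG

variable {d : ℕ} (Γ : SimpleGraph (Fin d))

/-- The relators `[x_u, x_v] = x_u⁻¹ x_v⁻¹ x_u x_v`, for `{u, v}` an edge. -/
def relators : Set (FreeProTwoGroup d) :=
  {r | ∃ u v : Fin d, Γ.Adj u v ∧
    r = toProTwoCompletion _ ((FreeGroup.of u)⁻¹ * (FreeGroup.of v)⁻¹ *
      FreeGroup.of u * FreeGroup.of v)}

/-- The closed normal subgroup generated by the relators. -/
def relationSubgroup : Subgroup (FreeProTwoGroup d) :=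
  (Subgroup.normalClosure (relators Γ)).topologicalClosure

instance : (relationSubgroup Γ).Normal :=
  Subgroup.is_normal_topologicalClosure (Subgroup.normalClosure (relators Γ))

end ProTwoRAAG

/-- The pro-`2` right-angled Artin group `G_Γ`, given by the pro-`2` presentation with
generators the vertices of `Γ` and relators the commutators of adjacent vertices. -/
abbrev ProTwoRAAG {d : ℕ} (Γ : SimpleGraph (Fin d)) : Type :=
  FreeProTwoGroup d ⧸ ProTwoRAAG.relationSubgroup Γ

/-- The canonical generator `x_i` of `G_Γ`. -/
def ProTwoRAAG.gen {d : ℕ} (Γ : SimpleGraph (Fin d)) (i : Fin d) : ProTwoRAAG Γ :=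
  QuotientGroup.mk (toProTwoCompletion _ (FreeGroup.of i))

/-! ## `Δ`-RAAGs -/

/-- The multiplicative group `Δ` of order two. -/
abbrev DeltaGroup : Type := Multiplicative (ZMod 2)

/-- The generator `x₀` of `Δ`. -/
def DeltaGroup.x₀ : DeltaGroup := Multiplicative.ofAdd 1

/-- The action `δ_z` of `Δ` on `G_Γ`: an action by automorphisms of topological groups such
that `δ_z(x₀)(x_i) = z_i⁻¹ x_i⁻¹ z_i` for every `i`. -/
structure IsDeltaRAAGAction {d : ℕ} (Γ : SimpleGraph (Fin d)) (z : Fin d → ProTwoRAAG Γ)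
    (δ : DeltaGroup →* MulAut (ProTwoRAAG Γ)) : Prop where
  continuous : ∀ a : DeltaGroup, Continuous (δ a)
  conj : ∀ i : Fin d, δ DeltaGroup.x₀ (ProTwoRAAG.gen Γ i) =
    (z i)⁻¹ * (ProTwoRAAG.gen Γ i)⁻¹ * z i

/-- The product topology on a semidirect product. -/
instance SemidirectProduct.instTopologicalSpaceProd {N H : Type*} [Group N] [Group H]
    [TopologicalSpace N] [TopologicalSpace H] (φ : H →* MulAut N) :
    TopologicalSpace (N ⋊[φ] H) :=
  TopologicalSpace.induced (fun g => (g.left, g.right)) inferInstance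

/-- The semidirect product `G_z = G_Γ ⋊ Δ`. -/
abbrev DeltaRAAG {d : ℕ} (Γ : SimpleGraph (Fin d))
    (δ : DeltaGroup →* MulAut (ProTwoRAAG Γ)) : Type :=
  ProTwoRAAG Γ ⋊[δ] DeltaGroup

/-! ## Completed group algebras and the Zassenhaus filtration -/

section Zassenhaus

variable (G : Type*) [Group G] [TopologicalSpace G]

variable {G} in
/-- The transition map `𝔽₂[G/N] → 𝔽₂[G/M]` for open normal subgroups `N ≤ M`. -/
def groupAlgebraTransition {N M : OpenNormalSubgroup G}
    (h : N.toSubgroup ≤ M.toSubgroup) :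
    MonoidAlgebra (ZMod 2) (G ⧸ N.toSubgroup) →ₐ[ZMod 2]
      MonoidAlgebra (ZMod 2) (G ⧸ M.toSubgroup) :=
  MonoidAlgebra.mapDomainAlgHom (ZMod 2) (ZMod 2)
    (QuotientGroup.map N.toSubgroup M.toSubgroup (MonoidHom.id G) h)

/-- The completed group algebra `E(G) = lim 𝔽₂[G/N]` over the open normal subgroups `N`,
realised as the algebra of compatible families. -/
def completedGroupAlgebra :
    Subalgebra (ZMod 2)
      (∀ N : OpenNormalSubgroup G, MonoidAlgebra (ZMod 2) (G ⧸ N.toSubgroup)) where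
  carrier := {f | ∀ (N M : OpenNormalSubgroup G) (h : N.toSubgroup ≤ M.toSubgroup),
    groupAlgebraTransition h (f N) = f M}
  mul_mem' {f g} hf hg N M h := by
    simp only [Pi.mul_apply, map_mul, hf N M h, hg N M h]
  add_mem' {f g} hf hg N M h := by
    simp only [Pi.add_apply, map_add, hf N M h, hg N M h]
  algebraMap_mem' r N M h := by
    simp only [Pi.algebraMap_apply, AlgHom.commutes]

/-- The canonical map `G → E(G)`. -/
def toCompletedGroupAlgebra : G →* completedGroupAlgebra G where
  toFun g := ⟨fun N => MonoidAlgebra.of (ZMod 2) (G ⧸ N.toSubgroup) (QuotientGroup.mk g),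
    fun N M h => by
      simp only [groupAlgebraTransition, MonoidAlgebra.of_apply,
        MonoidAlgebra.mapDomainAlgHom_apply, MonoidAlgebra.mapDomain_single]
      rfl⟩
  map_one' := Subtype.ext (funext fun N => by
    simp [MonoidAlgebra.one_def])
  map_mul' a b := Subtype.ext (funext fun N => by
    simp [MonoidAlgebra.single_mul_single])

/-- The augmentation `E(G) → 𝔽₂`: the sum of the coefficients of any component; here the
component at the open normal subgroup `G` is used. -/
def completedAugmentation : completedGroupAlgebra G →ₐ[ZMod 2] ZMod 2 :=
  ((MonoidAlgebra.lift (ZMod 2) (ZMod 2) (G ⧸ (⊤ : Subgroup G)) 1).comp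
    (Pi.evalAlgHom (ZMod 2)
      (fun N : OpenNormalSubgroup G => MonoidAlgebra (ZMod 2) (G ⧸ N.toSubgroup))
      ⟨⊤, inferInstanceAs (⊤ : Subgroup G).Normal⟩)).comp
    (completedGroupAlgebra G).val

/-- The augmentation ideal of `E(G)` (a two-sided ideal). -/
def completedAugmentationIdeal : Ideal (completedGroupAlgebra G) :=
  RingHom.ker (completedAugmentation G)

instance : (completedAugmentationIdeal G).IsTwoSided :=
  inferInstanceAs (RingHom.ker (completedAugmentation G)).IsTwoSided

variable {G} in
theorem toCompletedGroupAlgebra_sub_one_mem (g : G) :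
    toCompletedGroupAlgebra G g - 1 ∈ completedAugmentationIdeal G := by
  rw [completedAugmentationIdeal, RingHom.mem_ker, map_sub, map_one, sub_eq_zero]
  simp [completedAugmentation, toCompletedGroupAlgebra]

/-- The Zassenhaus filtration `G_n = {g ∈ G | g - 1 ∈ E_n(G)}`, where `E_n(G)` is the `n`-th
power of the augmentation ideal of `E(G)`. -/
def zassenhaus (n : ℕ) : Subgroup G where
  carrier := {g | toCompletedGroupAlgebra G g - 1 ∈ completedAugmentationIdeal G ^ n}
  one_mem' := by simp
  mul_mem' {a b} ha hb := by
    have h : toCompletedGroupAlgebra G (a * b) - 1 =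
        toCompletedGroupAlgebra G a * (toCompletedGroupAlgebra G b - 1) +
          (toCompletedGroupAlgebra G a - 1) := by
      rw [map_mul, mul_sub, mul_one, sub_add_sub_cancel]
    rw [Set.mem_ofPred_eq, h]
    exact add_mem (Ideal.mul_mem_left _ _ hb) ha
  inv_mem' {a} ha := by
    have h : toCompletedGroupAlgebra G a⁻¹ - 1 =
        -(toCompletedGroupAlgebra G a⁻¹ * (toCompletedGroupAlgebra G a - 1)) := by
      rw [mul_sub, ← map_mul]; simp
    rw [Set.mem_ofPred_eq, h]
    exact neg_mem (Ideal.mul_mem_left _ _ ha)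

variable {G}

theorem mem_zassenhaus {n : ℕ} {g : G} : g ∈ zassenhaus G n ↔
    toCompletedGroupAlgebra G g - 1 ∈ completedAugmentationIdeal G ^ n := Iff.rfl

instance (n : ℕ) : (zassenhaus G n).Normal where
  conj_mem a ha g := by
    rw [mem_zassenhaus] at ha ⊢
    have h : toCompletedGroupAlgebra G (g * a * g⁻¹) - 1 =
        toCompletedGroupAlgebra G g * (toCompletedGroupAlgebra G a - 1) *
          toCompletedGroupAlgebra G g⁻¹ := by
      rw [mul_sub, sub_mul, ← map_mul, ← map_mul, mul_one, ← map_mul]; simp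
    rw [h]
    exact Ideal.mul_mem_right _ _ (Ideal.mul_mem_left _ _ ha)

theorem mul_mem_completedAugmentationIdeal_pow {m n : ℕ} {a b : completedGroupAlgebra G}
    (ha : a ∈ completedAugmentationIdeal G ^ m) (hb : b ∈ completedAugmentationIdeal G ^ n) :
    a * b ∈ completedAugmentationIdeal G ^ (m + n) := by
  rw [Ideal.IsTwoSided.pow_add]
  exact Ideal.mul_mem_mul ha hb

theorem ring_commutator_identity {R : Type*} [Ring R] (a b : R) :
    (a - 1) * (b - 1) - (b - 1) * (a - 1) = a * b - b * a := by
  simp only [mul_sub, sub_mul, mul_one, one_mul]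
  abel

/-- `[G_m, G_n] ⊆ G_{m+n}`. -/
theorem commutator_mem_zassenhaus {m n : ℕ} {g h : G}
    (hg : g ∈ zassenhaus G m) (hh : h ∈ zassenhaus G n) :
    g⁻¹ * h⁻¹ * g * h ∈ zassenhaus G (m + n) := by
  rw [mem_zassenhaus] at hg hh ⊢
  have key : toCompletedGroupAlgebra G (g⁻¹ * h⁻¹ * g * h) - 1 =
      toCompletedGroupAlgebra G (g⁻¹ * h⁻¹) *
        ((toCompletedGroupAlgebra G g - 1) * (toCompletedGroupAlgebra G h - 1) -
          (toCompletedGroupAlgebra G h - 1) * (toCompletedGroupAlgebra G g - 1)) := by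
    have e1 : g⁻¹ * h⁻¹ * (h * g) = 1 := by group
    rw [ring_commutator_identity, ← map_mul, ← map_mul, mul_sub, ← map_mul, ← map_mul, e1,
      map_one, ← mul_assoc]
  rw [key]
  refine Ideal.mul_mem_left _ _ (sub_mem (mul_mem_completedAugmentationIdeal_pow hg hh) ?_)
  rw [add_comm]
  exact mul_mem_completedAugmentationIdeal_pow hh hg

/-- `(G_n)² ⊆ G_{2n}`. -/
theorem sq_mem_zassenhaus {n : ℕ} {g : G} (hg : g ∈ zassenhaus G n) :
    g * g ∈ zassenhaus G (n + n) := by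
  rw [mem_zassenhaus] at hg ⊢
  have two : (2 : completedGroupAlgebra G) = 0 := by
    have := map_ofNat (algebraMap (ZMod 2) (completedGroupAlgebra G)) 2
    rw [← this, show (OfNat.ofNat 2 : ZMod 2) = 0 from rfl, map_zero]
  have key : toCompletedGroupAlgebra G (g * g) - 1 =
      (toCompletedGroupAlgebra G g - 1) * (toCompletedGroupAlgebra G g - 1) := by
    have : toCompletedGroupAlgebra G (g * g) - 1 =
      (toCompletedGroupAlgebra G g - 1) * (toCompletedGroupAlgebra G g - 1) +
        2 * (toCompletedGroupAlgebra G g - 1) := by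
      rw [map_mul, two_mul]
      simp only [mul_sub, sub_mul, mul_one, one_mul]
      abel
    rw [this, two, zero_mul, add_zero]
  rw [key]
  exact mul_mem_completedAugmentationIdeal_pow hg hg

variable (G) in
/-- The graded piece `ℒ_n(G) = G_n / G_{n+1}`, written additively. -/
abbrev zassenhausGraded (n : ℕ) : Type _ :=
  Additive (zassenhaus G n ⧸ (zassenhaus G (n + 1)).subgroupOf (zassenhaus G n))

/-- The class in `ℒ_n(G)` of an element of `G_n`. -/
def zassenhausClass {n : ℕ} (g : G) (hg : g ∈ zassenhaus G n) : zassenhausGraded G n :=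
  Additive.ofMul (QuotientGroup.mk ⟨g, hg⟩)

end Zassenhaus

/-! ## Restricted Lie algebras over `𝔽₂` -/

/-- A restricted Lie algebra over `𝔽₂`: a Lie algebra with a `2`-power map `x ↦ x^{[2]}`.
(Compatibility with scalars in `𝔽₂` is automatic.) -/
class RestrictedLieAlgebraTwo (L : Type*) [LieRing L] [LieAlgebra (ZMod 2) L] where
  /-- the `2`-power map -/
  sq : L → L
  sq_lie : ∀ x y : L, ⁅sq x, y⁆ = ⁅x, ⁅x, y⁆⁆
  sq_add : ∀ x y : L, sq (x + y) = sq x + sq y + ⁅x, y⁆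

namespace FreeRestrictedLieTwo

/-- Formal expressions in the operations of a restricted Lie algebra over `𝔽₂`. -/
inductive Term (X : Type*) : Type _
  | of : X → Term X
  | zero : Term X
  | add : Term X → Term X → Term X
  | lie : Term X → Term X → Term X
  | sq : Term X → Term X

/-- The congruence on formal expressions generated by the axioms of restricted Lie algebras
over `𝔽₂`. -/
inductive Rel (X : Type*) : Term X → Term X → Prop
  | refl (a) : Rel X a a
  | symm {a b} : Rel X a b → Rel X b a
  | trans {a b c} : Rel X a b → Rel X b c → Rel X a c
  | add_congr {a a' b b'} : Rel X a a' → Rel X b b' → Rel X (.add a b) (.add a' b')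
  | lie_congr {a a' b b'} : Rel X a a' → Rel X b b' → Rel X (.lie a b) (.lie a' b')
  | sq_congr {a a'} : Rel X a a' → Rel X (.sq a) (.sq a')
  | add_assoc (a b c) : Rel X (.add (.add a b) c) (.add a (.add b c))
  | add_comm (a b) : Rel X (.add a b) (.add b a)
  | zero_add (a) : Rel X (.add .zero a) a
  | add_self (a) : Rel X (.add a a) .zero
  | add_lie (a b c) : Rel X (.lie (.add a b) c) (.add (.lie a c) (.lie b c))
  | lie_add (a b c) : Rel X (.lie a (.add b c)) (.add (.lie a b) (.lie a c))
  | lie_self (a) : Rel X (.lie a a) .zero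
  | leibniz (a b c) :
      Rel X (.lie a (.lie b c)) (.add (.lie (.lie a b) c) (.lie b (.lie a c)))
  | sq_lie (a b) : Rel X (.lie (.sq a) b) (.lie a (.lie a b))
  | sq_add (a b) : Rel X (.sq (.add a b)) (.add (.add (.sq a) (.sq b)) (.lie a b))

/-- The setoid of the congruence `Rel`. -/
def setoid (X : Type*) : Setoid (Term X) := ⟨Rel X, .refl, .symm, .trans⟩

end FreeRestrictedLieTwo

open FreeRestrictedLieTwo in
/-- The free restricted Lie algebra over `𝔽₂` on a set `X`. -/
def FreeRestrictedLieTwo (X : Type*) : Type _ := Quotient (FreeRestrictedLieTwo.setoid X)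

namespace FreeRestrictedLieTwo

variable {X : Type*}

/-- The canonical generator attached to `x : X`. -/
def of (x : X) : FreeRestrictedLieTwo X := Quotient.mk (setoid X) (.of x)

instance : Add (FreeRestrictedLieTwo X) :=
  ⟨Quotient.map₂ (sa := setoid X) (sb := setoid X) (sc := setoid X) Term.add
    (fun _ _ h _ _ h' => .add_congr h h')⟩

instance : Zero (FreeRestrictedLieTwo X) := ⟨Quotient.mk (setoid X) .zero⟩

instance : Neg (FreeRestrictedLieTwo X) := ⟨fun a => a⟩

instance : AddCommGroup (FreeRestrictedLieTwo X) where
  nsmul := nsmulRec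
  zsmul := zsmulRec (nsmul := nsmulRec)
  add_assoc := by rintro ⟨a⟩ ⟨b⟩ ⟨c⟩; exact Quotient.sound (.add_assoc a b c)
  zero_add := by rintro ⟨a⟩; exact Quotient.sound (.zero_add a)
  add_zero := by rintro ⟨a⟩; exact Quotient.sound (.trans (.add_comm _ _) (.zero_add a))
  neg_add_cancel := by rintro ⟨a⟩; exact Quotient.sound (.add_self a)
  add_comm := by rintro ⟨a⟩ ⟨b⟩; exact Quotient.sound (.add_comm a b)

theorem add_self (a : FreeRestrictedLieTwo X) : a + a = 0 := by
  obtain ⟨a⟩ := a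
  exact Quotient.sound (.add_self a)

instance : Module (ZMod 2) (FreeRestrictedLieTwo X) :=
  AddCommGroup.zmodModule fun x => by rw [two_nsmul, add_self]

instance : LieRing (FreeRestrictedLieTwo X) where
  bracket := Quotient.map₂ (sa := setoid X) (sb := setoid X) (sc := setoid X) Term.lie
    (fun _ _ h _ _ h' => .lie_congr h h')
  add_lie := by rintro ⟨a⟩ ⟨b⟩ ⟨c⟩; exact Quotient.sound (.add_lie a b c)
  lie_add := by rintro ⟨a⟩ ⟨b⟩ ⟨c⟩; exact Quotient.sound (.lie_add a b c)
  lie_self := by rintro ⟨a⟩; exact Quotient.sound (.lie_self a)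
  leibniz_lie := by rintro ⟨a⟩ ⟨b⟩ ⟨c⟩; exact Quotient.sound (.leibniz a b c)

instance : LieAlgebra (ZMod 2) (FreeRestrictedLieTwo X) where
  lie_smul t x y := ZMod.map_smul
    (AddMonoidHom.mk' (fun y => ⁅x, y⁆) (fun a b => lie_add x a b)) t y

instance : RestrictedLieAlgebraTwo (FreeRestrictedLieTwo X) where
  sq := Quotient.map (sa := setoid X) (sb := setoid X) Term.sq (fun _ _ h => .sq_congr h)
  sq_lie := by rintro ⟨a⟩ ⟨b⟩; exact Quotient.sound (.sq_lie a b)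
  sq_add := by rintro ⟨a⟩ ⟨b⟩; exact Quotient.sound (.sq_add a b)

/-- Homogeneous elements of degree `n` of the free restricted Lie algebra, where the
generators have degree `1`. -/
inductive IsHomogeneous : ℕ → FreeRestrictedLieTwo X → Prop
  | of (x : X) : IsHomogeneous 1 (of x)
  | zero (n : ℕ) : IsHomogeneous n 0
  | add {n : ℕ} {a b} : IsHomogeneous n a → IsHomogeneous n b → IsHomogeneous n (a + b)
  | lie {m n : ℕ} {a b} : IsHomogeneous m a → IsHomogeneous n b → IsHomogeneous (m + n) ⁅a, b⁆
  | sq {n : ℕ} {a} : IsHomogeneous n a →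
      IsHomogeneous (n + n) (RestrictedLieAlgebraTwo.sq a)

/-- The component of degree `n` of the free restricted Lie algebra. -/
def component (X : Type*) (n : ℕ) : AddSubgroup (FreeRestrictedLieTwo X) where
  carrier := {a | IsHomogeneous n a}
  zero_mem' := .zero n
  add_mem' := .add
  neg_mem' := id

end FreeRestrictedLieTwo

section RestrictedQuotient

variable {L : Type*} [LieRing L] [LieAlgebra (ZMod 2) L] [RestrictedLieAlgebraTwo L]

/-- The restricted Lie ideal generated by a set `S`: the smallest Lie ideal which contains `S`
and is stable under the `2`-power map. -/
def restrictedIdealSpan (S : Set L) : LieIdeal (ZMod 2) L :=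
  sInf {I | S ⊆ I ∧ ∀ x ∈ I, RestrictedLieAlgebraTwo.sq x ∈ I}

theorem sq_mem_restrictedIdealSpan (S : Set L) {x : L} (hx : x ∈ restrictedIdealSpan S) :
    RestrictedLieAlgebraTwo.sq x ∈ restrictedIdealSpan S := by
  rw [restrictedIdealSpan, ← SetLike.mem_coe, LieSubmodule.coe_sInf, Set.mem_iInter₂] at hx ⊢
  exact fun I hI => hI.2 x (hx I hI)

instance restrictedQuotient (S : Set L) :
    RestrictedLieAlgebraTwo (L ⧸ restrictedIdealSpan S) where
  sq := Quotient.map' RestrictedLieAlgebraTwo.sq (by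
    intro a b hab
    rw [Submodule.quotientRel_def] at hab ⊢
    have h : RestrictedLieAlgebraTwo.sq a - RestrictedLieAlgebraTwo.sq b =
        RestrictedLieAlgebraTwo.sq (a - b) + ⁅a - b, b⁆ := by
      conv_lhs => rw [← sub_add_cancel a b, RestrictedLieAlgebraTwo.sq_add]
      abel
    rw [h]
    exact add_mem (sq_mem_restrictedIdealSpan S hab)
      (lie_mem_left (ZMod 2) L (restrictedIdealSpan S) _ _ hab))
  sq_lie := by
    rintro ⟨a⟩ ⟨b⟩
    exact congrArg (LieSubmodule.Quotient.mk (N := restrictedIdealSpan S))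
      (RestrictedLieAlgebraTwo.sq_lie a b)
  sq_add := by
    rintro ⟨a⟩ ⟨b⟩
    exact congrArg (LieSubmodule.Quotient.mk (N := restrictedIdealSpan S))
      (RestrictedLieAlgebraTwo.sq_add a b)

end RestrictedQuotient

/-- The restricted Lie algebra `ℒ_Γ`: the quotient of the free restricted Lie algebra over `𝔽₂`
on the vertices of `Γ` by the restricted ideal generated by the `[X_u, X_v]`, `{u, v}` an edge. -/
abbrev graphLie {d : ℕ} (Γ : SimpleGraph (Fin d)) : Type :=
  FreeRestrictedLieTwo (Fin d) ⧸ restrictedIdealSpan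
    {r : FreeRestrictedLieTwo (Fin d) | ∃ u v : Fin d, Γ.Adj u v ∧
      r = ⁅FreeRestrictedLieTwo.of u, FreeRestrictedLieTwo.of v⁆}

/-- The component `ℒ_{Γ,n}` of degree `n` of `ℒ_Γ`. -/
def graphLieComponent {d : ℕ} (Γ : SimpleGraph (Fin d)) (n : ℕ) : AddSubgroup (graphLie Γ) where
  carrier := {y | ∃ a ∈ FreeRestrictedLieTwo.component (Fin d) n,
    LieSubmodule.Quotient.mk a = y}
  zero_mem' := ⟨0, zero_mem _, rfl⟩
  add_mem' := by
    rintro _ _ ⟨a, ha, rfl⟩ ⟨b, hb, rfl⟩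
    exact ⟨a + b, add_mem ha hb, rfl⟩
  neg_mem' := by
    rintro _ ⟨a, ha, rfl⟩
    exact ⟨-a, neg_mem ha, rfl⟩

end

noncomputable section

set_option linter.unusedSectionVars false

/-! Let `A` be the associative `𝔽₂`-algebra on the vertices in which adjacent vertices commute
(`GraphAlgebra`), and `I` its augmentation ideal. The argument compares three objects: the group
`G_Γ`, the graded algebra `A`, and `ℒ_Γ`, which turns out to be the Lie algebra of primitive
elements of `A`.

Group and algebra. The assignment `x_i ↦ 1 + X_i` defines truncated Magnus representations `μ_n :
G_Γ → (A/I^(n+1))ˣ`; they exist because the target is a finite `2`-group. They extend to `E(G_Γ)`,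
and `X_i ↦ x_i - 1` goes the other way. The elements `x_i - 1` generate the augmentation ideal of
`E(G_Γ)` as a left ideal (by compactness, `CompletedGroupAlgebra.exists_eq_sum`), so the two maps
identify `E(G_Γ)/E_(n+1)(G_Γ)` with `A/I^(n+1)`. Hence `G_(Γ,n+1) = ker μ_n`
(`mem_zassenhaus_succ`), and for `n ≥ 1` the leading term `lead n` embeds `G_(Γ,n)/G_(Γ,n+1)` in the
degree `n` part of `A`, turning commutators into brackets and squares into squares.

Algebra and Lie algebra. A restricted Poincaré–Birkhoff–Witt theorem shows that `ℒ_Γ` embeds in `A`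
(`ofLie_injective`), with the ordered squarefree monomials in a basis of `ℒ_Γ` as a basis of `A`.
The coproduct has a simple form in this basis, so every primitive element of `A` comes from `ℒ_Γ`
(`exists_ofLie_eq_of_primitive`). Leading terms are primitive: the coproduct deforms, with a
parameter `t`, to one for which the elements `1 + t X_i` are group-like, and the lowest term of a
group-like element is primitive at `t = 0` (`comul_comp_magnus`). Conversely, products, commutators
and squares of group elements realise every homogeneous Lie element (`exists_lead_eq_ofLie`). So the
image of `lead n` is exactly `ℒ_(Γ,n)`.

Passage to `G_z`. The inclusion `G_(Γ,n) ⊆ G_(z,n)` is functoriality. For the converse, `G_z` acts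
on `A/I^(n+1)`: `G_Γ` by left multiplication through `μ_n`, and `Δ` by the algebra endomorphisms
induced by `δ`. As `z⁻¹ x⁻¹ z` agrees with `x` modulo commutators and squares, `Δ` acts trivially on
the graded pieces (`endo_sub_mem`). Every `g - 1` therefore raises the filtration by one, and every
element of `E_(n+1)(G_z)` raises it by `n + 1`, which is zero on the truncation. Evaluating at `1`
gives `μ_n = 1` on the `G_Γ`-component (`left_mem_zassenhaus`). The `Δ`-component is trivial once `n
≥ 2`, because `G_z → Δ → 𝔽₂[ε]ˣ` sends the augmentation ideal into `(ε)` and `ε² = 0`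
(`right_eq_one`). -/

theorem zmod_two_eq_zero_or_one (c : ZMod 2) : c = 0 ∨ c = 1 := by
  revert c; decide

/-! ## The Poincaré–Birkhoff–Witt theorem for restricted Lie algebras over `𝔽₂` -/

namespace RestrictedPBW

open RestrictedLieAlgebraTwo

variable {ι : Type*} [LinearOrder ι]

/-- The space with a basis indexed by the finite subsets of the index set. -/
abbrev Space (ι : Type*) : Type _ := Finset ι →₀ ZMod 2

/-- The basis vector attached to a finite set. -/
def e (S : Finset ι) : Space ι := Finsupp.single S 1

/-- The span of the basis vectors attached to sets with at most `n` elements. -/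
def fil (ι : Type*) (n : ℕ) : Submodule (ZMod 2) (Space ι) :=
  Finsupp.supported (ZMod 2) (ZMod 2) {S : Finset ι | S.card ≤ n}

theorem e_mem_fil {S : Finset ι} {n : ℕ} (h : S.card ≤ n) : e S ∈ fil ι n :=
  Finsupp.single_mem_supported _ _ h

theorem fil_mono {m n : ℕ} (h : m ≤ n) : fil ι m ≤ fil ι n :=
  Finsupp.supported_mono fun _ hS => le_trans hS h

theorem fil_induction {n : ℕ} (P : Space ι → Prop) (h0 : P 0)
    (hadd : ∀ p q, P p → P q → P (p + q)) (he : ∀ S : Finset ι, S.card ≤ n → P (e S))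
    {q : Space ι} (hq : q ∈ fil ι n) : P q := by
  rw [fil, Finsupp.supported_eq_span_single] at hq
  induction hq using Submodule.span_induction with
  | mem x hx => obtain ⟨S, hS, rfl⟩ := hx; exact he S hS
  | zero => exact h0
  | add x y _ _ hx hy => exact hadd x y hx hy
  | smul c x _ hx =>
    obtain rfl | rfl := zmod_two_eq_zero_or_one c
    · simpa using h0
    · simpa using hx

theorem space_induction (P : Space ι → Prop) (h0 : P 0)
    (hadd : ∀ p q, P p → P q → P (p + q)) (he : ∀ S : Finset ι, P (e S))
    (q : Space ι) : P q := by
  induction q using Finsupp.induction_linear with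
  | zero => exact h0
  | add f g hf hg => exact hadd f g hf hg
  | single S c =>
    obtain rfl | rfl := zmod_two_eq_zero_or_one c
    · simpa using h0
    · exact he S

/-- Leading term of the action of the basis element of index `i`. -/
def top (i : ι) (S : Finset ι) : Space ι := if i ∈ S then 0 else e (insert i S)

theorem top_mem_fil (i : ι) {S : Finset ι} {n : ℕ} (h : S.card ≤ n) :
    top i S ∈ fil ι (n + 1) := by
  unfold top
  split_ifs with hi
  · exact zero_mem _
  · exact e_mem_fil (by rw [Finset.card_insert_of_notMem hi]; omega)

/-! ### Recursive construction of the action on squarefree monomials -/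

variable {L : Type*} [LieRing L] [LieAlgebra (ZMod 2) L] [RestrictedLieAlgebraTwo L]
variable (b : Module.Basis ι (ZMod 2) L)

/-- The bilinear extension of a function of two basis elements. -/
def extend (f : ι → Finset ι → Space ι) : L →ₗ[ZMod 2] Space ι →ₗ[ZMod 2] Space ι :=
  b.constr (ZMod 2) fun i => Finsupp.linearCombination (ZMod 2) (f i)

@[simp]
theorem extend_basis (f : ι → Finset ι → Space ι) (i : ι) (S : Finset ι) :
    extend b f (b i) (e S) = f i S := by
  simp [extend, e]

theorem basis_induction (P : L → Prop) (h0 : P 0) (hadd : ∀ p q, P p → P q → P (p + q))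
    (hb : ∀ i, P (b i)) (x : L) : P x := by
  have hx : x ∈ Submodule.span (ZMod 2) (Set.range b) := by rw [b.span_eq]; trivial
  induction hx using Submodule.span_induction with
  | mem x hx => obtain ⟨i, rfl⟩ := hx; exact hb i
  | zero => exact h0
  | add x y _ _ hx hy => exact hadd x y hx hy
  | smul c x _ hx =>
    obtain rfl | rfl := zmod_two_eq_zero_or_one c
    · simpa using h0
    · simpa using hx

theorem extend_mem_fil {f : ι → Finset ι → Space ι} {n m : ℕ}
    (hf : ∀ i S, S.card ≤ n → f i S ∈ fil ι m) (x : L) {q : Space ι} (hq : q ∈ fil ι n) :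
    extend b f x q ∈ fil ι m := by
  induction x using basis_induction b with
  | h0 => simp
  | hadd p q hp hq => simpa using add_mem hp hq
  | hb i =>
    refine fil_induction (fun q => extend b f (b i) q ∈ fil ι m) (by simp)
      (fun p q hp hq => ?_) (fun S hS => ?_) hq
    · simpa using add_mem hp hq
    · simpa using hf i S hS

theorem extend_congr {f g : ι → Finset ι → Space ι} {n : ℕ}
    (hf : ∀ i S, S.card ≤ n → f i S = g i S) (x : L) {q : Space ι} (hq : q ∈ fil ι n) :
    extend b f x q = extend b g x q := by
  induction x using basis_induction b with
  | h0 => simp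
  | hadd p q hp hq => simp [hp, hq]
  | hb i =>
    refine fil_induction (fun q => extend b f (b i) q = extend b g (b i) q) (by simp)
      (fun p q hp hq => ?_) (fun S hS => ?_) hq
    · simp only [map_add, hp, hq]
    · simpa using hf i S hS

/-- The correction to the leading term of the action of the basis element of index `i`;
the first argument bounds the depth of the recursion. -/
def rem : ℕ → ι → Finset ι → Space ι
  | 0, _, _ => 0
  | n + 1, i, S =>
    if h : S.Nonempty then
      if i < S.min' h then 0
      else if i = S.min' h then
        -- Forces `b_i b_i = sq b_i` on a monomial starting with `b_i`.
        extend b (fun i S => top i S + rem n i S) (sq (b i)) (e (S.erase (S.min' h)))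
      else
        -- With `j = min S` and `T = S \ {j}`, this forces `b_i b_j e_T = b_j b_i e_T + [b_i, b_j]
        -- e_T`. The leading part of `b_i e_T`, once multiplied by `b_j`, is already counted in `top
        -- i S`, so only the correction of `b_i e_T` is fed to `b_j`.
        extend b (fun i S => top i S + rem n i S) (b (S.min' h))
            (rem n i (S.erase (S.min' h))) +
          extend b (fun i S => top i S + rem n i S) ⁅b i, b (S.min' h)⁆
            (e (S.erase (S.min' h)))
    else 0

theorem card_erase_min' {S : Finset ι} (h : S.Nonempty) :
    (S.erase (S.min' h)).card + 1 = S.card :=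
  Finset.card_erase_add_one (S.min'_mem h)

/-- Corrections do not lengthen monomials: each branch of the recursion applies one Lie element,
which adds at most one letter, to a vector of length at most `|S| - 1`. All inductions on length
below rest on this bound. -/
theorem rem_mem_fil (n : ℕ) : ∀ (i : ι) (S : Finset ι), rem b n i S ∈ fil ι S.card := by
  induction n with
  | zero => intro i S; simp [rem]
  | succ n ih =>
    have key : ∀ (x : L) (k : ℕ) (q : Space ι), q ∈ fil ι k →
        extend b (fun i S => top i S + rem b n i S) x q ∈ fil ι (k + 1) := fun x k q hq =>
      extend_mem_fil b (fun i S hS => add_mem (top_mem_fil i hS)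
        (fil_mono (hS.trans (Nat.le_succ k)) (ih i S))) x hq
    intro i S
    rw [rem]
    split_ifs with h h1 h2
    · exact zero_mem _
    · rw [← card_erase_min' h]
      exact key _ _ _ (e_mem_fil le_rfl)
    · rw [← card_erase_min' h]
      exact add_mem (key _ _ _ (ih _ _)) (key _ _ _ (e_mem_fil le_rfl))
    · exact zero_mem _

/-- The recursion only calls itself on vectors of length less than `|S|`, so depth `|S|` already
gives the final value. This makes the depth parameter harmless. -/
theorem rem_succ (n : ℕ) : ∀ (i : ι) (S : Finset ι), S.card ≤ n →
    rem b (n + 1) i S = rem b n i S := by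
  induction n with
  | zero =>
    intro i S hS
    have : S = ∅ := by simpa using hS
    subst this
    simp [rem]
  | succ n ih =>
    have key : ∀ (x : L) (q : Space ι), q ∈ fil ι n →
        extend b (fun i S => top i S + rem b (n + 1) i S) x q =
          extend b (fun i S => top i S + rem b n i S) x q := fun x q hq =>
      extend_congr b (fun i S hS => by rw [ih i S hS]) x hq
    intro i S hS
    rw [rem, rem]
    split_ifs with h h1 h2
    · rfl
    · rw [key _ _ (e_mem_fil (by have := card_erase_min' h; omega))]
    · have hc : (S.erase (S.min' h)).card ≤ n := by have := card_erase_min' h; omega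
      rw [ih _ _ hc, key _ _ (e_mem_fil hc), key _ _ (fil_mono hc (rem_mem_fil b _ _ _))]
    · rfl

theorem rem_eq {n : ℕ} {i : ι} {S : Finset ι} (h : S.card ≤ n) :
    rem b n i S = rem b S.card i S := by
  induction n, h using Nat.le_induction with
  | base => rfl
  | succ n hn ih => rw [rem_succ b n i S hn, ih]

/-- The action of a restricted Lie algebra on the space with basis the finite subsets of the
index set of a basis. -/
def act : L →ₗ[ZMod 2] Space ι →ₗ[ZMod 2] Space ι :=
  extend b fun i S => top i S + rem b S.card i S

theorem act_basis (i : ι) (S : Finset ι) :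
    act b (b i) (e S) = top i S + rem b S.card i S := by
  rw [act, extend_basis]

theorem act_eq_extend {n : ℕ} (x : L) {q : Space ι} (hq : q ∈ fil ι n) :
    extend b (fun i S => top i S + rem b n i S) x q = act b x q :=
  extend_congr b (fun i S hS => by rw [rem_eq b hS]) x hq

theorem min'_insert_of_lt {i : ι} {S : Finset ι} (h : ∀ j ∈ S, i < j) :
    (insert i S).min' (Finset.insert_nonempty i S) = i :=
  le_antisymm (Finset.min'_le _ _ (Finset.mem_insert_self i S))
    (Finset.le_min' _ _ _ fun j hj => by
      rcases Finset.mem_insert.1 hj with rfl | hj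
      · exact le_rfl
      · exact (h j hj).le)

theorem notMem_of_lt {i : ι} {S : Finset ι} (h : ∀ j ∈ S, i < j) : i ∉ S :=
  fun hi => lt_irrefl i (h i hi)

theorem act_of_lt {i : ι} {S : Finset ι} (h : ∀ j ∈ S, i < j) :
    act b (b i) (e S) = e (insert i S) := by
  rw [act_basis, top, if_neg (notMem_of_lt h)]
  obtain hS | hS := S.eq_empty_or_nonempty
  · subst hS; simp [rem]
  · obtain ⟨n, hn⟩ : ∃ n, S.card = n + 1 :=
      ⟨S.card - 1, by have := hS.card_pos; omega⟩
    rw [hn, rem, dif_pos hS, if_pos (h _ (S.min'_mem hS)), add_zero]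

theorem act_insert_self {i : ι} {T : Finset ι} (h : ∀ j ∈ T, i < j) :
    act b (b i) (e (insert i T)) = act b (sq (b i)) (e T) := by
  have hi := notMem_of_lt h
  rw [act_basis, top, if_pos (Finset.mem_insert_self i T), zero_add,
    Finset.card_insert_of_notMem hi, rem, dif_pos (Finset.insert_nonempty i T)]
  rw [min'_insert_of_lt h, if_neg (lt_irrefl i), if_pos rfl, Finset.erase_insert hi,
    act_eq_extend b _ (e_mem_fil le_rfl)]

theorem act_top {i j : ι} {T : Finset ι} (h : ∀ k ∈ T, j < k) (hij : j < i) :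
    act b (b j) (top i T) = top i (insert j T) := by
  by_cases hi : i ∈ T
  · simp [top, hi]
  · have : i ∉ insert j T := by simp [hi, hij.ne']
    rw [top, if_neg hi, top, if_neg this, act_of_lt b, Finset.insert_comm]
    intro k hk
    rcases Finset.mem_insert.1 hk with rfl | hk
    · exact hij
    · exact h k hk

/-- With `act_of_lt` and `act_insert_self`, this is the complete set of rewriting rules for `b_i`
against the first letter of a monomial. From here on only these three rules are used, not the
recursion. -/
theorem act_insert_of_lt {i j : ι} {T : Finset ι} (h : ∀ k ∈ T, j < k) (hij : j < i) :
    act b (b i) (e (insert j T)) =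
      act b (b j) (act b (b i) (e T)) + act b ⁅b i, b j⁆ (e T) := by
  have hj := notMem_of_lt h
  rw [act_basis, act_basis, map_add, act_top b h hij, Finset.card_insert_of_notMem hj, rem,
    dif_pos (Finset.insert_nonempty j T)]
  rw [min'_insert_of_lt h, if_neg hij.not_gt, if_neg hij.ne', Finset.erase_insert hj,
    act_eq_extend b _ (e_mem_fil le_rfl), act_eq_extend b _ (rem_mem_fil b _ _ _), add_assoc]

/-- Induction on finite sets, by adjoining elements below all the previous ones. -/
theorem eq_empty_or_insert_min (S : Finset ι) :
    S = ∅ ∨ ∃ (j : ι) (T : Finset ι), (∀ k ∈ T, j < k) ∧ S = insert j T := by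
  obtain hS | hS := S.eq_empty_or_nonempty
  · exact .inl hS
  · exact .inr ⟨S.min' hS, S.erase (S.min' hS), fun k hk => S.min'_lt_of_mem_erase_min' hS hk,
      (Finset.insert_erase (S.min'_mem hS)).symm⟩

/-! ### Consistency of the action with bracket and `2`-power map -/

/-- The compatibility of the action with bracket and `2`-power map at a vector. -/
def Compat (q : Space ι) : Prop :=
  (∀ x y : L, act b x (act b y q) + act b y (act b x q) = act b ⁅x, y⁆ q) ∧
    ∀ x : L, act b x (act b x q) = act b (sq x) q

theorem space_add_self (p : Space ι) : p + p = 0 := by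
  ext S; exact CharTwo.add_self_eq_zero _

theorem lie_add_self (x : L) : x + x = 0 := by
  have := (two_smul (ZMod 2) x).symm
  rwa [show (2 : ZMod 2) = 0 from rfl, zero_smul] at this

theorem lie_symm_two (x y : L) : ⁅x, y⁆ = ⁅y, x⁆ := by
  rw [← lie_skew, neg_eq_iff_add_eq_zero, lie_add_self]

theorem sq_zero' : sq (0 : L) = 0 := by
  have := sq_add (0 : L) 0
  rw [add_zero, lie_self, add_zero, lie_add_self] at this
  exact this

variable {b} in
theorem Compat.add {p q : Space ι} (hp : Compat b p) (hq : Compat b q) : Compat b (p + q) := by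
  refine ⟨fun x y => ?_, fun x => ?_⟩
  · simp only [map_add, ← hp.1, ← hq.1]; abel
  · simp only [map_add, hp.2, hq.2]

theorem Compat.zero : Compat b (0 : Space ι) := by
  refine ⟨fun x y => by simp, fun x => by simp⟩

/-- The bracket identity is bilinear and symmetric in characteristic `2`, so decreasing pairs of
basis elements suffice. The defect of additivity of the `2`-power map is a bracket, so the square
identity then spreads from basis elements to all of `L`. -/
theorem compat_of_basis {q : Space ι}
    (h1 : ∀ i j, j < i → act b (b i) (act b (b j) q) + act b (b j) (act b (b i) q) =
      act b ⁅b i, b j⁆ q)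
    (h2 : ∀ i, act b (b i) (act b (b i) q) = act b (sq (b i)) q) : Compat b q := by
  have h3 : ∀ x y : L, act b x (act b y q) + act b y (act b x q) = act b ⁅x, y⁆ q := by
    intro x y
    induction x using basis_induction b with
    | h0 => simp
    | hadd u v hu hv =>
      simp only [map_add, add_lie, LinearMap.add_apply, ← hu, ← hv]; abel
    | hb i =>
      induction y using basis_induction b with
      | h0 => simp
      | hadd u v hu hv =>
        simp only [map_add, lie_add, LinearMap.add_apply, ← hu, ← hv]; abel
      | hb j =>
        rcases lt_trichotomy i j with h | rfl | h
        · rw [add_comm, h1 j i h, lie_symm_two]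
        · rw [space_add_self, lie_self, map_zero, LinearMap.zero_apply]
        · exact h1 i j h
  refine ⟨h3, fun x => ?_⟩
  induction x using basis_induction b with
  | h0 => simp [sq_zero']
  | hadd u v hu hv =>
    simp only [map_add, sq_add, LinearMap.add_apply, ← hu, ← hv, ← h3]; abel
  | hb i => exact h2 i

theorem compat_lt_insert {i j : ι} {T : Finset ι} (h : ∀ k ∈ T, j < k) (hij : j < i) :
    act b (b i) (act b (b j) (e T)) + act b (b j) (act b (b i) (e T)) =
      act b ⁅b i, b j⁆ (e T) := by
  rw [act_of_lt b h, act_insert_of_lt b h hij, add_right_comm, space_add_self, zero_add]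

theorem compat_sq_of_lt {i : ι} {T : Finset ι} (h : ∀ k ∈ T, i < k) :
    act b (b i) (act b (b i) (e T)) = act b (sq (b i)) (e T) := by
  rw [act_of_lt b h, act_insert_self b h]

/-- The relations involving a letter `k` below all others hold at `b_j e_T`: the leading term is
zero or a monomial with all letters above `k`, where they hold by construction, and the correction
has length at most `|T|`, where they hold by induction. -/
theorem compat_act_of_lt {i j k : ι} {T : Finset ι} (hT : ∀ l ∈ T, k < l) (hki : k < i)
    (hkj : k < j) (hc : ∀ q ∈ fil ι T.card, Compat b q) :
    (act b (b i) (act b (b k) (act b (b j) (e T))) +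
        act b (b k) (act b (b i) (act b (b j) (e T))) = act b ⁅b i, b k⁆ (act b (b j) (e T))) ∧
      act b (b k) (act b (b k) (act b (b j) (e T))) = act b (sq (b k)) (act b (b j) (e T)) := by
  have h1 := hc _ (rem_mem_fil b T.card j T)
  have h2 : (act b (b i) (act b (b k) (top j T)) + act b (b k) (act b (b i) (top j T)) =
        act b ⁅b i, b k⁆ (top j T)) ∧
      act b (b k) (act b (b k) (top j T)) = act b (sq (b k)) (top j T) := by
    by_cases hj : j ∈ T
    · simp [top, hj]
    · rw [top, if_neg hj]
      have : ∀ l ∈ insert j T, k < l := fun l hl => by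
        rcases Finset.mem_insert.1 hl with rfl | hl
        · exact hkj
        · exact hT l hl
      exact ⟨compat_lt_insert b this hki, compat_sq_of_lt b this⟩
  rw [act_basis]
  constructor
  · simp only [map_add, ← h1.1, ← h2.1]; abel
  · simp only [map_add, h1.2, h2.2]

/-- This is the resolution of overlaps for the straightening rules. Each overlap of two letters `i`,
`j` with the first letter `k` of the monomial closes by one axiom of restricted Lie algebras. -/
theorem compat_insert {k : ι} {T : Finset ι} (hT : ∀ l ∈ T, k < l)
    (hc : ∀ q ∈ fil ι T.card, Compat b q) : Compat b (e (insert k T)) := by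
  have hcT : Compat b (e T) := hc _ (e_mem_fil le_rfl)
  have hlt : ∀ i, i < k → ∀ l ∈ insert k T, i < l := fun i hi l hl => by
    rcases Finset.mem_insert.1 hl with rfl | hl
    · exact hi
    · exact hi.trans (hT l hl)
  have hself := space_add_self (ι := ι)
  -- Since `e (insert k T) = b_k e_T`, any `x` can be moved past `b_k` by the relation at `e T`.
  have hkT : ∀ x : L, act b x (e (insert k T)) =
      act b (b k) (act b x (e T)) + act b ⁅x, b k⁆ (e T) := fun x => by
    have h1 := hcT.1 x (b k)
    have h2 := hself (act b (b k) (act b x (e T)))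
    rw [← act_of_lt b hT]
    grind
  refine compat_of_basis b (fun i j hji => ?_) fun i => ?_
  · rcases lt_trichotomy j k with hjk | rfl | hkj
    · exact compat_lt_insert b (hlt j hjk) hji
    -- Overlap with `j = k`: closed by `[b_i, sq b_k] = [[b_i, b_k], b_k]`.
    · have h1 := hcT.1 (b i) (sq (b j))
      have h2 := (compat_act_of_lt b hT hji hji hc).2
      have h4 : ⁅b i, sq (b j)⁆ = ⁅⁅b i, b j⁆, b j⁆ := by
        rw [lie_symm_two, sq_lie, lie_symm_two, lie_symm_two (b j)]
      rw [act_insert_self b hT, act_insert_of_lt b hT hji, hkT, map_add, h2, ← h4, ← h1]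
      abel
    -- Overlap `k < j < i`: closed by the Jacobi identity `h6`. Terms that occur twice cancel in
    -- characteristic `2`.
    · have hki := hkj.trans hji
      have h1 := (compat_act_of_lt b hT hki hkj hc).1
      have h2 := (compat_act_of_lt b hT hkj hki hc).1
      have h3 := hcT.1 (b i) ⁅b j, b k⁆
      have h4 := hcT.1 (b j) ⁅b i, b k⁆
      have h5 := hcT.1 (b i) (b j)
      have h6 : ⁅⁅b i, b j⁆, b k⁆ = ⁅b i, ⁅b j, b k⁆⁆ + ⁅b j, ⁅b i, b k⁆⁆ := by
        rw [lie_lie, sub_eq_add_neg, add_right_inj, neg_eq_iff_add_eq_zero, lie_add_self]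
      rw [hkT, hkT, hkT ⁅b i, b j⁆, h6, ← h5]
      simp only [map_add, LinearMap.add_apply]
      rw [← h3, ← h4]
      have e1 := hself (act b (b k) (act b (b i) (act b (b j) (e T))))
      have e2 := hself (act b (b k) (act b (b j) (act b (b i) (e T))))
      grind
  · rcases lt_trichotomy i k with hik | rfl | hki
    · exact compat_sq_of_lt b (hlt i hik)
    · have h1 : ⁅sq (b i), b i⁆ = 0 := by rw [sq_lie, lie_self, lie_zero]
      have h2 := hcT.1 (sq (b i)) (b i)
      rw [act_insert_self b hT, hkT, h1, map_zero, LinearMap.zero_apply, add_zero]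
    -- Overlap of the square of `b_i` with `k < i`: closed by `[sq b_i, b_k] = [b_i, [b_i, b_k]]`.
    · have h1 := (compat_act_of_lt b hT hki hki hc).1
      have h2 := hcT.1 (b i) ⁅b i, b k⁆
      have h3 := hcT.2 (b i)
      rw [hkT, hkT, map_add, sq_lie, ← h2, ← h3]
      have e1 := hself (act b (b k) (act b (b i) (act b (b i) (e T))))
      grind

theorem compat_basis (n : ℕ) : ∀ S : Finset ι, S.card = n → Compat b (e S) := by
  induction n using Nat.strong_induction_on with
  | _ n ih =>
    intro S hS
    obtain rfl | ⟨k, T, hT, rfl⟩ := eq_empty_or_insert_min S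
    · exact compat_of_basis b (fun i j hij => compat_lt_insert b (by simp) hij)
        fun i => compat_sq_of_lt b (by simp)
    · refine compat_insert b hT fun q hq => ?_
      rw [Finset.card_insert_of_notMem (notMem_of_lt hT)] at hS
      exact fil_induction (Compat b) (Compat.zero b) (fun _ _ => Compat.add)
        (fun S' hS' => ih _ (by omega) S' rfl) hq

theorem compat (q : Space ι) : Compat b q :=
  space_induction (Compat b) (Compat.zero b) (fun _ _ => Compat.add)
    (fun S => compat_basis b _ S rfl) q

theorem act_lie (x y : L) (q : Space ι) :
    act b ⁅x, y⁆ q = act b x (act b y q) - act b y (act b x q) := by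
  rw [← (compat b q).1 x y, sub_eq_add_neg, add_right_inj, eq_comm, neg_eq_iff_add_eq_zero,
    space_add_self]

theorem act_sq (x : L) (q : Space ι) : act b (sq x) q = act b x (act b x q) :=
  ((compat b q).2 x).symm

theorem act_empty (x : L) :
    act b x (e ∅) = (b.repr x).mapDomain fun i : ι => ({i} : Finset ι) := by
  induction x using basis_induction b with
  | h0 => simp
  | hadd p q hp hq => simp [hp, hq, Finsupp.mapDomain_add]
  | hb i => rw [act_of_lt b (by simp)]; simp [e]

/-- Applying `x` to the empty monomial returns the coordinates of `x` on the singletons, so the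
action is faithful. -/
theorem act_injective : Function.Injective (act b) := by
  rw [injective_iff_map_eq_zero]
  intro x hx
  have h := act_empty b x
  rw [hx, LinearMap.zero_apply, eq_comm, ← Finsupp.mapDomain_zero] at h
  simpa using Finsupp.mapDomain_injective Finset.singleton_injective h

/-! ### Ordered products -/

variable {R : Type*} [Ring R] [Algebra (ZMod 2) R] (f : L →ₗ[ZMod 2] R)

/-- The ordered product of the images of basis elements. -/
def orderedProd (S : Finset ι) : R := ((S.sort (· ≤ ·)).map fun i => f (b i)).prod

@[simp]
theorem orderedProd_empty : orderedProd b f ∅ = 1 := by simp [orderedProd]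

theorem orderedProd_insert {i : ι} {T : Finset ι} (h : ∀ k ∈ T, i < k) :
    orderedProd b f (insert i T) = f (b i) * orderedProd b f T := by
  rw [orderedProd, Finset.sort_insert (r := (· ≤ ·)) (fun k hk => (h k hk).le) (notMem_of_lt h)]
  simp [orderedProd]

/-- The linear map which sends basis vectors to ordered products. -/
def toAlgebra : Space ι →ₗ[ZMod 2] R := Finsupp.linearCombination (ZMod 2) (orderedProd b f)

@[simp]
theorem toAlgebra_e (S : Finset ι) : toAlgebra b f (e S) = orderedProd b f S := by
  simp [toAlgebra, e]

/-- Each straightening rule becomes a true identity in an associative algebra with commutator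
bracket and squaring, so ordered products turn the action into left multiplication. The induction is
on the length of the monomial. -/
theorem toAlgebra_act (hlie : ∀ x y, f ⁅x, y⁆ = f x * f y - f y * f x)
    (hsq : ∀ x, f (sq x) = f x * f x) (x : L) (q : Space ι) :
    toAlgebra b f (act b x q) = f x * toAlgebra b f q := by
  suffices H : ∀ (n : ℕ) (S : Finset ι), S.card = n → ∀ x,
      toAlgebra b f (act b x (e S)) = f x * toAlgebra b f (e S) by
    refine space_induction (fun q => toAlgebra b f (act b x q) = f x * toAlgebra b f q)
      (by simp) (fun p q hp hq => ?_) (fun S => H _ S rfl x) q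
    simp only [map_add, hp, hq, mul_add]
  intro n
  induction n using Nat.strong_induction_on with
  | _ n ih =>
    intro S hS x
    have ih' : ∀ x {m : ℕ} {q : Space ι}, q ∈ fil ι m → m < n →
        toAlgebra b f (act b x q) = f x * toAlgebra b f q := fun x m q hq hm => by
      refine fil_induction (fun q => toAlgebra b f (act b x q) = f x * toAlgebra b f q)
        (by simp) (fun p q hp hq => ?_) (fun S' hS' => ih _ (by omega) S' rfl x) hq
      simp only [map_add, hp, hq, mul_add]
    have hlt : ∀ i, ∀ S : Finset ι, (∀ k ∈ S, i < k) →
        toAlgebra b f (act b (b i) (e S)) = f (b i) * toAlgebra b f (e S) := fun i S hi => by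
      rw [act_of_lt b hi, toAlgebra_e, toAlgebra_e, orderedProd_insert b f hi]
    induction x using basis_induction b with
    | h0 => simp
    | hadd p q hp hq => simp only [map_add, LinearMap.add_apply, hp, hq, add_mul]
    | hb i =>
      obtain rfl | ⟨k, T, hT, rfl⟩ := eq_empty_or_insert_min S
      · exact hlt i _ (by simp)
      · have hcard : T.card < n := by
          rw [Finset.card_insert_of_notMem (notMem_of_lt hT)] at hS; omega
        have hT' := e_mem_fil (S := T) le_rfl
        rcases lt_trichotomy i k with hik | rfl | hki
        · refine hlt i _ fun l hl => ?_
          rcases Finset.mem_insert.1 hl with rfl | hl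
          · exact hik
          · exact hik.trans (hT l hl)
        · rw [act_insert_self b hT, ih' _ hT' hcard, hsq, toAlgebra_e, toAlgebra_e,
            orderedProd_insert b f hT, mul_assoc]
        · have hk : toAlgebra b f (act b (b k) (act b (b i) (e T))) =
              f (b k) * (f (b i) * toAlgebra b f (e T)) := by
            rw [← ih' _ hT' hcard, act_basis, map_add, map_add, map_add, mul_add,
              ih' _ (rem_mem_fil b _ i T) hcard]
            congr 1
            by_cases hi : i ∈ T
            · simp [top, hi]
            · rw [top, if_neg hi]
              refine hlt k _ fun l hl => ?_
              rcases Finset.mem_insert.1 hl with rfl | hl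
              · exact hki
              · exact hT l hl
          rw [act_insert_of_lt b hT hki, map_add, hk, ih' _ hT' hcard, hlie, toAlgebra_e,
            toAlgebra_e, orderedProd_insert b f hT]
          noncomm_ring

end RestrictedPBW

/-! ## Restricted Lie algebras and associative algebras -/

theorem algebra_add_self {R : Type*} [Ring R] [Algebra (ZMod 2) R] (a : R) : a + a = 0 := by
  have := (two_smul (ZMod 2) a).symm
  rwa [show (2 : ZMod 2) = 0 from rfl, zero_smul] at this

namespace FreeRestrictedLieTwo

variable {X : Type*}

theorem induction {P : FreeRestrictedLieTwo X → Prop} (hof : ∀ x, P (of x)) (hzero : P 0)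
    (hadd : ∀ a b, P a → P b → P (a + b)) (hlie : ∀ a b, P a → P b → P ⁅a, b⁆)
    (hsq : ∀ a, P a → P (RestrictedLieAlgebraTwo.sq a)) (a : FreeRestrictedLieTwo X) : P a := by
  obtain ⟨a⟩ := a
  induction a with
  | of x => exact hof x
  | zero => exact hzero
  | add a b ha hb => exact hadd _ _ ha hb
  | lie a b ha hb => exact hlie _ _ ha hb
  | sq a ha => exact hsq _ ha

variable {R : Type*} [Ring R] [Algebra (ZMod 2) R] (f : X → R)

/-- The evaluation of a formal expression in an associative algebra over `𝔽₂`. -/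
def Term.eval : Term X → R
  | .of x => f x
  | .zero => 0
  | .add a b => a.eval + b.eval
  | .lie a b => a.eval * b.eval - b.eval * a.eval
  | .sq a => a.eval * a.eval

theorem Rel.eval_eq {a b : Term X} (h : Rel X a b) : a.eval f = b.eval f := by
  induction h with
  | refl a => rfl
  | symm _ ih => exact ih.symm
  | trans _ _ ih1 ih2 => exact ih1.trans ih2
  | add_congr _ _ ih1 ih2 => simp only [Term.eval, ih1, ih2]
  | lie_congr _ _ ih1 ih2 => simp only [Term.eval, ih1, ih2]
  | sq_congr _ ih => simp only [Term.eval, ih]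
  | add_assoc a b c => exact _root_.add_assoc _ _ _
  | add_comm a b => exact _root_.add_comm _ _
  | zero_add a => exact _root_.zero_add _
  | add_self a => exact algebra_add_self _
  | add_lie a b c => simp only [Term.eval]; noncomm_ring
  | lie_add a b c => simp only [Term.eval]; noncomm_ring
  | lie_self a => simp only [Term.eval, sub_self]
  | leibniz a b c => simp only [Term.eval]; noncomm_ring
  | sq_lie a b =>
    simp only [Term.eval]
    -- The two sides differ by `2 (aba - baa)`.
    rw [← sub_eq_zero, ← algebra_add_self
      (a.eval f * b.eval f * a.eval f - b.eval f * a.eval f * a.eval f)]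
    noncomm_ring
  | sq_add a b =>
    simp only [Term.eval]
    -- The two sides differ by `2 ba`.
    rw [← sub_eq_zero, ← algebra_add_self (b.eval f * a.eval f)]
    noncomm_ring

/-- The linear map from the free restricted Lie algebra to an associative algebra, given by a
map on generators. -/
def lift : FreeRestrictedLieTwo X →ₗ[ZMod 2] R :=
  AddMonoidHom.toZModLinearMap 2
    { toFun := Quotient.lift (Term.eval f) fun _ _ h => Rel.eval_eq f h
      map_zero' := rfl
      map_add' := by rintro ⟨a⟩ ⟨b⟩; rfl }

@[simp]
theorem lift_of (x : X) : lift f (of x) = f x := rfl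

theorem lift_lie (a b : FreeRestrictedLieTwo X) :
    lift f ⁅a, b⁆ = lift f a * lift f b - lift f b * lift f a := by
  obtain ⟨a⟩ := a
  obtain ⟨b⟩ := b
  rfl

theorem lift_sq (a : FreeRestrictedLieTwo X) :
    lift f (RestrictedLieAlgebraTwo.sq a) = lift f a * lift f a := by
  obtain ⟨a⟩ := a
  rfl

end FreeRestrictedLieTwo

namespace GraphLie

open RestrictedLieAlgebraTwo

variable {d : ℕ} (Γ : SimpleGraph (Fin d))

/-- The canonical generator of the restricted Lie algebra of a graph. -/
def gen (i : Fin d) : graphLie Γ := LieSubmodule.Quotient.mk (FreeRestrictedLieTwo.of i)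

variable {Γ}

theorem induction {P : graphLie Γ → Prop} (hof : ∀ i, P (gen Γ i)) (hzero : P 0)
    (hadd : ∀ a b, P a → P b → P (a + b)) (hlie : ∀ a b, P a → P b → P ⁅a, b⁆)
    (hsq : ∀ a, P a → P (sq a)) (a : graphLie Γ) : P a := by
  obtain ⟨a, rfl⟩ := LieSubmodule.Quotient.surjective_mk' _ a
  induction a using FreeRestrictedLieTwo.induction with
  | hof x => exact hof x
  | hzero => exact hzero
  | hadd a b ha hb => exact hadd _ _ ha hb
  | hlie a b ha hb => exact hlie _ _ ha hb
  | hsq a ha => exact hsq _ ha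

variable {R : Type*} [Ring R] [Algebra (ZMod 2) R]

/-- The kernel of the evaluation is a Lie ideal stable under the `2`-power map and contains the
relators, so it contains the smallest such ideal. -/
theorem restrictedIdealSpan_le_ker {f : Fin d → R}
    (hf : ∀ u v, Γ.Adj u v → f u * f v = f v * f u) {x : FreeRestrictedLieTwo (Fin d)}
    (hx : x ∈ restrictedIdealSpan {r : FreeRestrictedLieTwo (Fin d) | ∃ u v : Fin d,
      Γ.Adj u v ∧ r = ⁅FreeRestrictedLieTwo.of u, FreeRestrictedLieTwo.of v⁆}) :
    FreeRestrictedLieTwo.lift f x = 0 := by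
  let K : LieIdeal (ZMod 2) (FreeRestrictedLieTwo (Fin d)) :=
    { LinearMap.ker (FreeRestrictedLieTwo.lift f) with
      lie_mem := fun {a m} (hm : FreeRestrictedLieTwo.lift f m = 0) => by
        change FreeRestrictedLieTwo.lift f ⁅a, m⁆ = 0
        rw [FreeRestrictedLieTwo.lift_lie, hm, mul_zero, zero_mul, sub_zero] }
  have hK : restrictedIdealSpan {r : FreeRestrictedLieTwo (Fin d) | ∃ u v : Fin d,
      Γ.Adj u v ∧ r = ⁅FreeRestrictedLieTwo.of u, FreeRestrictedLieTwo.of v⁆} ≤ K := by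
    refine sInf_le ⟨?_, fun x (hx : FreeRestrictedLieTwo.lift f x = 0) => ?_⟩
    · rintro _ ⟨u, v, h, rfl⟩
      change FreeRestrictedLieTwo.lift f _ = 0
      rw [FreeRestrictedLieTwo.lift_lie, FreeRestrictedLieTwo.lift_of,
        FreeRestrictedLieTwo.lift_of, hf u v h, sub_self]
    · change FreeRestrictedLieTwo.lift f _ = 0
      rw [FreeRestrictedLieTwo.lift_sq, hx, mul_zero]
  exact hK hx

/-- The linear map from the restricted Lie algebra of a graph to an associative algebra, given
by a map on vertices for which the images of adjacent vertices commute. -/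
def lift (f : Fin d → R) (hf : ∀ u v, Γ.Adj u v → f u * f v = f v * f u) :
    graphLie Γ →ₗ[ZMod 2] R :=
  Submodule.liftQ _ (FreeRestrictedLieTwo.lift f) fun _ hx => restrictedIdealSpan_le_ker hf hx

variable (f : Fin d → R) (hf : ∀ u v, Γ.Adj u v → f u * f v = f v * f u)

theorem lift_mk (a : FreeRestrictedLieTwo (Fin d)) :
    lift f hf (LieSubmodule.Quotient.mk a) = FreeRestrictedLieTwo.lift f a := rfl

theorem lift_lie (a b : graphLie Γ) :
    lift f hf ⁅a, b⁆ = lift f hf a * lift f hf b - lift f hf b * lift f hf a := by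
  obtain ⟨a, rfl⟩ := LieSubmodule.Quotient.surjective_mk' _ a
  obtain ⟨b, rfl⟩ := LieSubmodule.Quotient.surjective_mk' _ b
  exact FreeRestrictedLieTwo.lift_lie f a b

theorem lift_sq (a : graphLie Γ) : lift f hf (sq a) = lift f hf a * lift f hf a := by
  obtain ⟨a, rfl⟩ := LieSubmodule.Quotient.surjective_mk' _ a
  exact FreeRestrictedLieTwo.lift_sq f a

theorem lie_of_adj {u v : Fin d} (h : Γ.Adj u v) : ⁅gen Γ u, gen Γ v⁆ = 0 := by
  have hle : ({r : FreeRestrictedLieTwo (Fin d) | ∃ u v : Fin d, Γ.Adj u v ∧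
      r = ⁅FreeRestrictedLieTwo.of u, FreeRestrictedLieTwo.of v⁆} : Set _) ⊆
      restrictedIdealSpan {r : FreeRestrictedLieTwo (Fin d) | ∃ u v : Fin d, Γ.Adj u v ∧
      r = ⁅FreeRestrictedLieTwo.of u, FreeRestrictedLieTwo.of v⁆} := by
    intro x hx
    rw [restrictedIdealSpan, LieSubmodule.coe_sInf, Set.mem_iInter₂]
    exact fun I hI => hI.1 hx
  exact (LieSubmodule.Quotient.mk_eq_zero _).2 (hle ⟨u, v, h, rfl⟩)

end GraphLie

/-! ## The associative algebra of a graph -/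

/-- The defining relations of the associative algebra of a graph. -/
inductive GraphAlgebra.Rel {d : ℕ} (Γ : SimpleGraph (Fin d)) :
    FreeAlgebra (ZMod 2) (Fin d) → FreeAlgebra (ZMod 2) (Fin d) → Prop
  | comm {u v : Fin d} (h : Γ.Adj u v) :
    Rel Γ (FreeAlgebra.ι _ u * FreeAlgebra.ι _ v) (FreeAlgebra.ι _ v * FreeAlgebra.ι _ u)

/-- The associative algebra over `𝔽₂` generated by the vertices of a graph, in which adjacent
vertices commute. -/
def GraphAlgebra {d : ℕ} (Γ : SimpleGraph (Fin d)) : Type := RingQuot (GraphAlgebra.Rel Γ)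

namespace GraphAlgebra

variable {d : ℕ} (Γ : SimpleGraph (Fin d))

instance : Ring (GraphAlgebra Γ) := inferInstanceAs (Ring (RingQuot (Rel Γ)))

instance : Algebra (ZMod 2) (GraphAlgebra Γ) :=
  inferInstanceAs (Algebra (ZMod 2) (RingQuot (Rel Γ)))

/-- The canonical generators. -/
def X (i : Fin d) : GraphAlgebra Γ :=
  RingQuot.mkAlgHom (ZMod 2) (Rel Γ) (FreeAlgebra.ι (ZMod 2) i)

variable {Γ}

theorem X_comm {u v : Fin d} (h : Γ.Adj u v) : X Γ u * X Γ v = X Γ v * X Γ u := by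
  have := RingQuot.mkAlgHom_rel (ZMod 2) (Rel.comm h)
  rwa [map_mul, map_mul] at this

section lift

variable {R : Type*} [Ring R] [Algebra (ZMod 2) R]

/-- The universal property of the associative algebra of a graph. -/
def lift (f : Fin d → R) (hf : ∀ u v, Γ.Adj u v → f u * f v = f v * f u) :
    GraphAlgebra Γ →ₐ[ZMod 2] R :=
  RingQuot.liftAlgHom (ZMod 2) ⟨FreeAlgebra.lift (ZMod 2) f, by
    rintro _ _ ⟨h⟩
    simpa using hf _ _ h⟩

@[simp]
theorem lift_X (f : Fin d → R) (hf : ∀ u v, Γ.Adj u v → f u * f v = f v * f u) (i : Fin d) :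
    lift f hf (X Γ i) = f i := by
  unfold lift X
  erw [RingQuot.liftAlgHom_mkAlgHom_apply]
  simp

theorem hom_ext {φ ψ : GraphAlgebra Γ →ₐ[ZMod 2] R} (h : ∀ i, φ (X Γ i) = ψ (X Γ i)) : φ = ψ :=
  RingQuot.ringQuot_ext' (ZMod 2) φ ψ (FreeAlgebra.hom_ext (funext h))

end lift

theorem adjoin_range_X : Algebra.adjoin (ZMod 2) (Set.range (X Γ)) = ⊤ := by
  set S := Algebra.adjoin (ZMod 2) (Set.range (X Γ))
  let φ : GraphAlgebra Γ →ₐ[ZMod 2] S :=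
    lift (fun i => ⟨X Γ i, Algebra.subset_adjoin ⟨i, rfl⟩⟩) fun u v h => Subtype.ext (X_comm h)
  have h : S.val.comp φ = AlgHom.id (ZMod 2) _ := hom_ext fun i => by simp [φ]
  rw [eq_top_iff]
  intro a _
  have := DFunLike.congr_fun h a
  rw [AlgHom.id_apply] at this
  rw [← this]
  exact (φ a).2

theorem induction {P : GraphAlgebra Γ → Prop} (hone : P 1) (hX : ∀ i, P (X Γ i))
    (hzero : P 0) (hadd : ∀ a b, P a → P b → P (a + b)) (hmul : ∀ a b, P a → P b → P (a * b))
    (a : GraphAlgebra Γ) : P a := by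
  have ha : a ∈ Algebra.adjoin (ZMod 2) (Set.range (X Γ)) := by
    rw [adjoin_range_X]; trivial
  induction ha using Algebra.adjoin_induction with
  | mem x hx => obtain ⟨i, rfl⟩ := hx; exact hX i
  | algebraMap r =>
    obtain rfl | rfl := zmod_two_eq_zero_or_one r
    · rwa [map_zero]
    · rwa [map_one]
  | add x y _ _ hx hy => exact hadd x y hx hy
  | mul x y _ _ hx hy => exact hmul x y hx hy

/-- The canonical map from the restricted Lie algebra of a graph to its associative algebra. -/
def ofLie (Γ : SimpleGraph (Fin d)) : graphLie Γ →ₗ[ZMod 2] GraphAlgebra Γ :=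
  GraphLie.lift (X Γ) fun _ _ => X_comm

@[simp]
theorem ofLie_gen (i : Fin d) : ofLie Γ (GraphLie.gen Γ i) = X Γ i := rfl

theorem ofLie_lie (a b : graphLie Γ) :
    ofLie Γ ⁅a, b⁆ = ofLie Γ a * ofLie Γ b - ofLie Γ b * ofLie Γ a :=
  GraphLie.lift_lie _ _ a b

theorem ofLie_sq (a : graphLie Γ) :
    ofLie Γ (RestrictedLieAlgebraTwo.sq a) = ofLie Γ a * ofLie Γ a :=
  GraphLie.lift_sq _ _ a

/-! ### The Poincaré–Birkhoff–Witt basis -/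

section PBW

open RestrictedPBW

variable {ι : Type*} [LinearOrder ι] (b : Module.Basis ι (ZMod 2) (graphLie Γ))

/-- The module structure of the space of ordered monomials. -/
def actHom : GraphAlgebra Γ →ₐ[ZMod 2] Module.End (ZMod 2) (Space ι) :=
  lift (fun i => act b (GraphLie.gen Γ i)) fun u v h => LinearMap.ext fun q => by
    have := act_lie b (GraphLie.gen Γ u) (GraphLie.gen Γ v) q
    rw [GraphLie.lie_of_adj h, map_zero, LinearMap.zero_apply, eq_comm, sub_eq_zero] at this
    exact this

theorem actHom_ofLie (x : graphLie Γ) : actHom b (ofLie Γ x) = act b x := by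
  induction x using GraphLie.induction with
  | hof i => simp [actHom]
  | hzero => simp
  | hadd x y hx hy => simp only [map_add, hx, hy]
  | hlie x y hx hy =>
    refine LinearMap.ext fun q => ?_
    rw [ofLie_lie, map_sub, map_mul, map_mul, hx, hy, act_lie]
    rfl
  | hsq x hx =>
    refine LinearMap.ext fun q => ?_
    rw [ofLie_sq, map_mul, hx, act_sq]
    rfl

theorem toAlgebra_actHom (a : GraphAlgebra Γ) : ∀ q : Space ι,
    toAlgebra b (ofLie Γ) (actHom b a q) = a * toAlgebra b (ofLie Γ) q := by
  induction a using GraphAlgebra.induction with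
  | hone => simp
  | hzero => simp
  | hadd x y hx hy => intro q; simp only [map_add, LinearMap.add_apply, hx, hy, add_mul]
  | hmul x y hx hy => intro q; rw [map_mul, Module.End.mul_apply, hx, hy, mul_assoc]
  | hX i =>
    intro q
    rw [← ofLie_gen, actHom_ofLie, toAlgebra_act b _ ofLie_lie ofLie_sq]

theorem actHom_orderedProd (S : Finset ι) :
    actHom b (orderedProd b (ofLie Γ) S) (e ∅) = e S := by
  induction S using Finset.induction_on_min with
  | empty => simp
  | insert i S hi ih =>
    rw [orderedProd_insert b _ hi, map_mul, Module.End.mul_apply, ih, actHom_ofLie,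
      act_of_lt b hi]

/-- Together with `actHom_orderedProd`, this makes `a ↦ a · e_∅` and `toAlgebra` mutually inverse,
so the ordered products form a basis of the associative algebra. -/
theorem toAlgebra_actHom_empty (a : GraphAlgebra Γ) :
    toAlgebra b (ofLie Γ) (actHom b a (e ∅)) = a := by
  rw [toAlgebra_actHom, toAlgebra_e, orderedProd_empty, mul_one]

/-- The coefficient of an ordered monomial. -/
def coord (S : Finset ι) : GraphAlgebra Γ →ₗ[ZMod 2] ZMod 2 where
  toFun a := actHom b a (e ∅) S
  map_add' x y := by simp
  map_smul' c x := by simp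

theorem coord_orderedProd (S T : Finset ι) :
    coord b S (orderedProd b (ofLie Γ) T) = if T = S then 1 else 0 := by
  change actHom b (orderedProd b (ofLie Γ) T) (e ∅) S = _
  rw [actHom_orderedProd, e, Finsupp.single_apply]

end PBW

theorem exists_basis (Γ : SimpleGraph (Fin d)) : ∃ (ι : Type) (_ : LinearOrder ι),
    Nonempty (Module.Basis ι (ZMod 2) (graphLie Γ)) := by
  classical
  exact ⟨_, linearOrderOfSTO WellOrderingRel, ⟨Module.Free.chooseBasis (ZMod 2) (graphLie Γ)⟩⟩

/-- The restricted Lie algebra of a graph embeds into its associative algebra. -/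
theorem ofLie_injective (Γ : SimpleGraph (Fin d)) : Function.Injective (ofLie Γ) := by
  obtain ⟨ι, _, ⟨b⟩⟩ := exists_basis Γ
  intro x y h
  apply RestrictedPBW.act_injective b
  rw [← actHom_ofLie, ← actHom_ofLie, h]

/-! ### Primitive elements -/

open scoped TensorProduct

theorem commute_tmul {R : Type*} [Ring R] [Algebra (ZMod 2) R] (a b : R) :
    Commute (a ⊗ₜ[ZMod 2] (1 : R)) ((1 : R) ⊗ₜ[ZMod 2] b) := by
  simp [Commute, SemiconjBy, Algebra.TensorProduct.tmul_mul_tmul]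

theorem commute_tmul_left {R : Type*} [Ring R] [Algebra (ZMod 2) R] {a b : R}
    (h : Commute a b) : Commute (a ⊗ₜ[ZMod 2] (1 : R)) (b ⊗ₜ[ZMod 2] (1 : R)) := by
  simp [Commute, SemiconjBy, Algebra.TensorProduct.tmul_mul_tmul, h.eq]

theorem commute_tmul_right {R : Type*} [Ring R] [Algebra (ZMod 2) R] {a b : R}
    (h : Commute a b) : Commute ((1 : R) ⊗ₜ[ZMod 2] a) ((1 : R) ⊗ₜ[ZMod 2] b) := by
  simp [Commute, SemiconjBy, Algebra.TensorProduct.tmul_mul_tmul, h.eq]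

theorem commute_primitive {R : Type*} [Ring R] [Algebra (ZMod 2) R] {a b : R}
    (h : Commute a b) : Commute (a ⊗ₜ[ZMod 2] (1 : R) + (1 : R) ⊗ₜ[ZMod 2] a)
      (b ⊗ₜ[ZMod 2] (1 : R) + (1 : R) ⊗ₜ[ZMod 2] b) :=
  ((commute_tmul_left h).add_right (commute_tmul a b)).add_left
    ((commute_tmul b a).symm.add_right (commute_tmul_right h))

/-- The coproduct for which the generators are primitive. -/
def comul (Γ : SimpleGraph (Fin d)) :
    GraphAlgebra Γ →ₐ[ZMod 2] GraphAlgebra Γ ⊗[ZMod 2] GraphAlgebra Γ :=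
  lift (fun i => X Γ i ⊗ₜ 1 + 1 ⊗ₜ X Γ i) fun _ _ h => (commute_primitive (X_comm h)).eq

theorem comul_ofLie (x : graphLie Γ) :
    comul Γ (ofLie Γ x) = ofLie Γ x ⊗ₜ 1 + 1 ⊗ₜ ofLie Γ x := by
  induction x using GraphLie.induction with
  | hof i => simp [comul]
  | hzero => simp
  | hadd x y hx hy =>
    simp only [map_add, hx, hy, TensorProduct.add_tmul, TensorProduct.tmul_add]; abel
  | hlie x y hx hy =>
    rw [ofLie_lie, map_sub, map_mul, map_mul, hx, hy]
    simp only [mul_add, add_mul, Algebra.TensorProduct.tmul_mul_tmul, one_mul, mul_one,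
      TensorProduct.sub_tmul, TensorProduct.tmul_sub]
    abel
  | hsq x hx =>
    rw [ofLie_sq, map_mul, hx]
    simp only [mul_add, add_mul, Algebra.TensorProduct.tmul_mul_tmul, one_mul, mul_one]
    rw [add_assoc, ← add_assoc (ofLie Γ x ⊗ₜ[ZMod 2] ofLie Γ x), algebra_add_self, zero_add]

section

open RestrictedPBW

variable {ι : Type*} [LinearOrder ι] (b : Module.Basis ι (ZMod 2) (graphLie Γ))

/-- Every factor is primitive, so the product expands by sending each letter to the left or to the
right tensor factor. Exponents are at most one, so no binomial coefficients, and hence no divided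
powers, appear. -/
theorem comul_orderedProd (S : Finset ι) : comul Γ (orderedProd b (ofLie Γ) S) =
    ∑ T ∈ S.powerset, orderedProd b (ofLie Γ) T ⊗ₜ orderedProd b (ofLie Γ) (S \ T) := by
  induction S using Finset.induction_on_min with
  | empty => simp [Algebra.TensorProduct.one_def]
  | insert i S hi ih =>
    have hiS := notMem_of_lt hi
    rw [orderedProd_insert b _ hi, map_mul, ih, comul_ofLie, Finset.sum_powerset_insert hiS,
      add_mul, Finset.mul_sum, Finset.mul_sum, add_comm]
    congr 1 <;> refine Finset.sum_congr rfl fun T hT => ?_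
    · have hT' := Finset.mem_powerset.1 hT
      rw [Finset.insert_sdiff_of_notMem _ (fun h => hiS (hT' h)), orderedProd_insert b _
        (fun k hk => hi k (Finset.mem_sdiff.1 hk).1), Algebra.TensorProduct.tmul_mul_tmul, one_mul]
    · have hT' := Finset.mem_powerset.1 hT
      rw [Finset.insert_sdiff_insert, Finset.sdiff_insert_of_notMem hiS, orderedProd_insert b _
        (fun k hk => hi k (hT' hk)), Algebra.TensorProduct.tmul_mul_tmul, one_mul]

/-- The coefficient of a tensor product of ordered monomials. -/
def coordTensor (T U : Finset ι) : GraphAlgebra Γ ⊗[ZMod 2] GraphAlgebra Γ →ₗ[ZMod 2] ZMod 2 :=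
  LinearMap.mul' (ZMod 2) (ZMod 2) ∘ₗ TensorProduct.map (coord b T) (coord b U)

theorem coordTensor_tmul (T U : Finset ι) (x y : GraphAlgebra Γ) :
    coordTensor b T U (x ⊗ₜ y) = coord b T x * coord b U y := by
  simp [coordTensor]

theorem coordTensor_comul_orderedProd {T U : Finset ι} (h : Disjoint T U) (S : Finset ι) :
    coordTensor b T U (comul Γ (orderedProd b (ofLie Γ) S)) = if S = T ∪ U then 1 else 0 := by
  rw [comul_orderedProd, map_sum]
  simp only [coordTensor_tmul, coord_orderedProd, ite_mul, zero_mul, one_mul]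
  rw [Finset.sum_ite_eq']
  by_cases hS : S = T ∪ U
  · subst hS
    rw [if_pos (Finset.mem_powerset.2 Finset.subset_union_left), if_pos rfl, if_pos]
    rw [Finset.union_sdiff_cancel_left h]
  · rw [if_neg hS]
    split_ifs with h1 h2
    · exact absurd (by rw [← h2, Finset.union_sdiff_of_subset (Finset.mem_powerset.1 h1)]) hS
    · rfl
    · rfl

/-- Among ordered monomials, only the one on `T ∪ U` has the tensor monomial `T ⊗ U` in its
coproduct. Coordinates of an element can thus be read off its coproduct. -/
theorem coordTensor_comul {T U : Finset ι} (h : Disjoint T U) (a : GraphAlgebra Γ) :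
    coordTensor b T U (comul Γ a) = coord b (T ∪ U) a := by
  rw [← toAlgebra_actHom_empty b a]
  refine space_induction (fun q => coordTensor b T U (comul Γ (toAlgebra b (ofLie Γ) q)) =
    coord b (T ∪ U) (toAlgebra b (ofLie Γ) q)) (by simp) (fun p q hp hq => ?_) (fun S => ?_) _
  · simp only [map_add, hp, hq]
  · rw [toAlgebra_e, coordTensor_comul_orderedProd b h, coord_orderedProd]

theorem coord_one (S : Finset ι) : coord b S (1 : GraphAlgebra Γ) = if S = ∅ then 1 else 0 := by
  rw [← orderedProd_empty b (ofLie Γ), coord_orderedProd]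
  simp only [eq_comm]

end

/-- Primitive elements of the associative algebra of a graph are Lie elements. -/
theorem exists_ofLie_eq_of_primitive {a : GraphAlgebra Γ} (ha : comul Γ a = a ⊗ₜ 1 + 1 ⊗ₜ a) :
    ∃ x, ofLie Γ x = a := by
  classical
  obtain ⟨ι, _, ⟨b⟩⟩ := exists_basis Γ
  -- For primitive `a` the coordinate at `T ∪ U` vanishes as soon as `T` and `U` are both nonempty,
  -- and `T = U = ∅` kills the constant term. Only singletons survive, so `a` is a combination of
  -- basis elements of `ℒ_Γ`.
  have key : ∀ T U : Finset ι, Disjoint T U → coord b (T ∪ U) a =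
      coord b T a * (if U = ∅ then 1 else 0) + (if T = ∅ then 1 else 0) * coord b U a := by
    intro T U h
    rw [← coordTensor_comul b h, ha, map_add, coordTensor_tmul, coordTensor_tmul, coord_one,
      coord_one]
  have hcard : ∀ S : Finset ι, S.card ≠ 1 → coord b S a = 0 := by
    intro S hS
    obtain rfl | ⟨j, hj⟩ := S.eq_empty_or_nonempty
    · have := key ∅ ∅ (Finset.disjoint_empty_left _)
      simpa using this
    · have hne : S.erase j ≠ ∅ := fun h => hS (by
        rw [← Finset.card_erase_add_one hj, h, Finset.card_empty])
      have := key {j} (S.erase j) (by simp)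
      rwa [if_neg hne, if_neg (Finset.singleton_ne_empty j), mul_zero, zero_mul, add_zero,
        ← Finset.insert_eq, Finset.insert_erase hj] at this
  rw [← toAlgebra_actHom_empty b a, RestrictedPBW.toAlgebra, Finsupp.linearCombination_apply]
  refine ⟨(actHom b a (RestrictedPBW.e ∅)).sum fun S c =>
    c • if h : ∃ i, S = {i} then b h.choose else 0, ?_⟩
  rw [Finsupp.sum, Finsupp.sum, map_sum]
  refine Finset.sum_congr rfl fun S hS => ?_
  have h1 : S.card = 1 := by
    by_contra h
    exact Finsupp.mem_support_iff.1 hS (hcard S h)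
  obtain ⟨i, rfl⟩ := Finset.card_eq_one.1 h1
  have h : ∃ j, ({i} : Finset ι) = {j} := ⟨i, rfl⟩
  rw [dif_pos h, ← Finset.singleton_injective h.choose_spec, map_smul]
  simp [RestrictedPBW.orderedProd]

end GraphAlgebra

/-- A ring map sending `I` into step one of a multiplicative filtration sends `I^n` into step `n`.
Every comparison of filtrations in this file is an instance; closure under multiplication by step
one on the right is enough. -/
theorem Ideal.map_pow_mem {R S : Type*} [Ring R] [Ring S] {I : Ideal R} [I.IsTwoSided]
    {φ : R →+* S} {F : ℕ → AddSubgroup S} (h0 : ∀ x, φ x ∈ F 0) (h1 : ∀ x ∈ I, φ x ∈ F 1)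
    (hmul : ∀ n, ∀ a ∈ F n, ∀ b ∈ F 1, a * b ∈ F (n + 1)) :
    ∀ {n : ℕ} {x : R}, x ∈ I ^ n → φ x ∈ F n := by
  intro n
  induction n with
  | zero => exact fun _ => h0 _
  | succ n ih =>
    intro x hx
    rw [Submodule.pow_succ] at hx
    refine Submodule.mul_induction_on hx (fun a ha b hb => ?_) fun a b ha hb => ?_
    · rw [map_mul]; exact hmul n _ (ih ha) _ (h1 b hb)
    · rw [map_add]; exact add_mem ha hb

theorem Ideal.mul_mem_pow_succ {R : Type*} [Ring R] {I : Ideal R} [I.IsTwoSided] {n : ℕ}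
    {a b : R} (ha : a ∈ I ^ n) (hb : b ∈ I) : a * b ∈ I ^ (n + 1) := by
  rw [Submodule.pow_succ]
  exact Ideal.mul_mem_mul ha hb

namespace GraphAlgebra

open Polynomial

variable {d : ℕ} {Γ : SimpleGraph (Fin d)}

/-! ### The augmentation ideal -/

/-- The augmentation of the associative algebra of a graph. -/
def aug (Γ : SimpleGraph (Fin d)) : GraphAlgebra Γ →ₐ[ZMod 2] ZMod 2 :=
  lift (fun _ => 0) fun _ _ _ => rfl

@[simp]
theorem aug_X (i : Fin d) : aug Γ (X Γ i) = 0 := lift_X _ _ i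

/-- The augmentation ideal. -/
def augIdeal (Γ : SimpleGraph (Fin d)) : Ideal (GraphAlgebra Γ) := RingHom.ker (aug Γ)

instance : (augIdeal Γ).IsTwoSided := inferInstanceAs (RingHom.ker (aug Γ)).IsTwoSided

theorem X_mem_augIdeal (i : Fin d) : X Γ i ∈ augIdeal Γ := aug_X i

/-- The augmentation ideal is the left ideal generated by the `X i`. -/
theorem exists_eq_sum (a : GraphAlgebra Γ) : ∃ v : Fin d → GraphAlgebra Γ,
    a = algebraMap (ZMod 2) _ (aug Γ a) + ∑ i, v i * X Γ i := by
  induction a using GraphAlgebra.induction with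
  | hone => exact ⟨0, by simp⟩
  | hzero => exact ⟨0, by simp⟩
  | hX i => exact ⟨Pi.single i 1, by simp [Pi.single_apply, ite_mul]⟩
  | hadd a b ha hb =>
    obtain ⟨v, hv⟩ := ha
    obtain ⟨w, hw⟩ := hb
    refine ⟨v + w, ?_⟩
    simp only [map_add, Pi.add_apply, add_mul, Finset.sum_add_distrib]
    conv_lhs => rw [hv, hw]
    abel
  | hmul a b ha hb =>
    obtain ⟨v, hv⟩ := ha
    obtain ⟨w, hw⟩ := hb
    refine ⟨fun i => aug Γ b • v i + a * w i, ?_⟩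
    simp only [add_mul, Finset.sum_add_distrib, smul_mul_assoc, ← Finset.smul_sum, mul_assoc,
      ← Finset.mul_sum]
    have h1 : ∑ i, v i * X Γ i = a - algebraMap (ZMod 2) _ (aug Γ a) := by
      conv_rhs => rw [hv]
      simp
    have h2 : ∑ i, w i * X Γ i = b - algebraMap (ZMod 2) _ (aug Γ b) := by
      conv_rhs => rw [hw]
      simp
    rw [h1, h2, smul_sub, mul_sub, Algebra.smul_def, Algebra.smul_def, Algebra.commutes _ a,
      map_mul, map_mul, ← map_mul, mul_comm (aug Γ a), map_mul]
    abel

/-- An element modulo `I^(n+1)` is determined by its constant term and by the coefficients `v i`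
modulo `I^n`. Finiteness is what lets the Magnus representation extend to the pro-`2` completion. -/
instance finite_quotient (n : ℕ) : Finite (GraphAlgebra Γ ⧸ augIdeal Γ ^ n) := by
  induction n with
  | zero =>
    have : Subsingleton (GraphAlgebra Γ ⧸ augIdeal Γ ^ 0) := by
      rw [Ideal.Quotient.subsingleton_iff, Submodule.pow_zero, Ideal.one_eq_top]
    infer_instance
  | succ n ih =>
    refine Finite.of_surjective
      (fun p : ZMod 2 × (Fin d → GraphAlgebra Γ ⧸ augIdeal Γ ^ n) =>
        Ideal.Quotient.mk (augIdeal Γ ^ (n + 1))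
          (algebraMap (ZMod 2) _ p.1 + ∑ i, (p.2 i).out * X Γ i)) fun y => ?_
    obtain ⟨a, rfl⟩ := Ideal.Quotient.mk_surjective y
    obtain ⟨v, hv⟩ := exists_eq_sum a
    refine ⟨(aug Γ a, fun i => Ideal.Quotient.mk _ (v i)), ?_⟩
    conv_rhs => rw [hv]
    rw [Ideal.Quotient.eq, add_sub_add_left_eq_sub, ← Finset.sum_sub_distrib]
    refine Ideal.sum_mem _ fun i _ => ?_
    rw [← sub_mul]
    refine Ideal.mul_mem_pow_succ ?_ (X_mem_augIdeal i)
    rw [← Ideal.Quotient.eq, Ideal.Quotient.mk_out]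

/-! ### The grading -/

/-- The homomorphism which multiplies the elements of degree `n` by the `n`-th power of the
variable. -/
def grade (Γ : SimpleGraph (Fin d)) : GraphAlgebra Γ →ₐ[ZMod 2] (GraphAlgebra Γ)[X] :=
  lift (fun i => monomial 1 (X Γ i)) fun u v h => by
    rw [monomial_mul_monomial, monomial_mul_monomial, X_comm h]

@[simp]
theorem grade_X (i : Fin d) : grade Γ (X Γ i) = monomial 1 (X Γ i) := lift_X _ _ i

/-- The homogeneous component of degree `n`. -/
def comp (n : ℕ) : GraphAlgebra Γ →+ GraphAlgebra Γ :=
  (lcoeff (GraphAlgebra Γ) n).toAddMonoidHom.comp (grade Γ).toRingHom.toAddMonoidHom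

theorem comp_apply (n : ℕ) (a : GraphAlgebra Γ) : comp n a = (grade Γ a).coeff n := rfl

theorem comp_mem (a : GraphAlgebra Γ) : ∀ n, comp n a ∈ augIdeal Γ ^ n := by
  induction a using GraphAlgebra.induction with
  | hone =>
    intro n
    rw [comp_apply, map_one, coeff_one]
    split_ifs with h
    · subst h; rw [Submodule.pow_zero, Ideal.one_eq_top]; trivial
    · exact zero_mem _
  | hzero => intro n; rw [map_zero]; exact zero_mem _
  | hX i =>
    intro n
    rw [comp_apply, grade_X, coeff_monomial]
    split_ifs with h
    · subst h; rw [Submodule.pow_one]; exact X_mem_augIdeal i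
    · exact zero_mem _
  | hadd a b ha hb => intro n; rw [map_add]; exact add_mem (ha n) (hb n)
  | hmul a b ha hb =>
    intro n
    rw [comp_apply, map_mul, coeff_mul]
    refine Ideal.sum_mem _ fun p hp => ?_
    rw [← Finset.HasAntidiagonal.mem_antidiagonal.1 hp, Ideal.IsTwoSided.pow_add]
    exact Ideal.mul_mem_mul (ha _) (hb _)

theorem grade_comp (a : GraphAlgebra Γ) : ∀ n, grade Γ (comp n a) = monomial n (comp n a) := by
  induction a using GraphAlgebra.induction with
  | hone =>
    intro n
    rw [comp_apply, map_one, coeff_one]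
    split_ifs with h
    · subst h; simp
    · simp
  | hzero => simp
  | hX i =>
    intro n
    rw [comp_apply, grade_X, coeff_monomial]
    split_ifs with h
    · subst h; exact grade_X i
    · simp
  | hadd a b ha hb => intro n; simp only [map_add, ha, hb]
  | hmul a b ha hb =>
    intro n
    rw [comp_apply, map_mul, coeff_mul, map_sum, map_sum]
    refine Finset.sum_congr rfl fun p hp => ?_
    rw [map_mul]
    refine (congrArg₂ _ (ha p.1) (hb p.2)).trans ?_
    rw [monomial_mul_monomial, Finset.HasAntidiagonal.mem_antidiagonal.1 hp]
    rfl

theorem comp_comp (n : ℕ) (a : GraphAlgebra Γ) : comp n (comp n a) = comp n a := by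
  rw [comp_apply, grade_comp, coeff_monomial, if_pos rfl]

theorem eval_grade (a : GraphAlgebra Γ) : (grade Γ a).eval 1 = a := by
  induction a using GraphAlgebra.induction with
  | hone => simp
  | hzero => simp
  | hX i => simp
  | hadd a b ha hb => rw [map_add, eval_add, ha, hb]
  | hmul a b ha hb =>
    rw [map_mul, eval, eval₂_mul_noncomm _ _ fun k => Commute.one_right _]
    exact congrArg₂ _ ha hb

/-- The filtration of the polynomials by the order of vanishing. -/
def orderFil (R : Type*) [Ring R] (n : ℕ) : AddSubgroup R[X] where
  carrier := {p | ∀ k < n, p.coeff k = 0}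
  zero_mem' := by simp
  add_mem' ha hb k hk := by rw [coeff_add, ha k hk, hb k hk, add_zero]
  neg_mem' ha k hk := by rw [coeff_neg, ha k hk, neg_zero]

/-- With `comp_mem` and `mem_pow_succ`, this identifies `I^n` with the elements having no component
of degree below `n`. -/
theorem comp_eq_zero {n : ℕ} {a : GraphAlgebra Γ} (ha : a ∈ augIdeal Γ ^ n) {k : ℕ}
    (hk : k < n) : comp k a = 0 := by
  refine Ideal.map_pow_mem (φ := (grade Γ).toRingHom) (F := orderFil (GraphAlgebra Γ))
    (fun x k hk => absurd hk (Nat.not_lt_zero k)) (fun x hx k hk => ?_)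
    (fun n p hp q hq k hk => ?_) ha k hk
  · obtain rfl : k = 0 := by omega
    obtain ⟨v, hv⟩ := exists_eq_sum x
    have h0 : aug Γ x = 0 := hx
    rw [hv, h0]
    simp [mul_coeff_zero]
  · rw [coeff_mul]
    refine Finset.sum_eq_zero fun p hp' => ?_
    have := Finset.HasAntidiagonal.mem_antidiagonal.1 hp'
    by_cases h : p.1 < n
    · rw [hp _ h, zero_mul]
    · rw [hq p.2 (by omega), mul_zero]

theorem comp_mul {m n : ℕ} {a b : GraphAlgebra Γ} (ha : a ∈ augIdeal Γ ^ m)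
    (hb : b ∈ augIdeal Γ ^ n) : comp (m + n) (a * b) = comp m a * comp n b := by
  rw [comp_apply, map_mul, coeff_mul, Finset.sum_eq_single (m, n)]
  · rfl
  · rintro ⟨i, j⟩ hij hne
    have := Finset.HasAntidiagonal.mem_antidiagonal.1 hij
    simp only at this
    by_cases h : i < m
    · rw [show (grade Γ a).coeff i = 0 from comp_eq_zero ha h, zero_mul]
    · have hj : j < n := by
        by_contra hj
        exact hne (Prod.ext (by simp only; omega) (by simp only; omega))
      rw [show (grade Γ b).coeff j = 0 from comp_eq_zero hb hj, mul_zero]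
  · intro h; simp at h

theorem mem_pow_succ {n : ℕ} {a : GraphAlgebra Γ} (ha : a ∈ augIdeal Γ ^ n)
    (h : comp n a = 0) : a ∈ augIdeal Γ ^ (n + 1) := by
  rw [← eval_grade a, eval_eq_sum, Polynomial.sum]
  refine Ideal.sum_mem _ fun k hk => ?_
  rw [one_pow, mul_one]
  have hk' : comp k a ≠ 0 := mem_support_iff.1 hk
  have : n + 1 ≤ k := by
    by_contra hlt
    rcases Nat.lt_succ_iff_lt_or_eq.1 (not_le.1 hlt) with h1 | rfl
    · exact hk' (comp_eq_zero ha h1)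
    · exact hk' h
  exact Ideal.pow_le_pow_right this (comp_mem a k)

theorem grade_ofLie_of_isHomogeneous {n : ℕ} {a : FreeRestrictedLieTwo (Fin d)}
    (ha : FreeRestrictedLieTwo.IsHomogeneous n a) :
    grade Γ (FreeRestrictedLieTwo.lift (X Γ) a) =
      monomial n (FreeRestrictedLieTwo.lift (X Γ) a) := by
  induction ha with
  | of x => simp
  | zero n => simp
  | add _ _ ha hb => simp only [map_add, ha, hb]
  | @lie m n _ _ _ _ ha hb =>
    rw [FreeRestrictedLieTwo.lift_lie, map_sub, map_mul, map_mul, ha, hb, monomial_mul_monomial,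
      monomial_mul_monomial, add_comm n m, map_sub]
  | sq _ ha => rw [FreeRestrictedLieTwo.lift_sq, map_mul, ha, monomial_mul_monomial]

theorem comp_ofLie {m n : ℕ} {x : graphLie Γ} (hx : x ∈ graphLieComponent Γ n) :
    comp m (ofLie Γ x) = if n = m then ofLie Γ x else 0 := by
  obtain ⟨a, ha, rfl⟩ := hx
  rw [comp_apply, ofLie, GraphLie.lift_mk, grade_ofLie_of_isHomogeneous ha, coeff_monomial]

/-- The only delicate closure property is under the `2`-power map, which is not additive. Its defect
is a bracket, so closure under brackets is proved first. -/
theorem mem_closure_isHomogeneous {V : Type*} (a : FreeRestrictedLieTwo V) :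
    a ∈ AddSubgroup.closure {b : FreeRestrictedLieTwo V |
      ∃ n, FreeRestrictedLieTwo.IsHomogeneous n b} := by
  have hlie : ∀ {a b : FreeRestrictedLieTwo V},
      a ∈ AddSubgroup.closure {b : FreeRestrictedLieTwo V |
        ∃ n, FreeRestrictedLieTwo.IsHomogeneous n b} →
      b ∈ AddSubgroup.closure {b : FreeRestrictedLieTwo V |
        ∃ n, FreeRestrictedLieTwo.IsHomogeneous n b} →
      ⁅a, b⁆ ∈ AddSubgroup.closure {b : FreeRestrictedLieTwo V |
        ∃ n, FreeRestrictedLieTwo.IsHomogeneous n b} := by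
    intro a b ha hb
    induction ha using AddSubgroup.closure_induction with
    | mem a ha =>
      obtain ⟨m, hm⟩ := ha
      induction hb using AddSubgroup.closure_induction with
      | mem b hb =>
        obtain ⟨n, hn⟩ := hb
        exact AddSubgroup.subset_closure ⟨m + n, .lie hm hn⟩
      | zero => rw [lie_zero]; exact zero_mem _
      | add b c _ _ hb hc => rw [lie_add]; exact add_mem hb hc
      | neg b _ hb => rw [lie_neg]; exact neg_mem hb
    | zero => rw [zero_lie]; exact zero_mem _
    | add b c _ _ hb hc => rw [add_lie]; exact add_mem hb hc
    | neg b _ hb => rw [neg_lie]; exact neg_mem hb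
  induction a using FreeRestrictedLieTwo.induction with
  | hof x => exact AddSubgroup.subset_closure ⟨1, .of x⟩
  | hzero => exact zero_mem _
  | hadd a b ha hb => exact add_mem ha hb
  | hlie a b ha hb => exact hlie ha hb
  | hsq a ha =>
    induction ha using AddSubgroup.closure_induction with
    | mem a ha =>
      obtain ⟨m, hm⟩ := ha
      exact AddSubgroup.subset_closure ⟨m + m, .sq hm⟩
    | zero => rw [RestrictedPBW.sq_zero']; exact zero_mem _
    | add b c hb' hc' hb hc =>
      rw [RestrictedLieAlgebraTwo.sq_add]
      exact add_mem (add_mem hb hc) (hlie hb' hc')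
    | neg b _ hb => exact hb

/-- The image of `ℒ_Γ` in the associative algebra is graded. A homogeneous Lie element found through
primitivity can therefore be chosen in the component `ℒ_(Γ,n)`. -/
theorem exists_component (n : ℕ) (x : graphLie Γ) :
    ∃ y ∈ graphLieComponent Γ n, ofLie Γ y = comp n (ofLie Γ x) := by
  obtain ⟨a, rfl⟩ := LieSubmodule.Quotient.surjective_mk' _ x
  have ha := mem_closure_isHomogeneous a
  induction ha using AddSubgroup.closure_induction with
  | mem a ha =>
    obtain ⟨m, hm⟩ := ha
    have hm' : LieSubmodule.Quotient.mk a ∈ graphLieComponent Γ m := ⟨a, hm, rfl⟩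
    by_cases h : m = n
    · subst h
      exact ⟨_, hm', by rw [LieSubmodule.Quotient.mk'_apply, comp_ofLie hm', if_pos rfl]⟩
    · exact ⟨0, zero_mem _, by
        rw [LieSubmodule.Quotient.mk'_apply, comp_ofLie hm', if_neg h, map_zero]⟩
  | zero => exact ⟨0, zero_mem _, by simp⟩
  | add a b _ _ ha hb =>
    obtain ⟨y, hy, hy'⟩ := ha
    obtain ⟨z, hz, hz'⟩ := hb
    exact ⟨y + z, add_mem hy hz, by simp only [map_add, hy', hz']⟩
  | neg a _ ha =>
    obtain ⟨y, hy, hy'⟩ := ha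
    exact ⟨-y, neg_mem hy, by simp only [map_neg, hy']⟩

/-! ### Leading terms of products of the elements `1 + X i` -/

open scoped TensorProduct

theorem commute_tmul_self {R : Type*} [Ring R] [Algebra (ZMod 2) R] {a b : R}
    (h : Commute a b) : Commute (a ⊗ₜ[ZMod 2] a) (b ⊗ₜ[ZMod 2] b) := by
  simp [Commute, SemiconjBy, Algebra.TensorProduct.tmul_mul_tmul, h.eq]

theorem commute_primitive_tmul_self {R : Type*} [Ring R] [Algebra (ZMod 2) R] {a b : R}
    (h : Commute a b) :
    Commute (a ⊗ₜ[ZMod 2] (1 : R) + (1 : R) ⊗ₜ[ZMod 2] a) (b ⊗ₜ[ZMod 2] b) := by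
  simp [Commute, SemiconjBy, Algebra.TensorProduct.tmul_mul_tmul, h.eq, add_mul, mul_add]

theorem commute_C_add_X_mul_C {R : Type*} [Ring R] {p p' q q' : R} (h1 : Commute p p')
    (h2 : Commute p q') (h3 : Commute q p') (h4 : Commute q q') :
    Commute (C p + Polynomial.X * C q) (C p' + Polynomial.X * C q') :=
  ((h1.map C).add_right ((commute_X (C p)).symm.mul_right (h2.map C))).add_left
    (((commute_X (C p')).mul_left (h3.map C)).add_right
      (((commute_X _).mul_left (commute_X (C q)).symm).mul_right
        ((commute_X _).mul_left (h4.map C))))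

/-- The deformation of the coproduct for which the elements `1 + t X i` are group-like. -/
def comulDeform (Γ : SimpleGraph (Fin d)) :
    GraphAlgebra Γ →ₐ[ZMod 2] (GraphAlgebra Γ ⊗[ZMod 2] GraphAlgebra Γ)[X] :=
  lift (fun i => C (X Γ i ⊗ₜ 1 + 1 ⊗ₜ X Γ i) + Polynomial.X * C (X Γ i ⊗ₜ X Γ i))
    fun u v h => by
      have h : Commute (X Γ u) (X Γ v) := X_comm h
      exact (commute_C_add_X_mul_C (commute_primitive h) (commute_primitive_tmul_self h)
        (commute_primitive_tmul_self h.symm).symm (commute_tmul_self h)).eq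

theorem coeff_zero_comulDeform (a : GraphAlgebra Γ) :
    (comulDeform Γ a).coeff 0 = comul Γ a := by
  induction a using GraphAlgebra.induction with
  | hone => simp
  | hzero => simp
  | hX i => simp [comulDeform, comul]
  | hadd a b ha hb => rw [map_add, coeff_add, ha, hb, map_add]
  | hmul a b ha hb => rw [map_mul, mul_coeff_zero, ha, hb, map_mul]

/-- The extension of `comulDeform` to polynomials. -/
def comulPoly (Γ : SimpleGraph (Fin d)) :
    (GraphAlgebra Γ)[X] →+* (GraphAlgebra Γ ⊗[ZMod 2] GraphAlgebra Γ)[X] :=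
  eval₂RingHom' (comulDeform Γ).toRingHom Polynomial.X fun _ => (commute_X _).symm

theorem comulPoly_C (a : GraphAlgebra Γ) : comulPoly Γ (C a) = comulDeform Γ a :=
  eval₂_C _ _

theorem comulPoly_variable : comulPoly Γ Polynomial.X = Polynomial.X :=
  eval₂_X _ _

theorem coeff_zero_comulPoly (p : (GraphAlgebra Γ)[X]) :
    (comulPoly Γ p).coeff 0 = comul Γ (p.coeff 0) := by
  conv_lhs => rw [← divX_mul_X_add p]
  rw [map_add, map_mul, comulPoly_C, comulPoly_variable, coeff_add, coeff_mul_X_zero, zero_add,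
    coeff_zero_comulDeform]

/-- The inclusion of the left tensor factor, on polynomials. -/
def polyLeft (Γ : SimpleGraph (Fin d)) :
    (GraphAlgebra Γ)[X] →+* (GraphAlgebra Γ ⊗[ZMod 2] GraphAlgebra Γ)[X] :=
  mapRingHom (Algebra.TensorProduct.includeLeft (R := ZMod 2) (S := ZMod 2)).toRingHom

/-- The inclusion of the right tensor factor, on polynomials. -/
def polyRight (Γ : SimpleGraph (Fin d)) :
    (GraphAlgebra Γ)[X] →+* (GraphAlgebra Γ ⊗[ZMod 2] GraphAlgebra Γ)[X] :=
  mapRingHom (Algebra.TensorProduct.includeRight (R := ZMod 2)).toRingHom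

theorem coeff_polyLeft (p : (GraphAlgebra Γ)[X]) (n : ℕ) :
    (polyLeft Γ p).coeff n = p.coeff n ⊗ₜ 1 := by
  simp [polyLeft]

theorem coeff_polyRight (p : (GraphAlgebra Γ)[X]) (n : ℕ) :
    (polyRight Γ p).coeff n = 1 ⊗ₜ p.coeff n := by
  simp [polyRight]

theorem commute_polyRight_polyLeft (p q : (GraphAlgebra Γ)[X]) :
    polyRight Γ p * polyLeft Γ q = polyLeft Γ q * polyRight Γ p := by
  ext n
  rw [coeff_mul, coeff_mul, ← Finset.Nat.sum_antidiagonal_swap]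
  refine Finset.sum_congr rfl fun x _ => ?_
  simp [coeff_polyLeft, coeff_polyRight, Algebra.TensorProduct.tmul_mul_tmul]

/-- The product of the elements `1 + X i` along a list of vertices. -/
def magnus (Γ : SimpleGraph (Fin d)) (w : List (Fin d)) : GraphAlgebra Γ :=
  (w.map fun i => 1 + X Γ i).prod

/-- This identity dictates the deformation: `t (a + b + t ab)` is `(1 + ta)(1 + tb) - 1`, so with `a
= X_i ⊗ 1` and `b = 1 ⊗ X_i` the element `1 + t X_i` becomes group-like. -/
theorem one_add_deform_mul_X {R : Type*} [Ring R] (a b : R) :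
    1 + (C (a + b) + Polynomial.X * C (a * b)) * Polynomial.X =
      (1 + C a * Polynomial.X) * (1 + C b * Polynomial.X) := by
  rw [X_mul, C_add, C_mul]
  simp only [add_mul, mul_add, one_mul, mul_one, mul_assoc]
  rw [X_mul (p := C b * Polynomial.X)]
  simp only [mul_assoc]
  abel

theorem comulPoly_grade_one_add_X (i : Fin d) : comulPoly Γ (grade Γ (1 + X Γ i)) =
    polyLeft Γ (grade Γ (1 + X Γ i)) * polyRight Γ (grade Γ (1 + X Γ i)) := by
  have h : grade Γ (1 + X Γ i) = 1 + C (X Γ i) * Polynomial.X := by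
    rw [map_add, map_one, grade_X, ← C_mul_X_eq_monomial]
  have hl : polyLeft Γ (C (X Γ i)) = C (X Γ i ⊗ₜ 1) := by simp [polyLeft]
  have hr : polyRight Γ (C (X Γ i)) = C (1 ⊗ₜ X Γ i) := by simp [polyRight]
  have hl' : polyLeft Γ Polynomial.X = Polynomial.X := by simp [polyLeft]
  have hr' : polyRight Γ Polynomial.X = Polynomial.X := by simp [polyRight]
  have hc : comulDeform Γ (X Γ i) =
      C (X Γ i ⊗ₜ 1 + 1 ⊗ₜ X Γ i) + Polynomial.X * C (X Γ i ⊗ₜ X Γ i) := lift_X _ _ i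
  have ht : X Γ i ⊗ₜ[ZMod 2] X Γ i = (X Γ i ⊗ₜ[ZMod 2] 1) * (1 ⊗ₜ[ZMod 2] X Γ i) := by
    rw [Algebra.TensorProduct.tmul_mul_tmul, one_mul, mul_one]
  rw [h, map_add, map_one, map_mul, comulPoly_C, comulPoly_variable, hc, ht,
    one_add_deform_mul_X, map_add, map_one, map_mul, hl, hl', map_add, map_one, map_mul, hr, hr']

theorem comulPoly_grade_magnus (w : List (Fin d)) : comulPoly Γ (grade Γ (magnus Γ w)) =
    polyLeft Γ (grade Γ (magnus Γ w)) * polyRight Γ (grade Γ (magnus Γ w)) := by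
  induction w with
  | nil => simp [magnus]
  | cons i w ih =>
    have h : magnus Γ (i :: w) = (1 + X Γ i) * magnus Γ w := by simp [magnus]
    rw [h, map_mul, map_mul, ih, comulPoly_grade_one_add_X, map_mul, map_mul, mul_assoc,
      ← mul_assoc (polyRight Γ _), commute_polyRight_polyLeft]
    simp only [mul_assoc]

/-- Write the graded element as `1 + t^n s`. Being group-like, it satisfies `1 + t^n D(s) = (1 + t^n
s ⊗ 1)(1 + t^n 1 ⊗ s)`, with `D` the deformed coproduct. Divide by `t^n` and set `t = 0`: the cross
term carries a further factor `t^n` and disappears since `n ≠ 0`, and `D` becomes the ordinary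
coproduct. -/
theorem comul_comp_magnus {n : ℕ} (hn : n ≠ 0) {w : List (Fin d)}
    (hw : magnus Γ w - 1 ∈ augIdeal Γ ^ n) :
    comul Γ (comp n (magnus Γ w - 1)) =
      comp n (magnus Γ w - 1) ⊗ₜ 1 + 1 ⊗ₜ comp n (magnus Γ w - 1) := by
  obtain ⟨s, hs⟩ : Polynomial.X ^ n ∣ grade Γ (magnus Γ w - 1) :=
    X_pow_dvd_iff.2 fun k hk => comp_eq_zero hw hk
  have h0 : s.coeff 0 = comp n (magnus Γ w - 1) := by
    rw [comp_apply, hs]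
    have := coeff_X_pow_mul s n 0
    rwa [zero_add, eq_comm] at this
  have hw' : grade Γ (magnus Γ w) = 1 + Polynomial.X ^ n * s := by
    rw [← hs, map_sub, map_one]; abel
  have hl' : polyLeft Γ Polynomial.X = Polynomial.X := by simp [polyLeft]
  have hr' : polyRight Γ Polynomial.X = Polynomial.X := by simp [polyRight]
  have key := comulPoly_grade_magnus (Γ := Γ) w
  rw [hw'] at key
  simp only [map_add, map_one, map_mul, map_pow, comulPoly_variable, hl', hr', add_mul, mul_add,
    one_mul, mul_one, mul_assoc] at key
  rw [add_assoc, add_right_inj, ← mul_add, ← mul_add] at key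
  have key' := congrArg (fun p => p.coeff (0 + n)) key
  simp only [coeff_X_pow_mul] at key'
  rw [coeff_zero_comulPoly, coeff_add, coeff_add, coeff_polyLeft, coeff_polyRight,
    mul_coeff_zero, mul_coeff_zero, coeff_X_pow, if_neg (Ne.symm hn), zero_mul, mul_zero] at key'
  rw [← h0, key']
  abel

/-- The leading term of a product of the elements `1 + X i` is a Lie element. -/
theorem exists_ofLie_eq_comp_magnus {n : ℕ} (hn : n ≠ 0) {w : List (Fin d)}
    (hw : magnus Γ w - 1 ∈ augIdeal Γ ^ n) :
    ∃ x ∈ graphLieComponent Γ n, ofLie Γ x = comp n (magnus Γ w - 1) := by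
  obtain ⟨x, hx⟩ := exists_ofLie_eq_of_primitive (comul_comp_magnus hn hw)
  obtain ⟨y, hy, hxy⟩ := exists_component n x
  exact ⟨y, hy, by rw [hxy, hx, comp_comp]⟩

end GraphAlgebra

/-! ## Pro-`2` completions -/

namespace ProTwoCompletion

variable {A : Type*} [Group A]

instance finite_finiteTwoQuotient (N : TwoPowerNormalSubgroup A) :
    Finite (FiniteTwoQuotient N) := by
  obtain ⟨k, hk⟩ := N.index_eq
  have : N.carrier.FiniteIndex := ⟨by rw [hk]; positivity⟩
  exact inferInstanceAs (Finite (A ⧸ N.carrier))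

theorem isClosed_proTwoCompletion :
    IsClosed (proTwoCompletion A : Set (∀ N : TwoPowerNormalSubgroup A, FiniteTwoQuotient N)) := by
  have : (proTwoCompletion A : Set (∀ N : TwoPowerNormalSubgroup A, FiniteTwoQuotient N)) =
      ⋂ (N : TwoPowerNormalSubgroup A) (M : TwoPowerNormalSubgroup A)
        (h : N.carrier ≤ M.carrier), {f | FiniteTwoQuotient.transition h (f N) = f M} := by
    ext f; simp [proTwoCompletion]
  rw [this]
  exact isClosed_iInter fun N => isClosed_iInter fun M => isClosed_iInter fun h =>
    isClosed_eq (continuous_of_discreteTopology.comp (continuous_apply N)) (continuous_apply M)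

instance : CompactSpace (proTwoCompletion A) :=
  isCompact_iff_compactSpace.1 isClosed_proTwoCompletion.isCompact

theorem exists_le_finset (F : Finset (TwoPowerNormalSubgroup A)) :
    ∃ N : TwoPowerNormalSubgroup A, ∀ M ∈ F, N.carrier ≤ M.carrier := by
  classical
  induction F using Finset.induction_on with
  | empty => exact ⟨⟨⊤, inferInstance, 0, by simp⟩, by simp⟩
  | insert M F _ ih =>
    obtain ⟨N, hN⟩ := ih
    have := M.normal
    have := N.normal
    obtain ⟨k, hk⟩ := N.index_eq
    obtain ⟨l, hl⟩ := M.index_eq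
    refine ⟨⟨M.carrier ⊓ N.carrier, inferInstance, ?_⟩, fun M' hM' => ?_⟩
    -- The index of `M ⊓ N` is the index of `N` times a divisor of the index of `M`, hence a power
    -- of two.
    · have h1 : M.carrier.relIndex N.carrier ∣ 2 ^ l :=
        hl ▸ Subgroup.relIndex_dvd_index_of_normal _ _
      obtain ⟨j, -, hj⟩ := (Nat.dvd_prime_pow Nat.prime_two).1 h1
      refine ⟨j + k, ?_⟩
      rw [← Subgroup.relIndex_mul_index (inf_le_right : M.carrier ⊓ N.carrier ≤ N.carrier),
        Subgroup.inf_relIndex_right, hj, hk, pow_add]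
    · rcases Finset.mem_insert.1 hM' with rfl | h
      · exact inf_le_left
      · exact inf_le_right.trans (hN M' h)

/-- A basic neighbourhood constrains finitely many coordinates, and these are all determined by the
coordinate at one common smaller subgroup. -/
theorem denseRange_toProTwoCompletion : DenseRange (toProTwoCompletion A) := by
  intro f
  rw [mem_closure_iff]
  rintro _ ⟨V, hV, rfl⟩ hf
  obtain ⟨F, u, hu, huV⟩ := isOpen_pi_iff.1 hV f.1 hf
  obtain ⟨N, hN⟩ := exists_le_finset F
  have := N.normal
  obtain ⟨a, ha⟩ : ∃ a, FiniteTwoQuotient.proj N a = f.1 N := QuotientGroup.mk_surjective _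
  refine ⟨toProTwoCompletion A a, huV fun M hM => ?_, a, rfl⟩
  have h1 : FiniteTwoQuotient.proj M a = f.1 M := by
    rw [← f.2 N M (hN M hM), ← ha]; rfl
  change FiniteTwoQuotient.proj M a ∈ u M
  rw [h1]
  exact (hu M hM).2

variable {H : Type*} [Group H]

/-- The extension to the pro-`2` completion of a homomorphism with finite image of `2`-power
order. -/
def extend (f : A →* H) (hf : ∃ k, Nat.card f.range = 2 ^ k) : proTwoCompletion A →* H :=
  (QuotientGroup.kerLift f).comp
    ((Pi.evalMonoidHom (fun N : TwoPowerNormalSubgroup A => FiniteTwoQuotient N)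
      ⟨f.ker, inferInstance, by simpa [Subgroup.index_ker] using hf⟩).comp
      (proTwoCompletion A).subtype)

theorem extend_apply (f : A →* H) (hf : ∃ k, Nat.card f.range = 2 ^ k) (a : A) :
    extend f hf (toProTwoCompletion A a) = f a := rfl

theorem isOpen_ker_extend (f : A →* H) (hf : ∃ k, Nat.card f.range = 2 ^ k) :
    IsOpen ((extend f hf).ker : Set (proTwoCompletion A)) := by
  have hc : Continuous fun g : proTwoCompletion A =>
      g.1 ⟨f.ker, inferInstance, by simpa [Subgroup.index_ker] using hf⟩ :=
    (continuous_apply _).comp continuous_subtype_val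
  exact hc.isOpen_preimage {q | QuotientGroup.kerLift f q = 1} (isOpen_discrete _)

end ProTwoCompletion

/-! ### Density of the abstract free group in `G_Γ` -/

namespace ProTwoRAAG

variable {d : ℕ} {Γ : SimpleGraph (Fin d)}

variable (Γ) in
/-- The canonical map from the free group to a pro-`2` right-angled Artin group. -/
def freeHom : FreeGroup (Fin d) →* ProTwoRAAG Γ :=
  (QuotientGroup.mk' _).comp (toProTwoCompletion _)

theorem freeHom_of (i : Fin d) : freeHom Γ (FreeGroup.of i) = gen Γ i := rfl

theorem denseRange_freeHom : DenseRange (freeHom Γ) :=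
  (QuotientGroup.mk'_surjective _).denseRange.comp
    ProTwoCompletion.denseRange_toProTwoCompletion continuous_quot_mk

theorem exists_freeHom_mem {N : Subgroup (ProTwoRAAG Γ)} (hN : IsOpen (N : Set (ProTwoRAAG Γ)))
    (g : ProTwoRAAG Γ) : ∃ w, g⁻¹ * freeHom Γ w ∈ N := by
  have ho : IsOpen ((fun h => g⁻¹ * h) ⁻¹' (N : Set (ProTwoRAAG Γ))) :=
    hN.preimage (continuous_const_mul _)
  obtain ⟨w, hw⟩ := denseRange_freeHom.exists_mem_open ho ⟨g, by simp [one_mem]⟩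
  exact ⟨w, hw⟩

/-- Open kernels play the role of continuity: modulo the intersection of the two kernels, every
element is represented by a word in the generators. -/
theorem hom_ext {H : Type*} [Group H] {φ ψ : ProTwoRAAG Γ →* H}
    (hφ : IsOpen (φ.ker : Set (ProTwoRAAG Γ))) (hψ : IsOpen (ψ.ker : Set (ProTwoRAAG Γ)))
    (h : ∀ i, φ (gen Γ i) = ψ (gen Γ i)) : φ = ψ := by
  have hfree : φ.comp (freeHom Γ) = ψ.comp (freeHom Γ) := FreeGroup.ext_hom _ _ h
  refine MonoidHom.ext fun g => ?_
  obtain ⟨w, hw⟩ := exists_freeHom_mem (N := φ.ker ⊓ ψ.ker) (hφ.inter hψ) g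
  have h1 : φ g = φ (freeHom Γ w) := inv_mul_eq_one.1 (by
    rw [← map_inv, ← map_mul]; exact hw.1)
  have h2 : ψ g = ψ (freeHom Γ w) := inv_mul_eq_one.1 (by
    rw [← map_inv, ← map_mul]; exact hw.2)
  rw [h1, h2]
  exact DFunLike.congr_fun hfree w

theorem closure_range_mk_gen (N : OpenNormalSubgroup (ProTwoRAAG Γ)) :
    Subgroup.closure (Set.range fun i => (gen Γ i : ProTwoRAAG Γ ⧸ N.toSubgroup)) = ⊤ := by
  rw [eq_top_iff]
  rintro q -
  obtain ⟨g, rfl⟩ := QuotientGroup.mk_surjective q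
  obtain ⟨w, hw⟩ := exists_freeHom_mem N.isOpen' g
  rw [QuotientGroup.eq.2 hw]
  have : ((QuotientGroup.mk' N.toSubgroup).comp (freeHom Γ)) w ∈
      ((QuotientGroup.mk' N.toSubgroup).comp (freeHom Γ)).range := ⟨w, rfl⟩
  have h2 : (QuotientGroup.mk' N.toSubgroup).comp (freeHom Γ) = FreeGroup.lift
      fun i => (gen Γ i : ProTwoRAAG Γ ⧸ N.toSubgroup) :=
    FreeGroup.ext_hom _ _ fun i => by simp [freeHom_of]
  rw [h2, FreeGroup.range_lift_eq_closure] at this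
  rw [← h2] at this
  exact this

theorem gen_comm {u v : Fin d} (h : Γ.Adj u v) : gen Γ u * gen Γ v = gen Γ v * gen Γ u := by
  have hmem : toProTwoCompletion _ ((FreeGroup.of u)⁻¹ * (FreeGroup.of v)⁻¹ *
      FreeGroup.of u * FreeGroup.of v) ∈ relationSubgroup Γ :=
    Subgroup.le_topologicalClosure _ (Subgroup.subset_normalClosure ⟨u, v, h, rfl⟩)
  have h1 : freeHom Γ ((FreeGroup.of u)⁻¹ * (FreeGroup.of v)⁻¹ *
      FreeGroup.of u * FreeGroup.of v) = 1 := (QuotientGroup.eq_one_iff _).2 hmem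
  simp only [map_mul, map_inv, freeHom_of] at h1
  have h2 : (gen Γ v * gen Γ u)⁻¹ * (gen Γ u * gen Γ v) = 1 := by
    rw [mul_inv_rev, ← mul_assoc]; exact h1
  exact (inv_mul_eq_one.1 h2).symm

end ProTwoRAAG

/-! ### Truncated Magnus representations -/

theorem one_add_pow_two_pow {R : Type*} [Ring R] [Algebra (ZMod 2) R] (x : R) (k : ℕ) :
    (1 + x) ^ 2 ^ k = 1 + x ^ 2 ^ k := by
  induction k with
  | zero => simp
  | succ k ih =>
    rw [pow_succ 2 k, pow_mul, pow_mul, ih, sq, sq, add_mul, one_mul, mul_add, mul_one, ← add_assoc,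
      add_assoc 1, algebra_add_self, add_zero]

namespace GraphAlgebra

open ProTwoRAAG

variable {d : ℕ} {Γ : SimpleGraph (Fin d)}

variable (Γ) in
/-- The truncation of the associative algebra of a graph in degrees at most `n`. -/
abbrev Trunc (n : ℕ) : Type := GraphAlgebra Γ ⧸ augIdeal Γ ^ (n + 1)

variable (Γ) in
/-- The projection to the truncation. -/
abbrev trunc (n : ℕ) : GraphAlgebra Γ →ₐ[ZMod 2] Trunc Γ n :=
  Ideal.Quotient.mkₐ (ZMod 2) (augIdeal Γ ^ (n + 1))

theorem trunc_eq_zero {n : ℕ} {a : GraphAlgebra Γ} :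
    trunc Γ n a = 0 ↔ a ∈ augIdeal Γ ^ (n + 1) := Ideal.Quotient.eq_zero_iff_mem

theorem pow_mem_augIdeal_pow {a : GraphAlgebra Γ} (ha : a ∈ augIdeal Γ) (n : ℕ) :
    a ^ n ∈ augIdeal Γ ^ n := by
  induction n with
  | zero => rw [Submodule.pow_zero, Ideal.one_eq_top]; trivial
  | succ n ih => rw [pow_succ]; exact Ideal.mul_mem_pow_succ ih ha

theorem trunc_pow_eq_zero {a : GraphAlgebra Γ} (ha : a ∈ augIdeal Γ) {n k : ℕ} (h : n < k) :
    trunc Γ n a ^ k = 0 := by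
  rw [← map_pow, trunc_eq_zero]
  exact Ideal.pow_le_pow_right h (pow_mem_augIdeal_pow ha k)

/-- Units have augmentation `1`, the only unit of `𝔽₂`. -/
theorem exists_unit_eq {n : ℕ} (u : (Trunc Γ n)ˣ) :
    ∃ a ∈ augIdeal Γ, (u : Trunc Γ n) = 1 + trunc Γ n a := by
  obtain ⟨a, ha⟩ := Ideal.Quotient.mkₐ_surjective (ZMod 2) (augIdeal Γ ^ (n + 1)) (u : Trunc Γ n)
  obtain ⟨b, hb⟩ := Ideal.Quotient.mkₐ_surjective (ZMod 2) (augIdeal Γ ^ (n + 1))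
    ((u⁻¹ : (Trunc Γ n)ˣ) : Trunc Γ n)
  have hab : a * b - 1 ∈ augIdeal Γ ^ (n + 1) := by
    rw [← trunc_eq_zero, map_sub, map_mul, ha, hb, map_one, Units.mul_inv, sub_self]
  have hab' : aug Γ (a * b - 1) = 0 := by
    have := Ideal.pow_le_pow_right (show 1 ≤ n + 1 by omega) hab
    rwa [Submodule.pow_one] at this
  rw [map_sub, map_mul, map_one, sub_eq_zero] at hab'
  have h1 : aug Γ a = 1 := by
    revert hab'
    generalize aug Γ a = x
    generalize aug Γ b = y
    revert x y
    decide
  have h2 : a - 1 ∈ augIdeal Γ := by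
    change aug Γ (a - 1) = 0
    rw [map_sub, h1, map_one, sub_self]
  refine ⟨a - 1, h2, ?_⟩
  rw [map_sub, map_one]
  exact ha.symm.trans (by abel)

theorem isPGroup_units_trunc (n : ℕ) : IsPGroup 2 (Trunc Γ n)ˣ := by
  intro u
  obtain ⟨a, ha, hu⟩ := exists_unit_eq u
  -- By Frobenius `(1 + a)^(2^n) = 1 + a^(2^n)`, and `2^n ≥ n + 1` kills the last term in the
  -- truncation.
  exact ⟨n, Units.ext (by rw [Units.val_pow_eq_pow_val, hu, one_add_pow_two_pow,
    trunc_pow_eq_zero ha (Nat.lt_two_pow_self (n := n)), add_zero, Units.val_one])⟩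

/-- The unit `1 + X i` of the truncation. -/
def unitX (n : ℕ) (i : Fin d) : (Trunc Γ n)ˣ :=
  (IsNilpotent.isUnit_one_add
    ⟨n + 1, trunc_pow_eq_zero (X_mem_augIdeal (Γ := Γ) i) n.lt_succ_self⟩).unit

theorem val_unitX (n : ℕ) (i : Fin d) :
    (unitX n i : (Trunc Γ n)ˣ).val = 1 + trunc Γ n (X Γ i) := rfl

theorem card_range_lift_unitX (n : ℕ) :
    ∃ k, Nat.card (FreeGroup.lift (unitX (Γ := Γ) n)).range = 2 ^ k :=
  IsPGroup.iff_card.1 ((isPGroup_units_trunc n).to_subgroup _)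

variable (Γ) in
/-- The truncated Magnus representation of a pro-`2` right-angled Artin group. -/
def magnusHom (n : ℕ) : ProTwoRAAG Γ →* (Trunc Γ n)ˣ :=
  QuotientGroup.lift _ (ProTwoCompletion.extend _ (card_range_lift_unitX (Γ := Γ) n)) <| by
    refine Subgroup.topologicalClosure_minimal _ (Subgroup.normalClosure_le_normal ?_)
      (Subgroup.isClosed_of_isOpen _ (ProTwoCompletion.isOpen_ker_extend _ _))
    rintro _ ⟨u, v, h, rfl⟩
    change ProTwoCompletion.extend _ _ _ = 1
    have hc : unitX (Γ := Γ) n u * unitX n v = unitX n v * unitX n u := Units.ext (by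
      have hc := X_comm h
      simp only [Units.val_mul, val_unitX, mul_add, add_mul, one_mul, mul_one, ← map_mul, hc]
      abel)
    rw [ProTwoCompletion.extend_apply]
    simp only [map_mul, map_inv, FreeGroup.lift_apply_of]
    rw [mul_assoc, hc]
    group

theorem magnusHom_gen (n : ℕ) (i : Fin d) : magnusHom Γ n (gen Γ i) = unitX n i := by
  change FreeGroup.lift (unitX n) (FreeGroup.of i) = _
  simp

theorem isOpen_ker_magnusHom (n : ℕ) :
    IsOpen ((magnusHom Γ n).ker : Set (ProTwoRAAG Γ)) := by
  refine isQuotientMap_quotient_mk'.isOpen_preimage.1 ?_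
  exact ProTwoCompletion.isOpen_ker_extend _ (card_range_lift_unitX (Γ := Γ) n)

end GraphAlgebra

/-! ## Completed group algebras -/

namespace CompletedGroupAlgebra

section Lift

variable {Q R : Type*} [Group Q] [Ring R] [Algebra (ZMod 2) R]

theorem algHom_ext {φ ψ : MonoidAlgebra (ZMod 2) Q →ₐ[ZMod 2] R}
    (h : ∀ q, φ (MonoidAlgebra.of (ZMod 2) Q q) = ψ (MonoidAlgebra.of (ZMod 2) Q q)) : φ = ψ :=
  (MonoidAlgebra.lift (ZMod 2) R Q).symm.injective (MonoidHom.ext h)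

variable (Q) in
/-- The augmentation of a group algebra. -/
def finiteAug : MonoidAlgebra (ZMod 2) Q →ₐ[ZMod 2] ZMod 2 :=
  MonoidAlgebra.lift (ZMod 2) (ZMod 2) Q 1

theorem finiteAug_of (q : Q) : finiteAug Q (MonoidAlgebra.of (ZMod 2) Q q) = 1 := by
  rw [finiteAug, MonoidAlgebra.lift_of, MonoidHom.one_apply]

/-- The difference is the sum of the terms `c_q (φ q - 1)`. A bound on `φ q - 1` over the group thus
becomes a bound on the whole augmentation ideal, the form used in `lift_mem`. -/
theorem lift_sub_mem (φ : Q →* R) {F : AddSubgroup R} (hF : ∀ q, φ q - 1 ∈ F)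
    (p : MonoidAlgebra (ZMod 2) Q) :
    MonoidAlgebra.lift (ZMod 2) R Q φ p -
      algebraMap (ZMod 2) R (finiteAug Q p) ∈ F := by
  induction p using MonoidAlgebra.induction_linear with
  | zero => simp [zero_mem]
  | add p q hp hq =>
    simp only [map_add]
    rw [add_sub_add_comm]
    exact add_mem hp hq
  | single q c =>
    rw [finiteAug, MonoidAlgebra.lift_single, MonoidAlgebra.lift_single]
    obtain rfl | rfl := zmod_two_eq_zero_or_one c
    · simp [zero_mem]
    · simpa using hF q

end Lift

variable {G : Type*} [Group G] [TopologicalSpace G]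

theorem groupAlgebraTransition_of {N M : OpenNormalSubgroup G}
    (h : N.toSubgroup ≤ M.toSubgroup) (g : G) :
    groupAlgebraTransition h (MonoidAlgebra.of (ZMod 2) _ (g : G ⧸ N.toSubgroup)) =
      MonoidAlgebra.of (ZMod 2) _ (g : G ⧸ M.toSubgroup) := by
  simp only [groupAlgebraTransition, MonoidAlgebra.of_apply,
    MonoidAlgebra.mapDomainAlgHom_apply, MonoidAlgebra.mapDomain_single]
  rfl

/-- The whole group as an open normal subgroup. -/
def topSubgroup (G : Type*) [Group G] [TopologicalSpace G] : OpenNormalSubgroup G :=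
  ⟨⊤, inferInstanceAs (⊤ : Subgroup G).Normal⟩

theorem completedAugmentation_eq (N : OpenNormalSubgroup G) (x : completedGroupAlgebra G) :
    completedAugmentation G x = finiteAug (G ⧸ N.toSubgroup) (x.1 N) := by
  have hN : N.toSubgroup ≤ (topSubgroup G).toSubgroup := fun _ _ => trivial
  have h0 : completedAugmentation G x =
    finiteAug (G ⧸ (topSubgroup G).toSubgroup) (x.1 (topSubgroup G)) := rfl
  rw [h0, ← x.2 N (topSubgroup G) hN]
  refine DFunLike.congr_fun (F := _ →ₐ[ZMod 2] _) (f := (finiteAug _).comp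
    (groupAlgebraTransition hN)) (g := finiteAug _) (algHom_ext fun q => ?_) (x.1 N)
  obtain ⟨g, rfl⟩ := QuotientGroup.mk_surjective q
  rw [AlgHom.comp_apply, groupAlgebraTransition_of, finiteAug_of, finiteAug_of]

theorem sub_algebraMap_mem (x : completedGroupAlgebra G) :
    x - algebraMap (ZMod 2) _ (completedAugmentation G x) ∈ completedAugmentationIdeal G := by
  change completedAugmentation G _ = 0
  rw [map_sub, AlgHom.commutes]
  exact sub_self _

variable {R : Type*} [Ring R] [Algebra (ZMod 2) R]

/-- The homomorphism from a completed group algebra which extends a homomorphism from the group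
that is trivial on an open normal subgroup. -/
def lift (f : G →* R) (N : OpenNormalSubgroup G) (hN : N.toSubgroup ≤ f.ker) :
    completedGroupAlgebra G →ₐ[ZMod 2] R :=
  ((MonoidAlgebra.lift (ZMod 2) R (G ⧸ N.toSubgroup) (QuotientGroup.lift N.toSubgroup f hN)).comp
    (Pi.evalAlgHom (ZMod 2)
      (fun N : OpenNormalSubgroup G => MonoidAlgebra (ZMod 2) (G ⧸ N.toSubgroup)) N)).comp
    (completedGroupAlgebra G).val

theorem lift_apply (f : G →* R) (N : OpenNormalSubgroup G) (hN : N.toSubgroup ≤ f.ker) (g : G) :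
    lift f N hN (toCompletedGroupAlgebra G g) = f g := by
  simp [lift, toCompletedGroupAlgebra]

theorem lift_mem (f : G →* R) (N : OpenNormalSubgroup G) (hN : N.toSubgroup ≤ f.ker)
    {F : AddSubgroup R} (hF : ∀ g, f g - 1 ∈ F) {x : completedGroupAlgebra G}
    (hx : x ∈ completedAugmentationIdeal G) : lift f N hN x ∈ F := by
  have h := lift_sub_mem (QuotientGroup.lift N.toSubgroup f hN) (F := F) (fun q => by
    obtain ⟨g, rfl⟩ := QuotientGroup.mk_surjective q
    exact hF g) (x.1 N)
  have h0 : completedAugmentation G x = 0 := hx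
  rw [← completedAugmentation_eq, h0, map_zero, sub_zero] at h
  exact h

/-! ### Functoriality -/

section Map

variable {H : Type*} [Group H] [TopologicalSpace H]

/-- The inverse image of an open normal subgroup. -/
def comapSubgroup (φ : H →* G) (hφ : Continuous φ) (N : OpenNormalSubgroup G) :
    OpenNormalSubgroup H :=
  { toOpenSubgroup := ⟨N.toSubgroup.comap φ, N.isOpen'.preimage hφ⟩
    isNormal' := inferInstanceAs (N.toSubgroup.comap φ).Normal }

/-- The map of finite-level group algebras induced by a homomorphism. -/
def mapComponent (φ : H →* G) (hφ : Continuous φ) (N : OpenNormalSubgroup G) :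
    MonoidAlgebra (ZMod 2) (H ⧸ (comapSubgroup φ hφ N).toSubgroup) →ₐ[ZMod 2]
      MonoidAlgebra (ZMod 2) (G ⧸ N.toSubgroup) :=
  MonoidAlgebra.lift (ZMod 2) _ _ ((MonoidAlgebra.of (ZMod 2) (G ⧸ N.toSubgroup)).comp
    (QuotientGroup.map _ N.toSubgroup φ (le_refl (N.toSubgroup.comap φ))))

theorem mapComponent_of (φ : H →* G) (hφ : Continuous φ) (N : OpenNormalSubgroup G) (h : H) :
    mapComponent φ hφ N (MonoidAlgebra.of (ZMod 2) _
      (h : H ⧸ (comapSubgroup φ hφ N).toSubgroup)) =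
      MonoidAlgebra.of (ZMod 2) _ (φ h : G ⧸ N.toSubgroup) := by
  rw [mapComponent, MonoidAlgebra.lift_of]
  rfl

/-- The homomorphism of completed group algebras induced by a continuous homomorphism. -/
def map (φ : H →* G) (hφ : Continuous φ) :
    completedGroupAlgebra H →ₐ[ZMod 2] completedGroupAlgebra G :=
  AlgHom.codRestrict
    (AlgHom.pi fun N : OpenNormalSubgroup G => (mapComponent φ hφ N).comp
      ((Pi.evalAlgHom (ZMod 2)
        (fun N : OpenNormalSubgroup H => MonoidAlgebra (ZMod 2) (H ⧸ N.toSubgroup))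
        (comapSubgroup φ hφ N)).comp (completedGroupAlgebra H).val)) _ fun x N M h => by
    have hle : (comapSubgroup φ hφ N).toSubgroup ≤ (comapSubgroup φ hφ M).toSubgroup :=
      Subgroup.comap_mono h
    have hx := x.2 (comapSubgroup φ hφ N) (comapSubgroup φ hφ M) hle
    change groupAlgebraTransition h (mapComponent φ hφ N (x.1 (comapSubgroup φ hφ N))) =
      mapComponent φ hφ M (x.1 (comapSubgroup φ hφ M))
    rw [← hx]
    refine DFunLike.congr_fun (f := (groupAlgebraTransition h).comp (mapComponent φ hφ N))
      (g := (mapComponent φ hφ M).comp (groupAlgebraTransition hle))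
      (algHom_ext fun q => ?_) _
    obtain ⟨g, rfl⟩ := QuotientGroup.mk_surjective q
    rw [AlgHom.comp_apply, AlgHom.comp_apply, mapComponent_of, groupAlgebraTransition_of,
      groupAlgebraTransition_of, mapComponent_of]

theorem map_apply (φ : H →* G) (hφ : Continuous φ) (h : H) :
    map φ hφ (toCompletedGroupAlgebra H h) = toCompletedGroupAlgebra G (φ h) := by
  refine Subtype.ext (funext fun N => ?_)
  exact mapComponent_of φ hφ N h

theorem map_mem (φ : H →* G) (hφ : Continuous φ) {x : completedGroupAlgebra H}
    (hx : x ∈ completedAugmentationIdeal H) : map φ hφ x ∈ completedAugmentationIdeal G := by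
  have h0 : completedAugmentation H x = 0 := hx
  change completedAugmentation G (map φ hφ x) = 0
  rw [completedAugmentation_eq (topSubgroup G), ← h0,
    completedAugmentation_eq (comapSubgroup φ hφ (topSubgroup G))]
  refine DFunLike.congr_fun (F := _ →ₐ[ZMod 2] _) (f := (finiteAug _).comp
    (mapComponent φ hφ (topSubgroup G))) (g := finiteAug _) (algHom_ext fun q => ?_) _
  obtain ⟨g, rfl⟩ := QuotientGroup.mk_surjective q
  rw [AlgHom.comp_apply, mapComponent_of, finiteAug_of, finiteAug_of]

/-- Applied to `G_Γ → G_z`, this is the easy inclusion of the main theorem. -/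
theorem map_zassenhaus_le (φ : H →* G) (hφ : Continuous φ) (n : ℕ) :
    (zassenhaus H n).map φ ≤ zassenhaus G n := by
  rintro _ ⟨h, hh, rfl⟩
  have hh : toCompletedGroupAlgebra H h - 1 ∈ completedAugmentationIdeal H ^ n := hh
  rw [mem_zassenhaus, ← map_apply φ hφ, ← map_one (map φ hφ), ← map_sub]
  exact Ideal.map_pow_mem (φ := (map φ hφ).toRingHom)
    (F := fun n => (completedAugmentationIdeal G ^ n).toAddSubgroup)
    (fun x => by rw [Submodule.pow_zero, Ideal.one_eq_top]; trivial)
    (fun x hx => by rw [Submodule.pow_one]; exact map_mem φ hφ hx)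
    (fun n a ha b hb => Ideal.mul_mem_pow_succ ha (by rwa [Submodule.pow_one] at hb)) hh

end Map

theorem zassenhaus_antitone : Antitone (zassenhaus G) := fun _ _ h _ hg =>
  Ideal.pow_le_pow_right h hg

/-! ### Generators of the augmentation ideal -/

section Generators

theorem exists_eq_sum_of_closure {Q : Type*} [Group Q] {d : ℕ} {x : Fin d → Q}
    (hx : Subgroup.closure (Set.range x) = ⊤) {p : MonoidAlgebra (ZMod 2) Q}
    (hp : finiteAug Q p = 0) :
    ∃ v : Fin d → MonoidAlgebra (ZMod 2) Q,
      ∑ i, v i * (MonoidAlgebra.of (ZMod 2) Q (x i) - 1) = p := by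
  set Λ : Ideal (MonoidAlgebra (ZMod 2) Q) :=
    Submodule.span _ (Set.range fun i => MonoidAlgebra.of (ZMod 2) Q (x i) - 1) with hΛ
  -- The elements `q` with `q - 1` in the left ideal form a subgroup containing the generators,
  -- hence are everything.
  let K : Subgroup Q :=
    { carrier := {q | MonoidAlgebra.of (ZMod 2) Q q - 1 ∈ Λ}
      one_mem' := by rw [Set.mem_ofPred_eq, map_one, sub_self]; exact zero_mem _
      mul_mem' := fun {a b} ha hb => by
        have h : MonoidAlgebra.of (ZMod 2) Q (a * b) - 1 =
            MonoidAlgebra.of (ZMod 2) Q a * (MonoidAlgebra.of (ZMod 2) Q b - 1) +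
              (MonoidAlgebra.of (ZMod 2) Q a - 1) := by
          rw [map_mul, mul_sub, mul_one, sub_add_sub_cancel]
        rw [Set.mem_ofPred_eq, h]
        exact add_mem (Ideal.mul_mem_left _ _ hb) ha
      inv_mem' := fun {a} ha => by
        have h : MonoidAlgebra.of (ZMod 2) Q a⁻¹ - 1 =
            -(MonoidAlgebra.of (ZMod 2) Q a⁻¹ * (MonoidAlgebra.of (ZMod 2) Q a - 1)) := by
          rw [mul_sub, ← map_mul, inv_mul_cancel, map_one, mul_one, neg_sub]
        rw [Set.mem_ofPred_eq, h]
        exact neg_mem (Ideal.mul_mem_left _ _ ha) }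
  have hK : ∀ q, q ∈ K := by
    have : Subgroup.closure (Set.range x) ≤ K := (Subgroup.closure_le _).2 (by
      rintro _ ⟨i, rfl⟩
      exact Submodule.subset_span ⟨i, rfl⟩)
    rw [hx] at this
    exact fun q => this trivial
  have h := lift_sub_mem (MonoidAlgebra.of (ZMod 2) Q) (F := Λ.toAddSubgroup) hK p
  have hid : MonoidAlgebra.lift (ZMod 2) _ Q (MonoidAlgebra.of (ZMod 2) Q) = AlgHom.id _ _ :=
    algHom_ext fun q => by simp
  rw [hp, map_zero, sub_zero, hid] at h
  exact (Submodule.mem_span_range_iff_exists_fun _).1 h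

instance finite_monoidAlgebra {Q : Type*} [Finite Q] : Finite (MonoidAlgebra (ZMod 2) Q) :=
  Finite.of_injective (fun p (q : Q) => p.coeff q) fun _ _ h =>
    MonoidAlgebra.coeffEquiv.injective (Finsupp.ext fun q => congrFun h q)

theorem groupAlgebraTransition_refl (N : OpenNormalSubgroup G) :
    groupAlgebraTransition (le_refl N.toSubgroup) = AlgHom.id _ _ :=
  algHom_ext fun q => by
    obtain ⟨g, rfl⟩ := QuotientGroup.mk_surjective q
    exact groupAlgebraTransition_of _ g

theorem groupAlgebraTransition_comp {N M K : OpenNormalSubgroup G}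
    (h : N.toSubgroup ≤ M.toSubgroup) (h' : M.toSubgroup ≤ K.toSubgroup) :
    (groupAlgebraTransition h').comp (groupAlgebraTransition h) =
      groupAlgebraTransition (h.trans h') :=
  algHom_ext fun q => by
    obtain ⟨g, rfl⟩ := QuotientGroup.mk_surjective q
    rw [AlgHom.comp_apply, groupAlgebraTransition_of, groupAlgebraTransition_of,
      groupAlgebraTransition_of]

variable {d : ℕ} {x : Fin d → G}

/-- The ways to write a component of an element of the completed group algebra as a combination
of the elements `x i - 1`. -/
def Solution (x : Fin d → G) (f : completedGroupAlgebra G) (N : OpenNormalSubgroup G) : Type _ :=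
  {v : Fin d → MonoidAlgebra (ZMod 2) (G ⧸ N.toSubgroup) //
    ∑ i, v i * (MonoidAlgebra.of (ZMod 2) _ (x i : G ⧸ N.toSubgroup) - 1) = f.1 N}

/-- The transition maps between sets of solutions. -/
def Solution.map {f : completedGroupAlgebra G} {N M : OpenNormalSubgroup G}
    (h : N.toSubgroup ≤ M.toSubgroup) (v : Solution x f N) : Solution x f M :=
  ⟨fun i => groupAlgebraTransition h (v.1 i), by
    refine Eq.trans ?_ ((congrArg (groupAlgebraTransition h) v.2).trans (f.2 N M h))
    rw [map_sum]
    simp only [map_mul, map_sub, map_one, groupAlgebraTransition_of]⟩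

/-- At each finite level the set of solutions is finite and nonempty, so the inverse system of
solution sets has a section. Compactness of `G` is used for the finiteness of the quotients. -/
theorem exists_eq_sum [IsTopologicalGroup G] [CompactSpace G]
    (hx : ∀ N : OpenNormalSubgroup G,
      Subgroup.closure (Set.range fun i => (x i : G ⧸ N.toSubgroup)) = ⊤)
    {f : completedGroupAlgebra G} (hf : f ∈ completedAugmentationIdeal G) :
    ∃ v : Fin d → completedGroupAlgebra G,
      f = ∑ i, v i * (toCompletedGroupAlgebra G (x i) - 1) := by
  let F : CategoryTheory.Functor (OpenNormalSubgroup G) (Type _) :=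
    { obj := fun N => Solution x f N
      map := fun {N M} h => TypeCat.ofHom (Solution.map (CategoryTheory.leOfHom h))
      map_id := fun N => by
        ext v
        refine Subtype.ext (funext fun i => ?_)
        exact DFunLike.congr_fun (groupAlgebraTransition_refl N) (v.1 i)
      map_comp := fun {N M K} h h' => by
        ext v
        refine Subtype.ext (funext fun i => ?_)
        exact (DFunLike.congr_fun (groupAlgebraTransition_comp (CategoryTheory.leOfHom h)
          (CategoryTheory.leOfHom h')) (v.1 i)).symm }
  have hfin : ∀ N, Finite (F.obj N) := fun N => by
    have : Finite (G ⧸ N.toSubgroup) := Subgroup.quotient_finite_of_isOpen _ N.isOpen'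
    exact inferInstanceAs (Finite (Subtype _))
  have hne : ∀ N, Nonempty (F.obj N) := fun N => by
    have h0 : completedAugmentation G f = 0 := hf
    rw [completedAugmentation_eq N] at h0
    obtain ⟨v, hv⟩ := exists_eq_sum_of_closure (hx N) h0
    exact ⟨⟨v, hv⟩⟩
  obtain ⟨s, hs⟩ := nonempty_sections_of_finite_cofiltered_system F
  refine ⟨fun i => ⟨fun N => (s N).1 i, fun N M h => ?_⟩, ?_⟩
  · have hs' : Solution.map h (s N) = s M := hs (CategoryTheory.homOfLE h)
    exact congrFun (congrArg Subtype.val hs') i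
  · refine Subtype.ext (funext fun N => ?_)
    rw [← (s N).2]
    simp only [AddSubmonoidClass.coe_finsetSum, Finset.sum_apply]
    rfl

end Generators

end CompletedGroupAlgebra

/-! ## The Zassenhaus filtration of a pro-`2` right-angled Artin group -/

namespace GraphAlgebra

set_option synthInstance.maxHeartbeats 400000

open ProTwoRAAG

variable {d : ℕ} {Γ : SimpleGraph (Fin d)}

section Completed

variable {G : Type*} [Group G] [TopologicalSpace G] {x : Fin d → G}

/-- The homomorphism to a completed group algebra which sends `X i` to `x i - 1`, where `x` is a
family of elements of the group. -/
def toCompleted (hx : ∀ u v, Γ.Adj u v → x u * x v = x v * x u) :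
    GraphAlgebra Γ →ₐ[ZMod 2] completedGroupAlgebra G :=
  lift (fun i => toCompletedGroupAlgebra G (x i) - 1) fun u v h => by
    have := congrArg (toCompletedGroupAlgebra G) (hx u v h)
    rw [map_mul, map_mul] at this
    rw [← sub_eq_zero, ring_commutator_identity, this, sub_self]

variable (hx : ∀ u v, Γ.Adj u v → x u * x v = x v * x u)

theorem toCompleted_X (i : Fin d) :
    toCompleted hx (X Γ i) = toCompletedGroupAlgebra _ (x i) - 1 := lift_X _ _ i

theorem toCompleted_mem {n : ℕ} {a : GraphAlgebra Γ} (ha : a ∈ augIdeal Γ ^ n) :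
    toCompleted hx a ∈ completedAugmentationIdeal G ^ n := by
  refine Ideal.map_pow_mem (φ := (toCompleted hx).toRingHom)
    (F := fun n => (completedAugmentationIdeal G ^ n).toAddSubgroup)
    (fun x => by rw [Submodule.pow_zero, Ideal.one_eq_top]; trivial) (fun y hy => ?_)
    (fun n a ha b hb => Ideal.mul_mem_pow_succ ha (by rwa [Submodule.pow_one] at hb)) ha
  rw [Submodule.pow_one]
  obtain ⟨v, hv⟩ := exists_eq_sum y
  have h0 : aug Γ y = 0 := hy
  change toCompleted hx y ∈ completedAugmentationIdeal G
  rw [hv, h0, map_zero, zero_add, map_sum]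
  refine Ideal.sum_mem _ fun i _ => ?_
  rw [map_mul, toCompleted_X]
  exact Ideal.mul_mem_left _ _ (toCompletedGroupAlgebra_sub_one_mem _)

/-- Surjectivity of `A → E(G)/E_n(G)`: an element is a scalar plus a combination of the `x i - 1`,
whose coefficients are approximated one step less precisely. -/
theorem exists_toCompleted_sub_mem [IsTopologicalGroup G] [CompactSpace G]
    (hgen : ∀ N : OpenNormalSubgroup G,
      Subgroup.closure (Set.range fun i => (x i : G ⧸ N.toSubgroup)) = ⊤) (n : ℕ) :
    ∀ e : completedGroupAlgebra G,
      ∃ a, e - toCompleted hx a ∈ completedAugmentationIdeal G ^ n := by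
  induction n with
  | zero => exact fun e => ⟨0, by rw [Submodule.pow_zero, Ideal.one_eq_top]; trivial⟩
  | succ n ih =>
    intro e
    obtain ⟨v, hv⟩ := CompletedGroupAlgebra.exists_eq_sum hgen
      (CompletedGroupAlgebra.sub_algebraMap_mem e)
    choose a ha using fun i => ih (v i)
    refine ⟨algebraMap (ZMod 2) _ (completedAugmentation G e) + ∑ i, a i * X Γ i, ?_⟩
    rw [map_add, AlgHom.commutes, ← sub_sub, hv, map_sum, ← Finset.sum_sub_distrib]
    refine Ideal.sum_mem _ fun i _ => ?_
    rw [map_mul, toCompleted_X, ← sub_mul]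
    exact Ideal.mul_mem_pow_succ (ha i) (toCompletedGroupAlgebra_sub_one_mem _)

end Completed

/-! ### Comparison of `E(G_Γ)/E_(n+1)(G_Γ)` with the truncated graph algebra -/

variable (Γ) in
/-- The kernel of the truncated Magnus representation, as an open normal subgroup. -/
def magnusKer (n : ℕ) : OpenNormalSubgroup (ProTwoRAAG Γ) :=
  { toOpenSubgroup := ⟨(magnusHom Γ n).ker, isOpen_ker_magnusHom n⟩
    isNormal' := inferInstanceAs (magnusHom Γ n).ker.Normal }

variable (Γ) in
/-- The extension of the truncated Magnus representation to the completed group algebra. -/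
def magnusAlgHom (n : ℕ) : completedGroupAlgebra (ProTwoRAAG Γ) →ₐ[ZMod 2] Trunc Γ n :=
  CompletedGroupAlgebra.lift ((Units.coeHom _).comp (magnusHom Γ n)) (magnusKer Γ n)
    fun g (hg : magnusHom Γ n g = 1) => by
      change ((magnusHom Γ n g : (Trunc Γ n)ˣ) : Trunc Γ n) = 1
      rw [hg, Units.val_one]

theorem magnusAlgHom_apply (n : ℕ) (g : ProTwoRAAG Γ) :
    magnusAlgHom Γ n (toCompletedGroupAlgebra _ g) = (magnusHom Γ n g).val :=
  CompletedGroupAlgebra.lift_apply _ _ _ g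

theorem magnusAlgHom_toCompleted (n : ℕ) (a : GraphAlgebra Γ) :
    magnusAlgHom Γ n (toCompleted (fun _ _ => gen_comm (Γ := Γ)) a) = trunc Γ n a := by
  refine DFunLike.congr_fun (F := GraphAlgebra Γ →ₐ[ZMod 2] Trunc Γ n)
    (f := (magnusAlgHom Γ n).comp (toCompleted (fun _ _ => gen_comm (Γ := Γ)))) (hom_ext fun i => ?_) a
  rw [AlgHom.comp_apply, toCompleted_X, map_sub, map_one, magnusAlgHom_apply, magnusHom_gen,
    val_unitX, add_sub_cancel_left]

theorem magnusAlgHom_eq_zero {n : ℕ} {e : completedGroupAlgebra (ProTwoRAAG Γ)}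
    (he : e ∈ completedAugmentationIdeal (ProTwoRAAG Γ) ^ (n + 1)) : magnusAlgHom Γ n e = 0 := by
  have h := Ideal.map_pow_mem (φ := (magnusAlgHom Γ n).toRingHom)
    (F := fun k => (augIdeal Γ ^ k).toAddSubgroup.map (trunc Γ n).toRingHom.toAddMonoidHom)
    (fun x => by
      obtain ⟨a, ha⟩ := Ideal.Quotient.mkₐ_surjective (ZMod 2) (augIdeal Γ ^ (n + 1))
        (magnusAlgHom Γ n x)
      exact ⟨a, by rw [Submodule.pow_zero, Ideal.one_eq_top]; trivial, ha⟩)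
    (fun x hx => CompletedGroupAlgebra.lift_mem _ _ _ (fun g => by
      obtain ⟨a, ha, h⟩ := exists_unit_eq (magnusHom Γ n g)
      refine ⟨a, by rwa [Submodule.pow_one], ?_⟩
      change trunc Γ n a = (magnusHom Γ n g).val - 1
      rw [h, add_sub_cancel_left]) hx)
    (by
      rintro k _ ⟨a, ha, rfl⟩ _ ⟨b, hb, rfl⟩
      exact ⟨a * b, Ideal.mul_mem_pow_succ ha (by
        have hb : b ∈ augIdeal Γ ^ 1 := hb
        rwa [Submodule.pow_one] at hb), map_mul (trunc Γ n) a b⟩) he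
  obtain ⟨a, ha, h⟩ := h
  exact h.symm.trans (trunc_eq_zero.2 ha)

/-- Approximate `e` by the image of some `a` in the graph algebra. The Magnus map sends that image
back to the truncation of `a`, so `a` lies in `I^(n+1)` and `e` in `E_(n+1)`. -/
theorem mem_of_magnusAlgHom_eq_zero {n : ℕ} {e : completedGroupAlgebra (ProTwoRAAG Γ)}
    (he : magnusAlgHom Γ n e = 0) : e ∈ completedAugmentationIdeal (ProTwoRAAG Γ) ^ (n + 1) := by
  obtain ⟨a, ha⟩ := exists_toCompleted_sub_mem (fun _ _ => gen_comm (Γ := Γ)) closure_range_mk_gen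
    (n + 1) e
  have h := magnusAlgHom_eq_zero ha
  rw [map_sub, he, zero_sub, neg_eq_zero, magnusAlgHom_toCompleted, trunc_eq_zero] at h
  have h2 := add_mem ha (toCompleted_mem (fun _ _ => gen_comm (Γ := Γ)) h)
  rwa [sub_add_cancel] at h2

/-- The terms of the Zassenhaus filtration are the kernels of the truncated Magnus
representations. -/
theorem mem_zassenhaus_succ {n : ℕ} {g : ProTwoRAAG Γ} :
    g ∈ zassenhaus (ProTwoRAAG Γ) (n + 1) ↔ magnusHom Γ n g = 1 := by
  rw [mem_zassenhaus]
  have h : magnusAlgHom Γ n (toCompletedGroupAlgebra _ g - 1) = 0 ↔ magnusHom Γ n g = 1 := by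
    rw [map_sub, map_one, magnusAlgHom_apply, sub_eq_zero, Units.val_eq_one]
  rw [← h]
  exact ⟨magnusAlgHom_eq_zero, mem_of_magnusAlgHom_eq_zero⟩

theorem mem_zassenhaus_one {G : Type*} [Group G] [TopologicalSpace G] (g : G) :
    g ∈ zassenhaus G 1 := by
  rw [mem_zassenhaus, Submodule.pow_one]
  exact toCompletedGroupAlgebra_sub_one_mem g

/-! ### Approximation by positive words -/

theorem magnusHom_prod (n : ℕ) (w : List (Fin d)) :
    (magnusHom Γ n (w.map (gen Γ)).prod).val = trunc Γ n (magnus Γ w) := by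
  induction w with
  | nil => simp [magnus]
  | cons i w ih =>
    have h : magnus Γ (i :: w) = (1 + X Γ i) * magnus Γ w := by simp [magnus]
    rw [List.map_cons, List.prod_cons, map_mul, Units.val_mul, ih, magnusHom_gen, val_unitX, h,
      map_mul, map_add, map_one]

/-- In a finite quotient, generators as a group also generate as a monoid. Positive words suffice,
so leading terms need only be computed for products of the `1 + X_i`, without inverses. -/
theorem exists_word (n : ℕ) (g : ProTwoRAAG Γ) :
    ∃ w : List (Fin d), g⁻¹ * (w.map (gen Γ)).prod ∈ zassenhaus (ProTwoRAAG Γ) (n + 1) := by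
  set N := magnusKer Γ n
  have : Finite (ProTwoRAAG Γ ⧸ N.toSubgroup) := Subgroup.quotient_finite_of_isOpen _ N.isOpen'
  have hmem : (g : ProTwoRAAG Γ ⧸ N.toSubgroup) ∈
      Submonoid.closure (Set.range fun i => (gen Γ i : ProTwoRAAG Γ ⧸ N.toSubgroup)) := by
    rw [← Subgroup.closure_toSubmonoid_of_finite, closure_range_mk_gen]
    trivial
  have key : ∀ q ∈ Submonoid.closure (Set.range fun i => (gen Γ i : ProTwoRAAG Γ ⧸ N.toSubgroup)),
      ∃ w : List (Fin d), q = ((w.map (gen Γ)).prod : ProTwoRAAG Γ) := by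
    intro q hq
    induction hq using Submonoid.closure_induction with
    | mem q hq => obtain ⟨i, rfl⟩ := hq; exact ⟨[i], by simp⟩
    | one => exact ⟨[], by simp⟩
    | mul p q _ _ hp hq =>
      obtain ⟨u, rfl⟩ := hp
      obtain ⟨v, rfl⟩ := hq
      exact ⟨u ++ v, by rw [List.map_append, List.prod_append]; rfl⟩
  obtain ⟨w, hw⟩ := key _ hmem
  exact ⟨w, mem_zassenhaus_succ.2 (QuotientGroup.eq.1 hw)⟩

theorem magnusHom_eq_of_mem {n : ℕ} {g h : ProTwoRAAG Γ}
    (hgh : g⁻¹ * h ∈ zassenhaus (ProTwoRAAG Γ) (n + 1)) : magnusHom Γ n g = magnusHom Γ n h := by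
  rw [mem_zassenhaus_succ, map_mul, map_inv, inv_mul_eq_one] at hgh
  exact hgh

/-! ### Leading terms -/

variable (Γ) in
/-- The component of degree `n`, on the truncation. -/
def compTrunc (n : ℕ) : Trunc Γ n →+ GraphAlgebra Γ :=
  QuotientAddGroup.lift (augIdeal Γ ^ (n + 1)).toAddSubgroup (comp n)
    fun _ ha => comp_eq_zero ha n.lt_succ_self

theorem compTrunc_trunc (n : ℕ) (a : GraphAlgebra Γ) : compTrunc Γ n (trunc Γ n a) = comp n a :=
  rfl

/-- The leading term, in degree `n`, of an element of the `n`-th term of the Zassenhaus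
filtration. -/
def lead (n : ℕ) (g : ProTwoRAAG Γ) : GraphAlgebra Γ :=
  compTrunc Γ n ((magnusHom Γ n g).val - 1)

theorem lead_eq {n : ℕ} {g : ProTwoRAAG Γ} {a : GraphAlgebra Γ}
    (h : (magnusHom Γ n g).val = 1 + trunc Γ n a) : lead n g = comp n a := by
  rw [lead, h, add_sub_cancel_left, compTrunc_trunc]

theorem magnus_sub_one_mem {n : ℕ} {w : List (Fin d)}
    (h : (w.map (gen Γ)).prod ∈ zassenhaus (ProTwoRAAG Γ) n) :
    magnus Γ w - 1 ∈ augIdeal Γ ^ n := by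
  cases n with
  | zero => rw [Submodule.pow_zero, Ideal.one_eq_top]; trivial
  | succ n =>
    rw [mem_zassenhaus_succ] at h
    rw [← trunc_eq_zero, map_sub, map_one, ← magnusHom_prod, h, Units.val_one, sub_self]

/-- One word approximates `g` both to the precision `N` of the computation and in its own degree
`n`, giving an exact representative of `g - 1` in `I^n`. -/
theorem exists_magnus {n N : ℕ} (hn : n ≤ N) {g : ProTwoRAAG Γ}
    (hg : g ∈ zassenhaus (ProTwoRAAG Γ) n) : ∃ w : List (Fin d),
      magnus Γ w - 1 ∈ augIdeal Γ ^ n ∧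
      (magnusHom Γ N g).val = 1 + trunc Γ N (magnus Γ w - 1) ∧
      lead n g = comp n (magnus Γ w - 1) := by
  obtain ⟨w, hw⟩ := exists_word N g
  have h1 : ∀ k ≤ N, (magnusHom Γ k g).val = 1 + trunc Γ k (magnus Γ w - 1) := fun k hk => by
    rw [magnusHom_eq_of_mem (CompletedGroupAlgebra.zassenhaus_antitone (Nat.succ_le_succ hk) hw),
      magnusHom_prod, map_sub, map_one, add_sub_cancel]
  refine ⟨w, magnus_sub_one_mem ?_, h1 N le_rfl, lead_eq (h1 n hn)⟩
  have := mul_mem hg (CompletedGroupAlgebra.zassenhaus_antitone (hn.trans N.le_succ) hw)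
  rwa [mul_inv_cancel_left] at this

theorem lead_one (n : ℕ) : lead n (1 : ProTwoRAAG Γ) = 0 := by
  rw [lead, map_one, Units.val_one, sub_self, map_zero]

/-- The cross term `ab` lies in `I^(2n)`, hence has no component of degree `n` when `n ≠ 0`. -/
theorem lead_mul {n : ℕ} (hn : n ≠ 0) {g h : ProTwoRAAG Γ}
    (hg : g ∈ zassenhaus (ProTwoRAAG Γ) n) (hh : h ∈ zassenhaus (ProTwoRAAG Γ) n) :
    lead n (g * h) = lead n g + lead n h := by
  obtain ⟨u, hu, hu1, hu2⟩ := exists_magnus le_rfl hg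
  obtain ⟨v, hv, hv1, hv2⟩ := exists_magnus le_rfl hh
  set a := magnus Γ u - 1
  set b := magnus Γ v - 1
  have hab : a * b ∈ augIdeal Γ ^ (n + n) := by
    rw [Ideal.IsTwoSided.pow_add]; exact Ideal.mul_mem_mul hu hv
  have h1 : (magnusHom Γ n (g * h)).val = 1 + trunc Γ n (a + b + a * b) := by
    rw [map_mul, Units.val_mul, hu1, hv1]
    simp only [map_add, map_mul]
    noncomm_ring
  rw [lead_eq h1, hu2, hv2, map_add, map_add, comp_eq_zero hab (by omega), add_zero]

theorem lead_eq_zero {n : ℕ} {g : ProTwoRAAG Γ} (hg : g ∈ zassenhaus (ProTwoRAAG Γ) n) :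
    lead n g = 0 ↔ g ∈ zassenhaus (ProTwoRAAG Γ) (n + 1) := by
  obtain ⟨w, hw, hw1, hw2⟩ := exists_magnus le_rfl hg
  rw [mem_zassenhaus_succ, ← Units.val_eq_one, hw1, add_eq_left, trunc_eq_zero, hw2]
  exact ⟨mem_pow_succ hw, fun h => comp_eq_zero h n.lt_succ_self⟩

/-- The commutator minus one is `g⁻¹ h⁻¹ (gh - hg)`. The prefix is `1 + c` with `c` in `I`, so it
does not affect the leading term `ab - ba`. -/
theorem lead_commutator {m n : ℕ} {g h : ProTwoRAAG Γ}
    (hg : g ∈ zassenhaus (ProTwoRAAG Γ) m) (hh : h ∈ zassenhaus (ProTwoRAAG Γ) n) :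
    lead (m + n) (g⁻¹ * h⁻¹ * g * h) = lead m g * lead n h - lead n h * lead m g := by
  obtain ⟨u, hu, hu1, hu2⟩ := exists_magnus (Nat.le_add_right m n) hg
  obtain ⟨v, hv, hv1, hv2⟩ := exists_magnus (Nat.le_add_left n m) hh
  set a := magnus Γ u - 1
  set b := magnus Γ v - 1
  obtain ⟨c, hc, hc1⟩ := exists_unit_eq (magnusHom Γ (m + n) (g⁻¹ * h⁻¹))
  have hab : a * b - b * a ∈ augIdeal Γ ^ (m + n) := by
    refine sub_mem ?_ ?_
    · rw [Ideal.IsTwoSided.pow_add]; exact Ideal.mul_mem_mul hu hv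
    · rw [add_comm, Ideal.IsTwoSided.pow_add]; exact Ideal.mul_mem_mul hv hu
  have hcab : c * (a * b - b * a) ∈ augIdeal Γ ^ (m + n + 1) := by
    rw [Ideal.IsTwoSided.pow_succ]; exact Ideal.mul_mem_mul hc hab
  have e1 : magnusHom Γ (m + n) (g⁻¹ * h⁻¹) *
      (magnusHom Γ (m + n) h * magnusHom Γ (m + n) g) = 1 := by
    rw [← map_mul, ← map_mul, show g⁻¹ * h⁻¹ * (h * g) = 1 by group, map_one]
  have e2 := congrArg Units.val e1
  simp only [Units.val_mul, Units.val_one, hu1, hv1, hc1] at e2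
  have h1 : (magnusHom Γ (m + n) (g⁻¹ * h⁻¹ * g * h)).val =
      1 + trunc Γ (m + n) (a * b - b * a + c * (a * b - b * a)) := by
    rw [mul_assoc (g⁻¹ * h⁻¹), map_mul, Units.val_mul, hc1, map_mul, Units.val_mul, hu1, hv1]
    have e3 : (1 + trunc Γ (m + n) c) *
        ((1 + trunc Γ (m + n) a) * (1 + trunc Γ (m + n) b)) =
        (1 + trunc Γ (m + n) c) * ((1 + trunc Γ (m + n) b) * (1 + trunc Γ (m + n) a)) +
        trunc Γ (m + n) (a * b - b * a + c * (a * b - b * a)) := by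
      simp only [map_add, map_sub, map_mul]
      noncomm_ring
    rw [e3, e2]
  rw [lead_eq h1, map_add, comp_eq_zero hcab (Nat.lt_succ_self _), add_zero, map_sub, hu2, hv2,
    comp_mul hu hv, add_comm m n, comp_mul hv hu]

theorem lead_sq {n : ℕ} {g : ProTwoRAAG Γ} (hg : g ∈ zassenhaus (ProTwoRAAG Γ) n) :
    lead (n + n) (g * g) = lead n g * lead n g := by
  obtain ⟨u, hu, hu1, hu2⟩ := exists_magnus (Nat.le_add_right n n) hg
  set a := magnus Γ u - 1
  have h1 : (magnusHom Γ (n + n) (g * g)).val = 1 + trunc Γ (n + n) (a * a) := by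
    have := one_add_pow_two_pow (trunc Γ (n + n) a) 1
    rw [pow_one, sq, sq, ← map_mul] at this
    rw [map_mul, Units.val_mul, hu1, this]
  rw [lead_eq h1, comp_mul hu hu, hu2]

theorem lead_gen (i : Fin d) : lead 1 (gen Γ i) = X Γ i := by
  have h1 : (magnusHom Γ 1 (gen Γ i)).val = 1 + trunc Γ 1 (X Γ i) := by
    rw [magnusHom_gen, val_unitX]
  rw [lead_eq h1, comp_apply, grade_X, Polynomial.coeff_monomial, if_pos rfl]

theorem exists_lead_eq_lift {n : ℕ} {a : FreeRestrictedLieTwo (Fin d)}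
    (ha : FreeRestrictedLieTwo.IsHomogeneous n a) :
    ∃ g ∈ zassenhaus (ProTwoRAAG Γ) n, lead n g = FreeRestrictedLieTwo.lift (X Γ) a := by
  induction ha with
  | of i => exact ⟨gen Γ i, mem_zassenhaus_one _, by rw [lead_gen, FreeRestrictedLieTwo.lift_of]⟩
  | zero n => exact ⟨1, one_mem _, by rw [lead_one, map_zero]⟩
  | @add n _ _ _ _ ha hb =>
    obtain ⟨g, hg, hga⟩ := ha
    obtain ⟨h, hh, hhb⟩ := hb
    rcases eq_or_ne n 0 with rfl | hn
    -- In degree zero `lead_mul` is unavailable, but units have constant term `1`, so all leading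
    -- terms vanish.
    · have h0 : ∀ k : ProTwoRAAG Γ, lead 0 k = 0 := fun k => by
        obtain ⟨c, hc, h⟩ := exists_unit_eq (magnusHom Γ 0 k)
        rw [lead_eq h]
        exact comp_eq_zero (n := 1) (by rwa [Submodule.pow_one]) Nat.one_pos
      exact ⟨1, one_mem _, by rw [map_add, ← hga, ← hhb, h0, h0, h0, add_zero]⟩
    · exact ⟨g * h, mul_mem hg hh, by rw [lead_mul hn hg hh, map_add, hga, hhb]⟩
  | lie _ _ ha hb =>
    obtain ⟨g, hg, hga⟩ := ha
    obtain ⟨h, hh, hhb⟩ := hb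
    exact ⟨g⁻¹ * h⁻¹ * g * h, commutator_mem_zassenhaus hg hh, by
      rw [lead_commutator hg hh, hga, hhb, FreeRestrictedLieTwo.lift_lie]⟩
  | sq _ ha =>
    obtain ⟨g, hg, hga⟩ := ha
    exact ⟨g * g, sq_mem_zassenhaus hg, by
      rw [lead_sq hg, hga, FreeRestrictedLieTwo.lift_sq]⟩

theorem exists_lead_eq_ofLie {n : ℕ} {x : graphLie Γ} (hx : x ∈ graphLieComponent Γ n) :
    ∃ g ∈ zassenhaus (ProTwoRAAG Γ) n, lead n g = ofLie Γ x := by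
  obtain ⟨a, ha, rfl⟩ := hx
  exact exists_lead_eq_lift ha

theorem exists_ofLie_eq_lead {n : ℕ} (hn : n ≠ 0) {g : ProTwoRAAG Γ}
    (hg : g ∈ zassenhaus (ProTwoRAAG Γ) n) :
    ∃ x ∈ graphLieComponent Γ n, ofLie Γ x = lead n g := by
  obtain ⟨w, hw, -, hw2⟩ := exists_magnus le_rfl hg
  rw [hw2]
  exact exists_ofLie_eq_comp_magnus hn hw

end GraphAlgebra

/-! ## Actions on truncations -/

namespace GraphAlgebra

open ProTwoRAAG

variable {d : ℕ} {Γ : SimpleGraph (Fin d)}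

variable (Γ) in
/-- The filtration of a truncation by the powers of the augmentation ideal. -/
def truncFil (n k : ℕ) : AddSubgroup (Trunc Γ n) :=
  (augIdeal Γ ^ k).toAddSubgroup.map (trunc Γ n).toRingHom.toAddMonoidHom

theorem trunc_mem_truncFil {n k : ℕ} {a : GraphAlgebra Γ} (ha : a ∈ augIdeal Γ ^ k) :
    trunc Γ n a ∈ truncFil Γ n k := ⟨a, ha, rfl⟩

theorem exists_trunc_eq {n k : ℕ} {y : Trunc Γ n} (hy : y ∈ truncFil Γ n k) :
    ∃ a ∈ augIdeal Γ ^ k, trunc Γ n a = y := hy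

theorem mem_truncFil_zero {n : ℕ} (y : Trunc Γ n) : y ∈ truncFil Γ n 0 := by
  obtain ⟨a, rfl⟩ := Ideal.Quotient.mkₐ_surjective (ZMod 2) (augIdeal Γ ^ (n + 1)) y
  exact ⟨a, by rw [Submodule.pow_zero, Ideal.one_eq_top]; trivial, rfl⟩

theorem eq_zero_of_mem_truncFil {n : ℕ} {y : Trunc Γ n} (hy : y ∈ truncFil Γ n (n + 1)) :
    y = 0 := by
  obtain ⟨a, ha, rfl⟩ := exists_trunc_eq hy
  exact trunc_eq_zero.2 ha

theorem mul_mem_truncFil {n k l : ℕ} {x y : Trunc Γ n} (hx : x ∈ truncFil Γ n k)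
    (hy : y ∈ truncFil Γ n l) : x * y ∈ truncFil Γ n (k + l) := by
  obtain ⟨a, ha, rfl⟩ := exists_trunc_eq hx
  obtain ⟨b, hb, rfl⟩ := exists_trunc_eq hy
  rw [← map_mul]
  refine trunc_mem_truncFil ?_
  rw [Ideal.IsTwoSided.pow_add]
  exact Ideal.mul_mem_mul ha hb

theorem truncFil_antitone (n : ℕ) : Antitone (truncFil Γ n) := fun _ _ h =>
  AddSubgroup.map_mono fun _ ha => Ideal.pow_le_pow_right h ha

theorem unit_sub_one_mem {n : ℕ} (u : (Trunc Γ n)ˣ) : u.val - 1 ∈ truncFil Γ n 1 := by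
  obtain ⟨a, ha, h⟩ := exists_unit_eq u
  rw [h, add_sub_cancel_left]
  exact trunc_mem_truncFil (by rwa [Submodule.pow_one])

theorem trunc_mem_truncFil_of_filtered {n : ℕ} (φ : GraphAlgebra Γ →ₐ[ZMod 2] Trunc Γ n)
    (hφ : ∀ i, φ (X Γ i) ∈ truncFil Γ n 1) {k : ℕ} {a : GraphAlgebra Γ}
    (ha : a ∈ augIdeal Γ ^ k) : φ a ∈ truncFil Γ n k := by
  refine Ideal.map_pow_mem (φ := φ.toRingHom) (F := truncFil Γ n)
    (fun x => mem_truncFil_zero _) (fun x hx => ?_)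
    (fun k a ha b hb => mul_mem_truncFil ha hb) ha
  obtain ⟨v, hv⟩ := exists_eq_sum x
  have h0 : aug Γ x = 0 := hx
  change φ x ∈ _
  rw [hv, h0, map_zero, zero_add, map_sum]
  refine sum_mem fun i _ => ?_
  rw [map_mul]
  have := mul_mem_truncFil (mem_truncFil_zero (φ (v i))) (hφ i)
  rwa [zero_add] at this

/-- The endomorphism of a truncation induced by an endomorphism of the pro-`2` right-angled
Artin group. -/
def endo (n : ℕ) (φ : ProTwoRAAG Γ →* ProTwoRAAG Γ) : Trunc Γ n →ₐ[ZMod 2] Trunc Γ n :=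
  Ideal.Quotient.liftₐ _ (lift (fun i => (magnusHom Γ n (φ (gen Γ i))).val - 1) fun u v h => by
      have h1 := congrArg (fun g => (magnusHom Γ n (φ g)).val) (gen_comm h)
      simp only [map_mul, Units.val_mul] at h1
      rw [← sub_eq_zero, ring_commutator_identity, h1, sub_self]) fun a ha =>
    eq_zero_of_mem_truncFil (trunc_mem_truncFil_of_filtered _ (fun i => by
      rw [lift_X]; exact unit_sub_one_mem _) ha)

theorem endo_trunc_X (n : ℕ) (φ : ProTwoRAAG Γ →* ProTwoRAAG Γ) (i : Fin d) :
    endo n φ (trunc Γ n (X Γ i)) = (magnusHom Γ n (φ (gen Γ i))).val - 1 :=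
  lift_X _ _ i

/-- Both sides define homomorphisms with open kernel that agree on generators. Functoriality of
`endo` and multiplicativity of `rep` follow from this equivariance. -/
theorem endo_magnusHom (n : ℕ) {φ : ProTwoRAAG Γ →* ProTwoRAAG Γ} (hφ : Continuous φ)
    (g : ProTwoRAAG Γ) : endo n φ (magnusHom Γ n g).val = (magnusHom Γ n (φ g)).val := by
  have h : (Units.map (endo n φ : Trunc Γ n →* Trunc Γ n)).comp (magnusHom Γ n) =
      (magnusHom Γ n).comp φ := by
    refine ProTwoRAAG.hom_ext (Subgroup.isOpen_mono (fun g (hg : magnusHom Γ n g = 1) => ?_)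
      (isOpen_ker_magnusHom n)) ((isOpen_ker_magnusHom n).preimage hφ) fun i => ?_
    · rw [MonoidHom.mem_ker, MonoidHom.comp_apply, hg, map_one]
    · refine Units.ext ?_
      change endo n φ (magnusHom Γ n (gen Γ i)).val = (magnusHom Γ n (φ (gen Γ i))).val
      rw [magnusHom_gen, val_unitX, map_add, map_one, endo_trunc_X, add_sub_cancel]
  exact congrArg Units.val (DFunLike.congr_fun h g)

theorem trunc_hom_ext {n : ℕ} {R : Type*} [Ring R] [Algebra (ZMod 2) R]
    {φ ψ : Trunc Γ n →ₐ[ZMod 2] R}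
    (h : ∀ i, φ (trunc Γ n (X Γ i)) = ψ (trunc Γ n (X Γ i))) : φ = ψ :=
  Ideal.Quotient.algHom_ext _ (hom_ext h)

theorem endo_id (n : ℕ) : endo n (MonoidHom.id (ProTwoRAAG Γ)) = AlgHom.id _ _ :=
  trunc_hom_ext fun i => by
    rw [endo_trunc_X, MonoidHom.id_apply, magnusHom_gen, val_unitX, add_sub_cancel_left]
    rfl

theorem endo_comp (n : ℕ) {φ ψ : ProTwoRAAG Γ →* ProTwoRAAG Γ} (hφ : Continuous φ) :
    endo n (φ.comp ψ) = (endo n φ).comp (endo n ψ) :=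
  trunc_hom_ext fun i => by
    rw [AlgHom.comp_apply, endo_trunc_X, endo_trunc_X, map_sub, map_one, endo_magnusHom n hφ]
    rfl

/-- The operator `φ - 1` is a twisted derivation, `φ(xy) - xy = (φx - x) φy + x (φy - y)`, so an
endomorphism trivial on generators modulo step two is trivial on every graded piece. -/
theorem sub_mem_of_generators {n : ℕ} {φ : Trunc Γ n →ₐ[ZMod 2] Trunc Γ n}
    (hφ : ∀ i, φ (trunc Γ n (X Γ i)) - trunc Γ n (X Γ i) ∈ truncFil Γ n 2) {k : ℕ}
    {y : Trunc Γ n} (hy : y ∈ truncFil Γ n k) : φ y - y ∈ truncFil Γ n (k + 1) := by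
  have hX : ∀ i, trunc Γ n (X Γ i) ∈ truncFil Γ n 1 := fun i =>
    trunc_mem_truncFil (by rw [Submodule.pow_one]; exact X_mem_augIdeal i)
  have hX' : ∀ i, φ (trunc Γ n (X Γ i)) ∈ truncFil Γ n 1 := fun i => by
    have := add_mem (truncFil_antitone n one_le_two (hφ i)) (hX i)
    rwa [sub_add_cancel] at this
  have hmul : ∀ {i j : ℕ} {x y : Trunc Γ n}, φ x - x ∈ truncFil Γ n (i + 1) →
      x ∈ truncFil Γ n i → φ y ∈ truncFil Γ n j → φ y - y ∈ truncFil Γ n (j + 1) →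
      φ (x * y) - x * y ∈ truncFil Γ n (i + j + 1) := by
    intro i j x y h1 h2 h3 h4
    have h : φ (x * y) - x * y = (φ x - x) * φ y + x * (φ y - y) := by
      rw [map_mul]; noncomm_ring
    rw [h]
    refine add_mem ?_ ?_
    · rw [show i + j + 1 = i + 1 + j by omega]; exact mul_mem_truncFil h1 h3
    · rw [add_assoc]; exact mul_mem_truncFil h2 h4
  have hsum : ∀ a : GraphAlgebra Γ, ∃ v : Fin d → GraphAlgebra Γ,
      φ (trunc Γ n a) - trunc Γ n a = ∑ i, (φ (trunc Γ n (v i * X Γ i)) -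
        trunc Γ n (v i * X Γ i)) := fun a => by
    obtain ⟨v, hv⟩ := exists_eq_sum a
    refine ⟨v, ?_⟩
    conv_lhs => rw [hv]
    simp only [map_add, AlgHom.commutes, map_sum, Finset.sum_sub_distrib, add_sub_add_left_eq_sub]
  have h1 : ∀ a : GraphAlgebra Γ, φ (trunc Γ n a) - trunc Γ n a ∈ truncFil Γ n 1 := fun a => by
    obtain ⟨v, hv⟩ := hsum a
    rw [hv]
    refine sum_mem fun i _ => ?_
    rw [map_mul, map_mul]
    have e1 := mul_mem_truncFil (mem_truncFil_zero (φ (trunc Γ n (v i)))) (hX' i)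
    have e2 := mul_mem_truncFil (mem_truncFil_zero (trunc Γ n (v i))) (hX i)
    rw [zero_add] at e1 e2
    exact sub_mem e1 e2
  have h2 : ∀ a ∈ augIdeal Γ, φ (trunc Γ n a) - trunc Γ n a ∈ truncFil Γ n 2 := fun a _ => by
    obtain ⟨v, hv⟩ := hsum a
    rw [hv]
    refine sum_mem fun i _ => ?_
    rw [map_mul (trunc Γ n)]
    exact hmul (i := 0) (j := 1) (h1 _) (mem_truncFil_zero _) (hX' i) (hφ i)
  have h3 : ∀ (k : ℕ) (a : GraphAlgebra Γ), a ∈ augIdeal Γ ^ k →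
      φ (trunc Γ n a) - trunc Γ n a ∈ truncFil Γ n (k + 1) := by
    intro k
    induction k with
    | zero => exact fun a _ => h1 a
    | succ k ih =>
      intro a ha
      rw [Submodule.pow_succ] at ha
      refine Submodule.mul_induction_on ha (fun x hx y hy => ?_) fun x y hx hy => ?_
      · rw [map_mul (trunc Γ n)]
        have e : trunc Γ n y ∈ truncFil Γ n 1 :=
          trunc_mem_truncFil (by rwa [Submodule.pow_one])
        refine hmul (ih x hx) (trunc_mem_truncFil hx) ?_ (h2 y hy)
        have := add_mem (truncFil_antitone n one_le_two (h2 y hy)) e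
        rwa [sub_add_cancel] at this
      · rw [map_add, map_add, add_sub_add_comm]
        exact add_mem hx hy
  obtain ⟨a, ha, rfl⟩ := exists_trunc_eq hy
  exact h3 k a ha

end GraphAlgebra

/-! ## `Δ`-RAAGs -/

namespace DeltaRAAG

open GraphAlgebra ProTwoRAAG

variable {d : ℕ} {Γ : SimpleGraph (Fin d)} {δ : DeltaGroup →* MulAut (ProTwoRAAG Γ)}

theorem continuous_leftRight :
    Continuous fun g : DeltaRAAG Γ δ => (g.left, g.right) := continuous_induced_dom

theorem continuous_inl :
    Continuous (SemidirectProduct.inl : ProTwoRAAG Γ →* DeltaRAAG Γ δ) :=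
  continuous_induced_rng.2 (continuous_id.prodMk continuous_const)

/-- A set that depends only on the finite data `μ_n(g.left)` and `g.right` is open in the product
topology. -/
theorem isOpen_of_magnusHom {n : ℕ} {S : Set (DeltaRAAG Γ δ)}
    (hS : ∀ g h : DeltaRAAG Γ δ, magnusHom Γ n g.left = magnusHom Γ n h.left →
      g.right = h.right → g ∈ S → h ∈ S) : IsOpen S := by
  have h1 : S = (fun g : DeltaRAAG Γ δ => (g.left, g.right)) ⁻¹'
      {p | (⟨p.1, p.2⟩ : DeltaRAAG Γ δ) ∈ S} := rfl
  rw [h1]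
  refine IsOpen.preimage continuous_leftRight (isOpen_prod_iff.2 fun l a hla => ?_)
  refine ⟨{l' | magnusHom Γ n (l⁻¹ * l') = 1}, {a},
    (isOpen_ker_magnusHom n).preimage (continuous_const_mul l⁻¹), isOpen_discrete _, ?_,
    rfl, ?_⟩
  · simp
  · rintro ⟨l', a'⟩ ⟨hl', ha'⟩
    rw [Set.mem_ofPred_eq, map_mul, map_inv, inv_mul_eq_one] at hl'
    exact hS ⟨l, a⟩ ⟨l', a'⟩ hl' (Set.mem_singleton_iff.1 ha').symm hla

/-- The action of a `Δ`-RAAG on a truncation of the associative algebra of the graph. -/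
def rep (hδ : ∀ a, Continuous (δ a)) (n : ℕ) :
    DeltaRAAG Γ δ →* Module.End (ZMod 2) (Trunc Γ n) where
  toFun g := LinearMap.mulLeft (ZMod 2) (magnusHom Γ n g.left).val ∘ₗ
    (endo n (δ g.right).toMonoidHom).toLinearMap
  map_one' := LinearMap.ext fun y => by
    have h : endo n (δ (1 : DeltaRAAG Γ δ).right).toMonoidHom = AlgHom.id _ (Trunc Γ n) := by
      rw [SemidirectProduct.one_right, map_one]
      exact endo_id n
    rw [LinearMap.comp_apply, AlgHom.toLinearMap_apply, h, SemidirectProduct.one_left]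
    simp
  map_mul' g h := LinearMap.ext fun y => by
    have h1 : endo (Γ := Γ) n (δ (g * h).right).toMonoidHom =
        (endo n (δ g.right).toMonoidHom).comp (endo n (δ h.right).toMonoidHom) := by
      rw [SemidirectProduct.mul_right, map_mul, ← endo_comp n (hδ g.right)]
      rfl
    have h2 := endo_magnusHom n (φ := (δ g.right).toMonoidHom) (hδ g.right) h.left
    change (magnusHom Γ n (g * h).left).val * endo n (δ (g * h).right).toMonoidHom y =
      (magnusHom Γ n g.left).val * endo n (δ g.right).toMonoidHom
        ((magnusHom Γ n h.left).val * endo n (δ h.right).toMonoidHom y)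
    rw [h1, map_mul (endo n _), h2, SemidirectProduct.mul_left, map_mul, Units.val_mul, mul_assoc]
    rfl

theorem rep_apply (hδ : ∀ a, Continuous (δ a)) (n : ℕ) (g : DeltaRAAG Γ δ) (y : Trunc Γ n) :
    rep hδ n g y = (magnusHom Γ n g.left).val * endo n (δ g.right).toMonoidHom y := rfl

/-- The kernel of the action on a truncation. -/
def repKer (hδ : ∀ a, Continuous (δ a)) (n : ℕ) : OpenNormalSubgroup (DeltaRAAG Γ δ) :=
  { toOpenSubgroup := ⟨(rep hδ n).ker, isOpen_of_magnusHom (n := n) fun g h h1 h2 hg => by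
      have hg : rep hδ n g = 1 := hg
      change rep hδ n h = 1
      rw [← hg]
      refine LinearMap.ext fun y => ?_
      rw [rep_apply, rep_apply, h1, h2]⟩
    isNormal' := inferInstanceAs (rep hδ n).ker.Normal }

/-! ### Triviality of the `Δ`-action on graded pieces -/

theorem deltaGroup_eq (a : DeltaGroup) : a = 1 ∨ a = DeltaGroup.x₀ := by
  revert a; decide

/-- An explicit form of `u⁻¹ v⁻¹ u ≡ v` modulo `I²`: conjugation contributes a commutator of `u - 1`
and `v - 1`, and inversion contributes the square of `v - 1`, because `2 = 0`. -/
theorem conj_inv_sub {R : Type*} [Ring R] [Algebra (ZMod 2) R] (u v : Rˣ) :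
    (u⁻¹ * v⁻¹ * u).val - 1 - (v.val - 1) =
      (u⁻¹ * v⁻¹).val * ((u.val - 1) * (v.val - 1) - (v.val - 1) * (u.val - 1)) * (v⁻¹).val -
        (v.val - 1) * (v.val - 1) * (v⁻¹).val := by
  have h2 : (v.val - 1) * (v.val - 1) = v.val * v.val - 1 := by
    have := algebra_add_self (v.val - 1)
    rw [← sub_eq_zero, ← neg_eq_zero, ← this]
    noncomm_ring
  have hgrp1 : u⁻¹ * v⁻¹ * (u * v) * v⁻¹ = u⁻¹ * v⁻¹ * u := by
    rw [← mul_assoc, mul_inv_cancel_right]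
  have hgrp2 : u⁻¹ * v⁻¹ * (v * u) * v⁻¹ = v⁻¹ := by
    rw [← mul_inv_rev, inv_mul_cancel, one_mul]
  have e1 : (u⁻¹ * v⁻¹).val * (u.val * v.val - v.val * u.val) * (v⁻¹).val =
      (u⁻¹ * v⁻¹ * u).val - (v⁻¹).val := by
    rw [mul_sub, sub_mul, ← Units.val_mul u v, ← Units.val_mul v u,
      ← Units.val_mul, ← Units.val_mul, ← Units.val_mul, ← Units.val_mul, hgrp1, hgrp2]
  have e2 : (v.val * v.val - 1) * (v⁻¹).val = v.val - (v⁻¹).val := by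
    rw [sub_mul, mul_assoc, Units.mul_inv, mul_one, one_mul]
  rw [h2, ring_commutator_identity, e1, e2]
  abel

variable {z : Fin d → ProTwoRAAG Γ}

theorem endo_sub_mem (hδ : IsDeltaRAAGAction Γ z δ) (n : ℕ) (a : DeltaGroup) {k : ℕ}
    {y : Trunc Γ n} (hy : y ∈ truncFil Γ n k) :
    endo n (δ a).toMonoidHom y - y ∈ truncFil Γ n (k + 1) := by
  obtain rfl | rfl := deltaGroup_eq a
  · have h : endo n (δ 1).toMonoidHom = AlgHom.id _ (Trunc Γ n) := by
      rw [map_one]; exact endo_id n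
    rw [h, AlgHom.id_apply, sub_self]
    exact zero_mem _
  · refine sub_mem_of_generators (fun i => ?_) hy
    rw [endo_trunc_X]
    have h1 : (δ DeltaGroup.x₀).toMonoidHom (gen Γ i) = (z i)⁻¹ * (gen Γ i)⁻¹ * z i :=
      hδ.conj i
    rw [h1]
    have hX : trunc Γ n (X Γ i) = (magnusHom Γ n (gen Γ i)).val - 1 := by
      rw [magnusHom_gen, val_unitX, add_sub_cancel_left]
    have hu1 := unit_sub_one_mem (magnusHom Γ n (z i))
    have hv1 := unit_sub_one_mem (magnusHom Γ n (gen Γ i))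
    have h3 : magnusHom Γ n ((z i)⁻¹ * (gen Γ i)⁻¹ * z i) =
        (magnusHom Γ n (z i))⁻¹ * (magnusHom Γ n (gen Γ i))⁻¹ * magnusHom Γ n (z i) := by
      rw [map_mul, map_mul, map_inv, map_inv]
    rw [hX, h3, conj_inv_sub]
    have huv := mul_mem_truncFil hu1 hv1
    have hvu := mul_mem_truncFil hv1 hu1
    have hvv := mul_mem_truncFil hv1 hv1
    have h4 := mul_mem_truncFil (mul_mem_truncFil (mem_truncFil_zero
      ((magnusHom Γ n (z i))⁻¹ * (magnusHom Γ n (gen Γ i))⁻¹).val) (sub_mem huv hvu))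
      (mem_truncFil_zero ((magnusHom Γ n (gen Γ i))⁻¹).val)
    have h5 := mul_mem_truncFil hvv (mem_truncFil_zero ((magnusHom Γ n (gen Γ i))⁻¹).val)
    rw [zero_add, add_zero] at h4
    rw [add_zero] at h5
    exact sub_mem h4 h5

variable (Γ) in
/-- The endomorphisms which raise the filtration degree by at least `k`. -/
def raiseFil (n k : ℕ) : AddSubgroup (Module.End (ZMod 2) (Trunc Γ n)) where
  carrier := {T | ∀ j, ∀ y ∈ truncFil Γ n j, T y ∈ truncFil Γ n (j + k)}
  zero_mem' _ _ _ := zero_mem _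
  add_mem' hS hT j y hy := add_mem (hS j y hy) (hT j y hy)
  neg_mem' hT j y hy := neg_mem (hT j y hy)

/-- Decompose `g - 1` as `(μ(g.left) - 1) δ + (δ - 1)`. Multiplication by `μ(g.left) - 1` raises the
filtration by one, and so does `δ - 1`. -/
theorem rep_sub_one_mem (hδ : IsDeltaRAAGAction Γ z δ) (n : ℕ) (g : DeltaRAAG Γ δ) :
    rep hδ.continuous n g - 1 ∈ raiseFil Γ n 1 := by
  intro j y hy
  have h1 := endo_sub_mem hδ n g.right hy
  have h2 : endo n (δ g.right).toMonoidHom y ∈ truncFil Γ n j := by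
    have := add_mem (truncFil_antitone n j.le_succ h1) hy
    rwa [sub_add_cancel] at this
  have h3 : (rep hδ.continuous n g - 1) y =
      ((magnusHom Γ n g.left).val - 1) * endo n (δ g.right).toMonoidHom y +
        (endo n (δ g.right).toMonoidHom y - y) := by
    rw [LinearMap.sub_apply, rep_apply, Module.End.one_apply, sub_mul, one_mul]
    abel
  rw [h3]
  have h4 := mul_mem_truncFil (unit_sub_one_mem (magnusHom Γ n g.left)) h2
  rw [add_comm 1 j] at h4
  exact add_mem h4 h1

theorem left_mem_zassenhaus (hδ : IsDeltaRAAGAction Γ z δ) {n : ℕ} {g : DeltaRAAG Γ δ}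
    (hg : g ∈ zassenhaus (DeltaRAAG Γ δ) (n + 1)) :
    g.left ∈ zassenhaus (ProTwoRAAG Γ) (n + 1) := by
  set φ := CompletedGroupAlgebra.lift (rep hδ.continuous n) (repKer hδ.continuous n) le_rfl
    with hφ
  have hφ1 : ∀ x ∈ completedAugmentationIdeal (DeltaRAAG Γ δ), φ x ∈ raiseFil Γ n 1 :=
    fun x hx => CompletedGroupAlgebra.lift_mem _ _ _ (rep_sub_one_mem hδ n) hx
  -- An element is a scalar plus an element of the augmentation ideal; scalars preserve the
  -- filtration.
  have hφ0 : ∀ x, φ x ∈ raiseFil Γ n 0 := fun x => by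
    have hx : x - algebraMap (ZMod 2) _ (completedAugmentation _ x) ∈
        completedAugmentationIdeal (DeltaRAAG Γ δ) :=
      CompletedGroupAlgebra.sub_algebraMap_mem x
    have h1 := hφ1 _ hx
    have h2 : φ x = φ (x - algebraMap (ZMod 2) _ (completedAugmentation _ x)) +
        algebraMap (ZMod 2) _ (completedAugmentation _ x) := by
      rw [map_sub, AlgHom.commutes, sub_add_cancel]
    rw [h2]
    refine add_mem (fun j y hy => truncFil_antitone n (Nat.le_succ _) (h1 j y hy)) ?_
    obtain h | h := zmod_two_eq_zero_or_one (completedAugmentation _ x)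
    · rw [h, map_zero]; exact zero_mem _
    · rw [h, map_one]; exact fun j y hy => hy
  -- Evaluate at `1`, of filtration degree `0`: the result lies in step `n + 1`, which is zero. For
  -- `g - 1` it equals `μ_n(g.left) - 1`, as the endomorphism part fixes `1`.
  have h := Ideal.map_pow_mem (φ := φ.toRingHom) (F := raiseFil Γ n) hφ0 hφ1
    (fun k S hS T hT j y hy => by
      have := hS _ _ (hT j y hy)
      rwa [add_assoc, add_comm 1 k] at this) (mem_zassenhaus.1 hg) 0 1 (mem_truncFil_zero _)
  rw [zero_add] at h
  have h' := eq_zero_of_mem_truncFil h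
  change φ (toCompletedGroupAlgebra _ g - 1) 1 = 0 at h'
  have hval : φ (toCompletedGroupAlgebra _ g - 1) = rep hδ.continuous n g - 1 := by
    rw [map_sub φ, map_one φ]
    exact congrArg (· - 1) (CompletedGroupAlgebra.lift_apply _ _ _ g)
  rw [hval, LinearMap.sub_apply, rep_apply,
    map_one (endo n _), mul_one, Module.End.one_apply, sub_eq_zero, Units.val_eq_one] at h'
  exact mem_zassenhaus_succ.2 h'

/-! ### Detection of the component in `Δ` -/

variable (Γ δ) in
/-- The homomorphism to the units of the dual numbers which detects the second component. -/
def dualHom : DeltaRAAG Γ δ →* DualNumber (ZMod 2) where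
  toFun g := 1 + TrivSqZeroExt.inr (Multiplicative.toAdd g.right)
  map_one' := by simp
  map_mul' g h := by
    rw [SemidirectProduct.mul_right, toAdd_mul, TrivSqZeroExt.inr_add, mul_add, add_mul, add_mul,
      TrivSqZeroExt.inr_mul_inr]
    simp [add_assoc]

variable (Γ δ) in
/-- The kernel of `dualHom`. -/
def dualKer : OpenNormalSubgroup (DeltaRAAG Γ δ) :=
  { toOpenSubgroup := ⟨(dualHom Γ δ).ker, isOpen_of_magnusHom (n := 0) fun g h _ h2 hg => by
      have hg : 1 + TrivSqZeroExt.inr (Multiplicative.toAdd g.right) =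
        (1 : DualNumber (ZMod 2)) := hg
      rw [h2] at hg
      exact hg⟩
    isNormal' := inferInstanceAs (dualHom Γ δ).ker.Normal }

/-- The filtration of the dual numbers. -/
def dualFil (k : ℕ) : AddSubgroup (DualNumber (ZMod 2)) where
  carrier := {x | (1 ≤ k → x.fst = 0) ∧ (2 ≤ k → x.snd = 0)}
  zero_mem' := by simp
  add_mem' ha hb := ⟨fun h => by simp [ha.1 h, hb.1 h], fun h => by simp [ha.2 h, hb.2 h]⟩
  neg_mem' ha := ⟨fun h => by simp [ha.1 h], fun h => by simp [ha.2 h]⟩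

/-- The augmentation ideal maps into `(ε)` and its square to zero, so `1 + ε a = 1` for the
`Δ`-component `a`. This is where `n ≥ 2` enters; in degree one `Δ` contributes an extra class. -/
theorem right_eq_one {n : ℕ} (hn : 2 ≤ n) {g : DeltaRAAG Γ δ}
    (hg : g ∈ zassenhaus (DeltaRAAG Γ δ) n) : g.right = 1 := by
  have hg := CompletedGroupAlgebra.zassenhaus_antitone hn hg
  set φ := CompletedGroupAlgebra.lift (dualHom Γ δ) (dualKer Γ δ) le_rfl with hφ
  have h := Ideal.map_pow_mem (φ := φ.toRingHom) (F := dualFil)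
    (fun x => ⟨fun h => absurd h (by norm_num), fun h => absurd h (by norm_num)⟩)
    (fun x hx => CompletedGroupAlgebra.lift_mem (dualHom Γ δ) (dualKer Γ δ) le_rfl (F := dualFil 1)
      (fun g => ⟨fun _ => by simp [dualHom], fun h => absurd h (by norm_num)⟩) hx)
    (fun k a ha b hb => ⟨fun _ => by
      rw [TrivSqZeroExt.fst_mul, hb.1 le_rfl, mul_zero], fun h => by
      rw [TrivSqZeroExt.snd_mul, hb.1 le_rfl, ha.1 (by omega)]; simp⟩)
    (mem_zassenhaus.1 hg)
  have h2 := h.2 le_rfl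
  change (φ (toCompletedGroupAlgebra _ g - 1)).snd = 0 at h2
  have hval : φ (toCompletedGroupAlgebra _ g) = dualHom Γ δ g :=
    CompletedGroupAlgebra.lift_apply _ _ _ g
  rw [map_sub, map_one, hval] at h2
  have h3 : Multiplicative.toAdd g.right = 0 := by simpa [dualHom] using h2
  exact h3

theorem map_inl_zassenhaus (hδ : IsDeltaRAAGAction Γ z δ) {n : ℕ} (hn : 2 ≤ n) :
    (zassenhaus (ProTwoRAAG Γ) n).map SemidirectProduct.inl = zassenhaus (DeltaRAAG Γ δ) n := by
  refine le_antisymm (CompletedGroupAlgebra.map_zassenhaus_le _ continuous_inl n) fun g hg => ?_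
  obtain ⟨m, rfl⟩ : ∃ m, n = m + 1 := ⟨n - 1, by omega⟩
  exact ⟨g.left, left_mem_zassenhaus hδ hg,
    SemidirectProduct.ext rfl (right_eq_one hn hg).symm⟩

theorem left_mem (hδ : IsDeltaRAAGAction Γ z δ) {n : ℕ} (hn : 2 ≤ n) {g : DeltaRAAG Γ δ}
    (hg : g ∈ zassenhaus (DeltaRAAG Γ δ) n) : g.left ∈ zassenhaus (ProTwoRAAG Γ) n := by
  rw [← map_inl_zassenhaus hδ hn] at hg
  obtain ⟨l, hl, rfl⟩ := hg
  exact hl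

theorem left_mul_of_mem {n : ℕ} (hn : 2 ≤ n) {g : DeltaRAAG Γ δ}
    (hg : g ∈ zassenhaus (DeltaRAAG Γ δ) n) (h : DeltaRAAG Γ δ) :
    (g * h).left = g.left * h.left := by
  rw [SemidirectProduct.mul_left, right_eq_one hn hg, map_one, MulAut.one_apply]

/-- The isomorphism between a graded piece of the Zassenhaus filtration of a `Δ`-RAAG and the
corresponding component of the restricted Lie algebra of the graph. -/
theorem exists_gradedEquiv (hδ : IsDeltaRAAGAction Γ z δ) (n : ℕ) (hn : 2 ≤ n) :
    ∃ e : zassenhausGraded (DeltaRAAG Γ δ) n ≃+ graphLieComponent Γ n,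
      ∀ (g : DeltaRAAG Γ δ) (hg : g ∈ zassenhaus (DeltaRAAG Γ δ) n),
        ofLie Γ (e (zassenhausClass g hg) : graphLie Γ) = lead n g.left := by
  have hn0 : n ≠ 0 := by omega
  -- The class is defined through its image in the associative algebra; injectivity of `ofLie` makes
  -- the choice unique and additive.
  choose f hf hf' using fun g : zassenhaus (DeltaRAAG Γ δ) n =>
    exists_ofLie_eq_lead hn0 (left_mem hδ hn g.2)
  let φ : zassenhaus (DeltaRAAG Γ δ) n →* Multiplicative (graphLieComponent Γ n) :=
    MonoidHom.mk' (fun g => Multiplicative.ofAdd ⟨f g, hf g⟩) fun g h =>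
      Multiplicative.toAdd.injective (Subtype.ext (ofLie_injective Γ (by
        change ofLie Γ (f (g * h)) = ofLie Γ (f g + f h)
        rw [map_add, hf', hf', hf', Subgroup.coe_mul, left_mul_of_mem hn g.2,
          lead_mul hn0 (left_mem hδ hn g.2) (left_mem hδ hn h.2)])))
  -- A vanishing leading term puts `g.left` one step deeper; as `g.right = 1`, the element `g` is
  -- the image of `g.left` and goes deeper with it.
  have hker : ∀ g : zassenhaus (DeltaRAAG Γ δ) n, φ g = 1 ↔
      g ∈ (zassenhaus (DeltaRAAG Γ δ) (n + 1)).subgroupOf (zassenhaus (DeltaRAAG Γ δ) n) := by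
    intro g
    have h1 : φ g = 1 ↔ f g = 0 := Subtype.ext_iff (a2 := (0 : graphLieComponent Γ n))
    rw [h1, ← map_eq_zero_iff _ (ofLie_injective Γ), hf', lead_eq_zero (left_mem hδ hn g.2),
      Subgroup.mem_subgroupOf]
    refine ⟨fun h => ?_, fun h => left_mem hδ (hn.trans n.le_succ) h⟩
    rw [← map_inl_zassenhaus hδ (hn.trans n.le_succ)]
    exact ⟨_, h, SemidirectProduct.ext rfl (right_eq_one hn g.2).symm⟩
  let ψ := QuotientGroup.lift _ φ fun g hg => (hker g).2 hg
  have hψ : Function.Bijective ψ := by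
    refine ⟨(injective_iff_map_eq_one _).2 fun q hq => ?_, fun y => ?_⟩
    · obtain ⟨g, rfl⟩ := QuotientGroup.mk_surjective q
      exact (QuotientGroup.eq_one_iff g).2 ((hker g).1 hq)
    · obtain ⟨l, hl, hly⟩ := exists_lead_eq_ofLie (Multiplicative.toAdd y).2
      have hg : (SemidirectProduct.inl l : DeltaRAAG Γ δ) ∈ zassenhaus (DeltaRAAG Γ δ) n :=
        map_inl_zassenhaus hδ hn ▸ ⟨l, hl, rfl⟩
      refine ⟨QuotientGroup.mk ⟨_, hg⟩, ?_⟩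
      refine Multiplicative.toAdd.injective (Subtype.ext (ofLie_injective Γ ?_))
      rw [← hly]
      exact hf' ⟨_, hg⟩
  exact ⟨AddEquiv.ofBijective (MonoidHom.toAdditiveLeft ψ) hψ, fun g hg => hf' ⟨g, hg⟩⟩

end DeltaRAAG

end

/-! ### Compatibility of the graded isomorphisms -/

theorem mainTheorem6 {d : ℕ} (Γ : SimpleGraph (Fin d)) (z : Fin d → ProTwoRAAG Γ)
    (δ : DeltaGroup →* MulAut (ProTwoRAAG Γ)) (hδ : IsDeltaRAAGAction Γ z δ) :
    (∀ n : ℕ, 2 ≤ n →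
      (zassenhaus (ProTwoRAAG Γ) n).map SemidirectProduct.inl = zassenhaus (DeltaRAAG Γ δ) n) ∧
    ∃ e : ∀ n : ℕ, 2 ≤ n → (zassenhausGraded (DeltaRAAG Γ δ) n ≃+ graphLieComponent Γ n),
      (∀ (m n : ℕ) (hm : 2 ≤ m) (hn : 2 ≤ n) (g h : DeltaRAAG Γ δ)
        (hg : g ∈ zassenhaus (DeltaRAAG Γ δ) m) (hh : h ∈ zassenhaus (DeltaRAAG Γ δ) n),
        (e (m + n) (le_add_right hm) (zassenhausClass (g⁻¹ * h⁻¹ * g * h)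
            (commutator_mem_zassenhaus hg hh)) : graphLie Γ) =
          ⁅(e m hm (zassenhausClass g hg) : graphLie Γ),
            (e n hn (zassenhausClass h hh) : graphLie Γ)⁆) ∧
      (∀ (n : ℕ) (hn : 2 ≤ n) (g : DeltaRAAG Γ δ) (hg : g ∈ zassenhaus (DeltaRAAG Γ δ) n),
        (e (n + n) (le_add_right hn) (zassenhausClass (g * g) (sq_mem_zassenhaus hg)) :
            graphLie Γ) =
          RestrictedLieAlgebraTwo.sq (e n hn (zassenhausClass g hg) : graphLie Γ)) := by
  refine ⟨fun n hn => DeltaRAAG.map_inl_zassenhaus hδ hn, ?_⟩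
  choose e he using DeltaRAAG.exists_gradedEquiv hδ
  refine ⟨e, fun m n hm hn g h hg hh => ?_, fun n hn g hg => ?_⟩
  -- After embedding in the associative algebra, the compatibilities are the formulas for leading
  -- terms of commutators and squares.
  · refine GraphAlgebra.ofLie_injective Γ ?_
    have hgl := DeltaRAAG.left_mem hδ hm hg
    have hhl := DeltaRAAG.left_mem hδ hn hh
    rw [GraphAlgebra.ofLie_lie, he, he, he, ← GraphAlgebra.lead_commutator hgl hhl]
    -- In degrees at least two both elements come from `G_Γ`, so the left component of the
    -- commutator is the commutator of the left components.
    obtain ⟨l, -, rfl⟩ := DeltaRAAG.map_inl_zassenhaus hδ hm ▸ hg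
    obtain ⟨k, -, rfl⟩ := DeltaRAAG.map_inl_zassenhaus hδ hn ▸ hh
    simp only [← map_inv, ← map_mul, SemidirectProduct.left_inl]
  · refine GraphAlgebra.ofLie_injective Γ ?_
    rw [GraphAlgebra.ofLie_sq, he, he, DeltaRAAG.left_mul_of_mem hn hg,
      GraphAlgebra.lead_sq (DeltaRAAG.left_mem hδ hn hg)]
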